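/- **Setting.** Let $\xi:\Omega\to\Xi\subset\mathbb R$ be a random variable with law $\mu$ and density $w_\xi$. Let $T>0$, let $\mathcal U\subset\mathbb R^m$ be open, and let $F\in C^2(\mathcal U;\mathbb R^m)$ be such that $\mathrm DF(v)$ has $m$ distinct real eigenvalues for every $v\in\mathcal U$. Let $\eta,q\in C^2(\mathcal U;\mathbb R)$ be an entropy/entropy-flux pair, i.e. $\eta$ is strictly convex and $\mathrm D\eta\,\mathrm DF=\mathrm Dq$. Let $u=u(t,x,y)\in L^1(\Xi;L^1((0,T)\times\mathbb R;\mathcal U))$ be a random entropy solution of $\partial_t u+\partial_xF(u)=0$, $u(0,x,y)=u^0(x,y)$. That is, for $\mu$-a.e. $y$ the path $u(\cdot,\cdot,y)$ is a locally bounded weak solution that satisfies $\partial_t\eta(u)+\partial_xq(u)\le0$ weakly, initial datum included, and $u(t,\cdot,y)$ is taken from the representative that is weakly continuous in $t\in[0,T]$. **Discretization.** Let $(\Psi_i)_{i\in\mathbb N_0}$ be an orthonormal basis of $L^2_\xi(\Xi)=L^2(\Xi,\mu)$, with $\langle f,g\rangle=\int_\Xi fg\,d\mu$. Let $M,R\in\mathbb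 N_0$, with quadrature points $y_0,\dots,y_R\in\Xi$ and weights $w_0,\dots,w_R\in\mathbb R$. Let $0=t_0<\dots<t_N=T$, and let $V_p$ be the space of $\mathbb R^m$-valued piecewise polynomials of degree at most $p$ on a uniform triangulation of $\mathbb R$. For each $l$ let $u_h^n(\cdot,y_l)\in V_p$, $n=0,\dots,N$, be the numerical solutions at $y_l$ (for instance those of a Runge–Kutta discontinuous Galerkin scheme; any elements of $V_p$ are allowed). Let $\hat u^{st}(y_l):[0,T]\times\mathbb R\to\mathcal U$ be a reconstruction: any function that is Lipschitz continuous in $(t,x)$ with $\hat u^{st}(y_l)(t,\cdot)\in V_{p+1}\cap C^0(\mathbb R)$ for all $t$. Put $$u_h^n(x,y)=\sum_{i=0}^M\Big(\sum_{l=0}^R u_h^n(x,y_l)\Psi_i(y_l)w_l\Big)\Psi_i(y),\qquad \hat u^{sts}(t,x,y)=\sum_{i=0}^M\Big(\sum_{l=0}^R \hat u^{st}(y_l)(t,x)\Psi_i(y_l)w_l\Big)\Psi_i(y),$$ $$\mathcal R^{st}(y_l)=\partial_t\hat u^{st}(y_l)+\partial_xF(\hat u^{st}(y_l)),\qquad \mathcal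 R^{det}_j=\sum_{l=0}^R\mathcal R^{st}(y_l)\Psi_j(y_l)w_l,$$ $$\mathcal R^{sq}_j=\big\langle\partial_xF(\hat u^{sts}),\Psi_j\big\rangle-\sum_{l=0}^R\partial_xF(\hat u^{st}(y_l))\Psi_j(y_l)w_l,\qquad \mathcal R^{sc}_j=\big\langle\partial_xF(\hat u^{sts}),\Psi_j\big\rangle ,$$ and, with all norms in $L^2((0,t)\times\mathbb R)$ unless indicated otherwise, $$\mathcal E^{det}(t)=\sum_{j=0}^M\|\mathcal R^{det}_j\|^2,\quad \mathcal E^{sq}(t)=\sum_{j=0}^M\|\mathcal R^{sq}_j\|^2,\quad \mathcal E^{sc}(t)=\sum_{j>M}\|\mathcal R^{sc}_j\|^2,\quad \mathcal E_0=\|u^0-\hat u^{sts}(0,\cdot,\cdot)\|^2_{L^2_\xi(\Xi;L^2(\mathbb R))}.$$ **Constants.** Let $\mathcal C\subset\mathcal U$ be convex and compact, such that $u$ and $\hat u^{sts}$ take values in $\mathcal C$ (almost surely in $y$). Let $C_F>0$ and $0<\underline\eta<\overline\eta$ be such that, with the Euclidean norm, $|v^\top HF(a)v|\le C_F|v|^2$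 and $\underline\eta|v|^2\le v^\top H\eta(a)v\le\overline\eta|v|^2$ for all $v\in\mathbb R^m$, $a\in\mathcal C$, where $H$ denotes the Hessian. **Theorem.** For every $n=0,\dots,N$, $$\begin{aligned}\|u(t_n,\cdot,\cdot)-u_h^n\|^2_{L^2_\xi(\Xi;L^2(\mathbb R))}\le{}& 2\,\|\hat u^{sts}(t_n,\cdot,\cdot)-u_h^n\|^2_{L^2_\xi(\Xi;L^2(\mathbb R))}\\&+2\underline\eta^{-1}\Big(2\mathcal E^{det}(t_n)+2\mathcal E^{sq}(t_n)+\mathcal E^{sc}(t_n)+\overline\eta\,\mathcal E_0\Big)\\&\quad\times\exp\Big(\underline\eta^{-1}\int_0^{t_n}\big(\overline\eta\,C_F\,\|\partial_x\hat u^{sts}(t,\cdot,\cdot)\|_{L^\infty_\xi(\Xi;L^\infty(\mathbb R))}+\overline\eta^2\big)\,dt\Big),\end{aligned}$$ where both sides are read in $[0,\infty]$ (with $0\cdot\infty=0$). -/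

import Mathlib

open MeasureTheory Set
open scoped ENNReal

/-- The vectors `ℝᵐ` of conserved quantities, with the Euclidean norm. -/
abbrev StateVec (m : ℕ) : Type := EuclideanSpace ℝ (Fin m)

/-- `∂ₜ v` for a function `v = v(t, x)`. -/
noncomputable def dt {V : Type*} [NormedAddCommGroup V] [NormedSpace ℝ V]
    (v : ℝ → ℝ → V) (t x : ℝ) : V :=
  deriv (fun s => v s x) t

/-- `∂ₓ v` for a function `v = v(t, x)`. -/
noncomputable def dx {V : Type*} [NormedAddCommGroup V] [NormedSpace ℝ V]
    (v : ℝ → ℝ → V) (t x : ℝ) : V :=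
  deriv (fun z => v t z) x

/-! ### The conservation law -/

/-- The Jacobian of the flux has `m` distinct real eigenvalues at every state. -/
def StrictlyHyperbolic {m : ℕ} (U : Set (StateVec m)) (F : StateVec m → StateVec m) : Prop :=
  ∀ v ∈ U, ∃ ev : Fin m → ℝ, Function.Injective ev ∧
    ∀ i, Module.End.HasEigenvalue (fderiv ℝ F v : StateVec m →ₗ[ℝ] StateVec m) (ev i)

/-- `(η, q)` is an entropy / entropy-flux pair for the flux `F` on the open state space `U`.
As `U` need not be convex, `η` is asked to be strictly convex on the convex subsets of `U`. -/
structure IsEntropyPair {m : ℕ} (U : Set (StateVec m)) (F : StateVec m → StateVec m)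
    (η q : StateVec m → ℝ) : Prop where
  contDiffOn_entropy : ContDiffOn ℝ 2 η U
  contDiffOn_flux : ContDiffOn ℝ 2 q U
  strictConvexOn : ∀ s ⊆ U, Convex ℝ s → StrictConvexOn ℝ s η
  compat : ∀ v ∈ U, (fderiv ℝ η v).comp (fderiv ℝ F v) = fderiv ℝ q v

/-- The open space-time strip `(0, T) × ℝ`. -/
def strip (T : ℝ) : Set (ℝ × ℝ) := Ioo 0 T ×ˢ univ

/-- Lipschitz test functions on space-time whose compact support meets `t ≥ 0` in a compact
subset of `[0, T) × ℝ`. -/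
def IsTestFunction {V : Type*} [NormedAddCommGroup V] (T : ℝ) (φ : ℝ × ℝ → V) : Prop :=
  (∃ K, LipschitzWith K φ) ∧ HasCompactSupport φ ∧ tsupport φ ⊆ Iio T ×ˢ univ

/-- `u` is an entropy solution (admissible weak solution with respect to `(η, q)`) on
`[0, T) × ℝ` of `∂ₜ u + ∂ₓ F(u) = 0`, `u(0, ·) = u0`: a measurable, locally bounded function with
values in `U` that satisfies the equation and the entropy inequality, both with the initial datum,
in the weak sense. As usual, `u` stands for its representative that is weakly continuous in time,
so that `u(t, ·)` has a meaning for every `t ∈ [0, T]`. -/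
structure IsEntropySolution {m : ℕ} (U : Set (StateVec m)) (F : StateVec m → StateVec m)
    (η q : StateVec m → ℝ) (T : ℝ) (u0 : ℝ → StateVec m) (u : ℝ → ℝ → StateVec m) : Prop where
  aestronglyMeasurable :
    AEStronglyMeasurable (fun p : ℝ × ℝ => u p.1 p.2) (volume.restrict (strip T))
  aestronglyMeasurable_initial : AEStronglyMeasurable u0 volume
  locally_bounded : ∀ K : Set (ℝ × ℝ), IsCompact K → ∃ B : Set (StateVec m), IsCompact B ∧ B ⊆ U ∧
    ∀ᵐ p ∂(volume.restrict (K ∩ strip T)), u p.1 p.2 ∈ B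
  locally_bounded_initial : ∀ K : Set ℝ, IsCompact K → ∃ B : Set (StateVec m), IsCompact B ∧ B ⊆ U ∧
    ∀ᵐ x ∂(volume.restrict K), u0 x ∈ B
  weak_equation : ∀ φ : ℝ × ℝ → StateVec m, IsTestFunction T φ →
    (∫ p in strip T, (inner ℝ (dt (fun t x => φ (t, x)) p.1 p.2) (u p.1 p.2)
        + inner ℝ (dx (fun t x => φ (t, x)) p.1 p.2) (F (u p.1 p.2))))
      + ∫ x, inner ℝ (φ (0, x)) (u0 x) = 0
  entropy_inequality : ∀ ψ : ℝ × ℝ → ℝ, IsTestFunction T ψ → (∀ p, 0 ≤ ψ p) →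
    0 ≤ (∫ p in strip T, (dt (fun t x => ψ (t, x)) p.1 p.2 * η (u p.1 p.2)
        + dx (fun t x => ψ (t, x)) p.1 p.2 * q (u p.1 p.2)))
      + ∫ x, ψ (0, x) * η (u0 x)
  locallyIntegrable_slice : ∀ t ∈ Icc 0 T, LocallyIntegrable (u t) volume
  weakly_continuous : ∀ φ : ℝ → ℝ, Continuous φ → HasCompactSupport φ →
    ContinuousOn (fun t => ∫ x, φ x • u t x) (Icc 0 T)

/-- `u = u(t, x, y)` is a random entropy solution with random initial datum `u0 = u0(x, y)`:
it belongs to `L¹(Ξ; L¹((0, T) × ℝ))` and almost every path is an entropy solution.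
`μ` is the law of the random parameter. -/
structure IsRandomEntropySolution {m : ℕ} {Ξ : Type*} [MeasurableSpace Ξ] (μ : Measure Ξ)
    (U : Set (StateVec m)) (F : StateVec m → StateVec m) (η q : StateVec m → ℝ) (T : ℝ)
    (u0 : ℝ → Ξ → StateVec m) (u : ℝ → ℝ → Ξ → StateVec m) : Prop where
  measurable : Measurable (fun p : ℝ × ℝ × Ξ => u p.1 p.2.1 p.2.2)
  integrable : Integrable (fun p : Ξ × (ℝ × ℝ) => u p.2.1 p.2.2 p.1)
    (μ.prod (volume.restrict (strip T)))
  path : ∀ᵐ y ∂μ, IsEntropySolution U F η q T (fun x => u0 x y) (fun t x => u t x y)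

/-! ### Discretization -/

/-- The space of piecewise polynomials of degree at most `p` with values in `ℝᵐ` on the uniform
triangulation of `ℝ` with nodes `a + k h`, `k ∈ ℤ`. -/
def DGSpace (m : ℕ) (a h : ℝ) (p : ℕ) : Set (ℝ → StateVec m) :=
  {v | ∀ k : ℤ, ∃ P : Fin m → Polynomial ℝ, (∀ i, (P i).natDegree ≤ p) ∧
    ∀ x ∈ Ioo (a + k * h) (a + (k + 1) * h), ∀ i, v x i = (P i).eval x}

/-- A space-time reconstruction: at each time a continuous piecewise polynomial of degree at most
`p + 1`, and jointly Lipschitz continuous in time and space. -/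
structure IsReconstruction {m : ℕ} (a h : ℝ) (p : ℕ) (T : ℝ) (v : ℝ → ℝ → StateVec m) : Prop where
  mem_DGSpace : ∀ t ∈ Icc 0 T, v t ∈ DGSpace m a h (p + 1)
  continuous : ∀ t ∈ Icc 0 T, Continuous (v t)
  lipschitz : ∃ K, LipschitzOnWith K (fun z : ℝ × ℝ => v z.1 z.2) (Icc 0 T ×ˢ univ)

/-- The functions `Ψ i` form an orthonormal basis of `L²(μ)`. -/
def IsOrthonormalBasisL2 {Ξ : Type*} [MeasurableSpace Ξ] (μ : Measure Ξ) (Ψ : ℕ → Ξ → ℝ) : Prop :=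
  ∃ b : HilbertBasis ℕ ℝ (Lp ℝ 2 μ), ∀ i, (b i : Ξ → ℝ) =ᵐ[μ] Ψ i

section NISP

variable {m R : ℕ} {Ξ : Type*}

/-- The discrete orthogonal projection on the `i`-th mode, `∑ l, v l Ψᵢ(y l) w l`, of values `v l`
at the quadrature points. -/
noncomputable def nispMode (Ψ : ℕ → Ξ → ℝ) (yq : Fin (R + 1) → Ξ) (wq : Fin (R + 1) → ℝ)
    (i : ℕ) (v : Fin (R + 1) → StateVec m) : StateVec m :=
  ∑ l, (Ψ i (yq l) * wq l) • v l

/-- The non-intrusive spectral projection `∑ i ≤ M, (∑ l, v l Ψᵢ(y l) w l) Ψᵢ(y)`. -/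
noncomputable def nisp (Ψ : ℕ → Ξ → ℝ) (yq : Fin (R + 1) → Ξ) (wq : Fin (R + 1) → ℝ) (M : ℕ)
    (v : Fin (R + 1) → StateVec m) (y : Ξ) : StateVec m :=
  ∑ i ∈ Finset.range (M + 1), Ψ i y • nispMode Ψ yq wq i v

/-- The space-time-stochastic reconstruction built from the reconstructions `ust l` at the
quadrature points. -/
noncomputable def stsReconstruction (Ψ : ℕ → Ξ → ℝ) (yq : Fin (R + 1) → Ξ)
    (wq : Fin (R + 1) → ℝ) (M : ℕ) (ust : Fin (R + 1) → ℝ → ℝ → StateVec m)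
    (t x : ℝ) (y : Ξ) : StateVec m :=
  nisp Ψ yq wq M (fun l => ust l t x) y

/-- The space-time residual `∂ₜ v + ∂ₓ F(v)`. -/
noncomputable def stResidual (F : StateVec m → StateVec m) (v : ℝ → ℝ → StateVec m)
    (t x : ℝ) : StateVec m :=
  dt v t x + dx (fun s z => F (v s z)) t x

/-- The `j`-th mode of the deterministic residual. -/
noncomputable def detMode (F : StateVec m → StateVec m) (Ψ : ℕ → Ξ → ℝ) (yq : Fin (R + 1) → Ξ)
    (wq : Fin (R + 1) → ℝ) (ust : Fin (R + 1) → ℝ → ℝ → StateVec m)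
    (j : ℕ) (t x : ℝ) : StateVec m :=
  nispMode Ψ yq wq j (fun l => stResidual F (ust l) t x)

variable [MeasurableSpace Ξ]

/-- The `j`-th mode of the stochastic cut-off residual, `⟨∂ₓ F(ûˢᵗˢ), Ψⱼ⟩` (used for `j > M`). -/
noncomputable def scMode (μ : Measure Ξ) (F : StateVec m → StateVec m) (Ψ : ℕ → Ξ → ℝ)
    (yq : Fin (R + 1) → Ξ) (wq : Fin (R + 1) → ℝ) (M : ℕ)
    (ust : Fin (R + 1) → ℝ → ℝ → StateVec m) (j : ℕ) (t x : ℝ) : StateVec m :=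
  ∫ y, Ψ j y • dx (fun s z => F (stsReconstruction Ψ yq wq M ust s z y)) t x ∂μ

/-- The `j`-th mode of the stochastic quadrature residual,
`⟨∂ₓ F(ûˢᵗˢ), Ψⱼ⟩ - ∑ l, ∂ₓ F(ûˢᵗ(y l)) Ψⱼ(y l) w l`. -/
noncomputable def sqMode (μ : Measure Ξ) (F : StateVec m → StateVec m) (Ψ : ℕ → Ξ → ℝ)
    (yq : Fin (R + 1) → Ξ) (wq : Fin (R + 1) → ℝ) (M : ℕ)
    (ust : Fin (R + 1) → ℝ → ℝ → StateVec m) (j : ℕ) (t x : ℝ) : StateVec m :=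
  (∫ y, Ψ j y • dx (fun s z => F (stsReconstruction Ψ yq wq M ust s z y)) t x ∂μ)
    - nispMode Ψ yq wq j (fun l => dx (fun s z => F (ust l s z)) t x)

/-! ### Norms and residual quantities, with values in `[0, ∞]` -/

/-- `‖v‖²` in `L²((0, t) × ℝ)`. -/
noncomputable def sqNormST (t : ℝ) (v : ℝ → ℝ → StateVec m) : ℝ≥0∞ :=
  eLpNorm (fun p : ℝ × ℝ => v p.1 p.2) 2 (volume.restrict (strip t)) ^ 2

/-- `‖f‖²` in `L²(Ξ; L²(ℝ))`, for `f = f(x, y)`. -/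
noncomputable def sqNormXi (μ : Measure Ξ) (f : ℝ → Ξ → StateVec m) : ℝ≥0∞ :=
  ∫⁻ y, eLpNorm (fun x => f x y) 2 volume ^ 2 ∂μ

/-- `‖f‖` in `L^∞(Ξ; L^∞(ℝ))`, for `f = f(x, y)`. -/
noncomputable def supNormXi (μ : Measure Ξ) (f : ℝ → Ξ → StateVec m) : ℝ≥0∞ :=
  essSup (fun y => eLpNorm (fun x => f x y) ∞ volume) μ

/-- The deterministic residual `∑ j ≤ M, ‖detⱼ‖²`. -/
noncomputable def detResidual (F : StateVec m → StateVec m) (Ψ : ℕ → Ξ → ℝ)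
    (yq : Fin (R + 1) → Ξ) (wq : Fin (R + 1) → ℝ) (M : ℕ)
    (ust : Fin (R + 1) → ℝ → ℝ → StateVec m) (t : ℝ) : ℝ≥0∞ :=
  ∑ j ∈ Finset.range (M + 1), sqNormST t (detMode F Ψ yq wq ust j)

/-- The stochastic quadrature residual `∑ j ≤ M, ‖sqⱼ‖²`. -/
noncomputable def sqResidual (μ : Measure Ξ) (F : StateVec m → StateVec m) (Ψ : ℕ → Ξ → ℝ)
    (yq : Fin (R + 1) → Ξ) (wq : Fin (R + 1) → ℝ) (M : ℕ)
    (ust : Fin (R + 1) → ℝ → ℝ → StateVec m) (t : ℝ) : ℝ≥0∞ :=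
  ∑ j ∈ Finset.range (M + 1), sqNormST t (sqMode μ F Ψ yq wq M ust j)

/-- The stochastic cut-off residual `∑ j > M, ‖scⱼ‖²`. -/
noncomputable def scResidual (μ : Measure Ξ) (F : StateVec m → StateVec m) (Ψ : ℕ → Ξ → ℝ)
    (yq : Fin (R + 1) → Ξ) (wq : Fin (R + 1) → ℝ) (M : ℕ)
    (ust : Fin (R + 1) → ℝ → ℝ → StateVec m) (t : ℝ) : ℝ≥0∞ :=
  ∑' k : ℕ, sqNormST t (scMode μ F Ψ yq wq M ust (M + 1 + k))

end NISP

/-!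
The estimate is a relative entropy argument along almost every path of the random parameter,
followed by Parseval's identity in the parameter.

*One path.* Let `u` be an entropy solution, `v` a Lipschitz function, both with values in `C`, and
`R = ∂ₜ v + ∂ₓ F(v)`. Testing the entropy inequality of `u` with `ψ` and the weak equation with
`ψ • ∇η(v)`, and using the divergence theorem for the Lipschitz quantities built from `v` alone,
gives `EntropyBounds.relative_entropy_inequality` for the relative entropy
`η(u | v) = η(u) - η(v) - Dη(v)(u - v)`. The compatibility of `η` and `q` makes `D²η(v)`
symmetrise `DF(v)`, so that the production term is
`- D²η(v)(R, u - v) - D²η(v)(∂ₓ v, F(u) - F(v) - DF(v)(u - v))`. On `C` the relative entropy lies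
between `ηlow / 2 |u - v|²` and `ηup / 2 |u - v|²`, and the relative flux is at most
`cF / 2 |u - v|²`. With `ψ = e^{-K(t)} ζ(t) χ(t, x)`, where `K' = ηlow⁻¹ (ηup cF |∂ₓ v|_∞ + ηup²)`
is the rate of Gronwall's inequality, `ζ` a cut-off in time and `χ` a cut-off to a backward cone
whose slope dominates the speed of propagation of the relative entropy, everything quadratic in
`u - v` except the contribution of `ζ'` has a favourable sign. This bounds the mean of the relative
entropy over the time slab where `ζ` decreases (`EntropyBounds.integral_duality_le`). To reach every
single time, `|u - v|²` is bounded below by `2 β · (u - v) - |β|²` with `β` continuous and compactly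
supported: this is affine in `u`, so that its integral is continuous in time because `u` is weakly
continuous, and the supremum over `β` recovers the `L²` norm (`EntropyBounds.path_estimate`). Weak
continuity also shows that `u(0, ·)` is the initial datum (`IsEntropySolution.initial_eq`).

*The random parameter.* At almost every `(t, x)` all modes of `ûˢᵗˢ` are differentiable, by
Rademacher's theorem. The modes of order `j ≤ M` of its residual are the sums of the deterministic
and the quadrature residual, those of order `j > M` are the cut-off residual, and Parseval's
identity for functions with values in `ℝᵐ` gives `lintegral_stResidual_le`. The exponential factor
does not depend on the path, so that the estimate may be integrated over the parameter. It may be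
infinite, and as the path-wise estimate is used with a bounded rate for each path, no finiteness
of `‖∂ₓ ûˢᵗˢ‖_∞` is needed.
-/

/-! ### Taylor estimates on a convex set of states -/

/-- A function on `[0, 1]` whose second derivative is at most `c` lies below its tangent line at `0`
plus `c / 2` at the point `1`. -/
theorem sub_sub_le_half_of_deriv2_le {f f' f'' : ℝ → ℝ} {c : ℝ}
    (hf : ∀ s ∈ Icc (0 : ℝ) 1, HasDerivAt f (f' s) s)
    (hf' : ∀ s ∈ Icc (0 : ℝ) 1, HasDerivAt f' (f'' s) s)
    (hc : ∀ s ∈ Icc (0 : ℝ) 1, f'' s ≤ c) : f 1 - f 0 - f' 0 ≤ c / 2 := by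
  have h1 : ∀ s ∈ Icc (0 : ℝ) 1, f' s - c * s ≤ f' 0 := by
    have : AntitoneOn (fun s => f' s - c * s) (Icc 0 1) := by
      apply antitoneOn_of_hasDerivWithinAt_nonpos (f' := fun s => f'' s - c) (convex_Icc 0 1)
      · intro s hs
        exact ((hf' s hs).continuousAt.sub (by fun_prop)).continuousWithinAt
      · intro s hs
        have hs' := interior_subset hs
        have h2 := (hasDerivAt_id s).const_mul c
        rw [mul_one] at h2
        exact ((hf' s hs').sub h2).hasDerivWithinAt
      · intro s hs
        linarith [hc s (interior_subset hs)]
    intro s hs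
    simpa using this ⟨le_rfl, zero_le_one⟩ hs hs.1
  have : AntitoneOn (fun s => f s - (f' 0 * s + c * (s ^ 2 / 2))) (Icc 0 1) := by
    apply antitoneOn_of_hasDerivWithinAt_nonpos (f' := fun s => f' s - (f' 0 + c * s))
      (convex_Icc 0 1)
    · intro s hs
      exact ((hf s hs).continuousAt.sub (by fun_prop)).continuousWithinAt
    · intro s hs
      have hs' := interior_subset hs
      have h2 : HasDerivAt (fun s : ℝ => s ^ 2 / 2) s s := by
        simpa using ((hasDerivAt_pow 2 s).div_const 2)
      have h3 := ((hasDerivAt_id s).const_mul (f' 0)).add (h2.const_mul c)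
      simp only [mul_one] at h3
      exact ((hf s hs').sub h3).hasDerivWithinAt
    · intro s hs
      linarith [h1 s (interior_subset hs)]
  have := this (left_mem_Icc.2 zero_le_one) (right_mem_Icc.2 zero_le_one) zero_le_one
  simp only at this
  linarith

section TwiceDifferentiable

variable {E G : Type*} [NormedAddCommGroup E] [NormedSpace ℝ E]
  [NormedAddCommGroup G] [NormedSpace ℝ G] {U : Set E} {f : E → G}

theorem ContDiffOn.hasFDerivAt_fderiv_of_two (hf : ContDiffOn ℝ 2 f U) (hU : IsOpen U) {a : E}
    (ha : a ∈ U) : HasFDerivAt f (fderiv ℝ f a) a :=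
  ((hf.contDiffAt (hU.mem_nhds ha)).differentiableAt (by norm_num)).hasFDerivAt

theorem ContDiffOn.fderiv_of_two (hf : ContDiffOn ℝ 2 f U) (hU : IsOpen U) :
    ContDiffOn ℝ 1 (fderiv ℝ f) U :=
  hf.fderiv_of_isOpen hU (by norm_num)

theorem ContDiffOn.hasFDerivAt_fderiv_fderiv (hf : ContDiffOn ℝ 2 f U) (hU : IsOpen U) {a : E}
    (ha : a ∈ U) : HasFDerivAt (fderiv ℝ f) (fderiv ℝ (fderiv ℝ f) a) a :=
  (((hf.fderiv_of_two hU).contDiffAt (hU.mem_nhds ha)).differentiableAt (by norm_num)).hasFDerivAt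

theorem ContDiffOn.fderiv_fderiv_symm (hf : ContDiffOn ℝ 2 f U) (hU : IsOpen U) {a : E}
    (ha : a ∈ U) (v w : E) :
    fderiv ℝ (fderiv ℝ f) a v w = fderiv ℝ (fderiv ℝ f) a w v :=
  (hf.contDiffAt (hU.mem_nhds ha)).isSymmSndFDerivAt (by simp) v w

/-- The second derivative is bounded on a compact subset of the open set of regularity. -/
theorem ContDiffOn.exists_norm_fderiv_fderiv_le (hf : ContDiffOn ℝ 2 f U) (hU : IsOpen U)
    {C : Set E} (hC : IsCompact C) (hCU : C ⊆ U) :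
    ∃ c, 0 ≤ c ∧ ∀ a ∈ C, ‖fderiv ℝ (fderiv ℝ f) a‖ ≤ c := by
  have h1 : ContinuousOn (fderiv ℝ (fderiv ℝ f)) C :=
    ((hf.fderiv_of_two hU).continuousOn_fderiv_of_isOpen hU (by norm_num)).mono hCU
  obtain ⟨c, hc⟩ := hC.exists_bound_of_continuousOn (E := E →L[ℝ] E →L[ℝ] G) h1
  exact ⟨max c 0, le_max_right _ _, fun a ha => (hc a ha).trans (le_max_left _ _)⟩

/-- Quadratic upper bound for a scalar function of the remainder of the tangent map, from a bound
of the second derivative along the segment. -/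
theorem ContDiffOn.apply_sub_sub_fderiv_le (hf : ContDiffOn ℝ 2 f U) (hU : IsOpen U)
    {C : Set E} (hC : Convex ℝ C) (hCU : C ⊆ U) (ℓ : G →L[ℝ] ℝ) {a b : E} (ha : a ∈ C)
    (hb : b ∈ C) {c : ℝ} (hc : ∀ z ∈ C, ℓ (fderiv ℝ (fderiv ℝ f) z (a - b) (a - b)) ≤ c) :
    ℓ (f a - f b - fderiv ℝ f b (a - b)) ≤ c / 2 := by
  set w := a - b with hw
  have hseg : ∀ s ∈ Icc (0 : ℝ) 1, b + s • w ∈ C := fun s hs =>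
    hC.add_smul_sub_mem hb ha hs
  have hline : ∀ s : ℝ, HasDerivAt (fun s : ℝ => b + s • w) w s := fun s => by
    simpa using ((hasDerivAt_id s).smul_const w).const_add b
  have := sub_sub_le_half_of_deriv2_le (f := fun s => ℓ (f (b + s • w)))
    (f' := fun s => ℓ (fderiv ℝ f (b + s • w) w))
    (f'' := fun s => ℓ (fderiv ℝ (fderiv ℝ f) (b + s • w) w w)) (c := c) ?_ ?_ ?_
  · simpa [hw, map_sub] using this
  · intro s hs
    exact ℓ.hasFDerivAt.comp_hasDerivAt s
      ((hf.hasFDerivAt_fderiv_of_two hU (hCU (hseg s hs))).comp_hasDerivAt s (hline s))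
  · intro s hs
    have h1 := ((hf.hasFDerivAt_fderiv_fderiv hU (hCU (hseg s hs))).comp_hasDerivAt s (hline s))
    exact ℓ.hasFDerivAt.comp_hasDerivAt s
      ((ContinuousLinearMap.apply ℝ G w).hasFDerivAt.comp_hasDerivAt s h1)
  · intro s hs
    exact hc _ (hseg s hs)

theorem ContDiffOn.lipschitzOnWith_of_compact_convex (hf : ContDiffOn ℝ 1 f U) (hU : IsOpen U)
    {C : Set E} (hC : IsCompact C) (hconv : Convex ℝ C) (hCU : C ⊆ U) :
    ∃ K, LipschitzOnWith K f C := by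
  have h1 : ContinuousOn (fderiv ℝ f) C :=
    (hf.continuousOn_fderiv_of_isOpen hU (by norm_num)).mono hCU
  obtain ⟨c, hc⟩ := hC.exists_bound_of_continuousOn h1
  refine ⟨c.toNNReal, hconv.lipschitzOnWith_of_nnnorm_hasFDerivWithin_le (f' := fderiv ℝ f)
    (fun a ha => ?_) fun a ha => ?_⟩
  · exact ((hf.contDiffAt (hU.mem_nhds (hCU ha))).differentiableAt
      (by norm_num)).hasFDerivAt.hasFDerivWithinAt
  · rw [← NNReal.coe_le_coe]
    exact (hc a ha).trans (Real.le_coe_toNNReal _)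

end TwiceDifferentiable

/-! ### Relative entropy and relative entropy flux -/

section Relative

variable {m : ℕ}

/-- The convex compact set `C` of states, on which the second derivatives of the flux and of the
entropy are controlled by the constants `cF`, `ηlow`, `ηup`. -/
structure EntropyBounds (U C : Set (StateVec m)) (F : StateVec m → StateVec m)
    (η q : StateVec m → ℝ) (cF ηlow ηup : ℝ) : Prop where
  isOpen : IsOpen U
  flux : ContDiffOn ℝ 2 F U
  pair : IsEntropyPair U F η q
  subset : C ⊆ U
  convex : Convex ℝ C
  compact : IsCompact C
  cF_pos : 0 < cF
  low_pos : 0 < ηlow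
  low_lt_up : ηlow < ηup
  flux_bound : ∀ a ∈ C, ∀ v, ‖fderiv ℝ (fderiv ℝ F) a v v‖ ≤ cF * ‖v‖ ^ 2
  bound_low : ∀ a ∈ C, ∀ v, ηlow * ‖v‖ ^ 2 ≤ fderiv ℝ (fderiv ℝ η) a v v
  bound_up : ∀ a ∈ C, ∀ v, fderiv ℝ (fderiv ℝ η) a v v ≤ ηup * ‖v‖ ^ 2

/-- The relative entropy `η(a | b)`. -/
noncomputable def relEntropy (η : StateVec m → ℝ) (a b : StateVec m) : ℝ :=
  η a - η b - fderiv ℝ η b (a - b)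

/-- The relative entropy flux `q(a | b)`. -/
noncomputable def relEntropyFlux (F : StateVec m → StateVec m) (η q : StateVec m → ℝ)
    (a b : StateVec m) : ℝ :=
  q a - q b - fderiv ℝ η b (F a - F b)

namespace EntropyBounds

variable {U C : Set (StateVec m)} {F : StateVec m → StateVec m} {η q : StateVec m → ℝ}
  {cF ηlow ηup : ℝ} (hB : EntropyBounds U C F η q cF ηlow ηup) {a b : StateVec m}
include hB

theorem up_pos : 0 < ηup := hB.low_pos.trans hB.low_lt_up

theorem relEntropy_le (ha : a ∈ C) (hb : b ∈ C) : relEntropy η a b ≤ ηup / 2 * ‖a - b‖ ^ 2 := by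
  have := hB.pair.contDiffOn_entropy.apply_sub_sub_fderiv_le hB.isOpen hB.convex hB.subset
    (ContinuousLinearMap.id ℝ ℝ) ha hb (c := ηup * ‖a - b‖ ^ 2)
    fun z hz => by simpa using hB.bound_up z hz (a - b)
  simp only [ContinuousLinearMap.id_apply] at this
  unfold relEntropy
  linarith

theorem le_relEntropy (ha : a ∈ C) (hb : b ∈ C) : ηlow / 2 * ‖a - b‖ ^ 2 ≤ relEntropy η a b := by
  have := hB.pair.contDiffOn_entropy.apply_sub_sub_fderiv_le hB.isOpen hB.convex hB.subset
    (-ContinuousLinearMap.id ℝ ℝ) ha hb (c := -(ηlow * ‖a - b‖ ^ 2))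
    fun z hz => neg_le_neg (hB.bound_low z hz (a - b))
  simp only [neg_apply, ContinuousLinearMap.id_apply] at this
  unfold relEntropy
  linarith

theorem relEntropy_nonneg (ha : a ∈ C) (hb : b ∈ C) : 0 ≤ relEntropy η a b :=
  le_trans (by have := hB.low_pos; positivity) (hB.le_relEntropy ha hb)

theorem norm_flux_sub_le (ha : a ∈ C) (hb : b ∈ C) :
    ‖F a - F b - fderiv ℝ F b (a - b)‖ ≤ cF / 2 * ‖a - b‖ ^ 2 := by
  set z := F a - F b - fderiv ℝ F b (a - b) with hz
  have := hB.flux.apply_sub_sub_fderiv_le hB.isOpen hB.convex hB.subset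
    (innerSL ℝ z) ha hb (c := ‖z‖ * (cF * ‖a - b‖ ^ 2))
    fun y hy => by
      rw [innerSL_apply_apply]
      exact (real_inner_le_norm _ _).trans
        (mul_le_mul_of_nonneg_left (hB.flux_bound y hy _) (norm_nonneg _))
  rw [← hz, innerSL_apply_apply, real_inner_self_eq_norm_sq] at this
  rcases (norm_nonneg z).eq_or_lt with h0 | h0
  · rw [← h0]; have := hB.cF_pos; positivity
  · have h2 : ‖z‖ * ‖z‖ ≤ ‖z‖ * (cF / 2 * ‖a - b‖ ^ 2) := by nlinarith
    exact le_of_mul_le_mul_left h2 h0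

/-- The relative entropy flux is quadratic, because `Dq = Dη DF`. -/
theorem exists_abs_relEntropyFlux_le :
    ∃ c, 0 < c ∧ ∀ a ∈ C, ∀ b ∈ C, |relEntropyFlux F η q a b| ≤ c * ‖a - b‖ ^ 2 := by
  obtain ⟨c1, hc1, h1⟩ := hB.pair.contDiffOn_flux.exists_norm_fderiv_fderiv_le hB.isOpen hB.compact
    hB.subset
  obtain ⟨c2, h2⟩ := hB.compact.exists_bound_of_continuousOn
    ((hB.pair.contDiffOn_entropy.fderiv_of_two hB.isOpen).continuousOn.mono hB.subset)
  refine ⟨c1 / 2 + |c2| * (cF / 2) + 1, by have := hB.cF_pos; positivity, fun a ha b hb => ?_⟩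
  have h3 : ∀ ε : ℝ, |ε| = 1 → ε * (q a - q b - fderiv ℝ q b (a - b)) ≤ c1 * ‖a - b‖ ^ 2 / 2 := by
    intro ε hε
    refine hB.pair.contDiffOn_flux.apply_sub_sub_fderiv_le hB.isOpen hB.convex hB.subset
      (ε • ContinuousLinearMap.id ℝ ℝ) ha hb (c := c1 * ‖a - b‖ ^ 2) fun z hz => ?_
    simp only [smul_apply, ContinuousLinearMap.id_apply, smul_eq_mul]
    refine (le_abs_self _).trans ?_
    rw [abs_mul, hε, one_mul, ← Real.norm_eq_abs]
    refine (ContinuousLinearMap.le_opNorm₂ _ _ _).trans ?_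
    rw [mul_assoc, ← sq]
    exact mul_le_mul_of_nonneg_right (h1 z hz) (by positivity)
  have h4 : |q a - q b - fderiv ℝ q b (a - b)| ≤ c1 / 2 * ‖a - b‖ ^ 2 := by
    rw [abs_le]
    have := h3 1 (by simp)
    have := h3 (-1) (by simp)
    constructor <;> linarith
  have h5 : relEntropyFlux F η q a b = (q a - q b - fderiv ℝ q b (a - b))
      - fderiv ℝ η b (F a - F b - fderiv ℝ F b (a - b)) := by
    rw [← hB.pair.compat b (hB.subset hb)]
    simp [relEntropyFlux, map_sub]
  have h6 : |fderiv ℝ η b (F a - F b - fderiv ℝ F b (a - b))|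
      ≤ |c2| * (cF / 2) * ‖a - b‖ ^ 2 := by
    rw [← Real.norm_eq_abs]
    refine (ContinuousLinearMap.le_opNorm _ _).trans ?_
    rw [mul_assoc]
    exact mul_le_mul ((h2 b hb).trans (le_abs_self _)) (hB.norm_flux_sub_le ha hb)
      (norm_nonneg _) (abs_nonneg _)
  rw [h5]
  refine (abs_sub _ _).trans ?_
  nlinarith [sq_nonneg ‖a - b‖]

/-- The Hessian of the entropy is symmetric and positive, so that its bilinear form is bounded by
the bound of its quadratic form. -/
theorem abs_hessian_le (hb : b ∈ C) (w z : StateVec m) :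
    |fderiv ℝ (fderiv ℝ η) b w z| ≤ ηup * ‖w‖ * ‖z‖ := by
  set B : LinearMap.BilinForm ℝ (StateVec m) :=
    (fderiv ℝ (fderiv ℝ η) b).toBilinForm with hBdef
  have hBapp : ∀ w z, B w z = fderiv ℝ (fderiv ℝ η) b w z := fun _ _ => rfl
  have hpos : ∀ x, 0 ≤ B x x := fun x => by
    rw [hBapp]
    exact le_trans (by have := hB.low_pos; positivity) (hB.bound_low b hb x)
  have h1 := B.apply_mul_apply_le_of_forall_zero_le hpos w z
  rw [hBapp, hBapp, hBapp, hBapp, hB.pair.contDiffOn_entropy.fderiv_fderiv_symm hB.isOpen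
    (hB.subset hb) z w] at h1
  have hup := hB.up_pos
  refine abs_le_of_sq_le_sq ?_ (by positivity)
  calc (fderiv ℝ (fderiv ℝ η) b w z) ^ 2
      ≤ fderiv ℝ (fderiv ℝ η) b w w * fderiv ℝ (fderiv ℝ η) b z z := by rw [sq]; exact h1
    _ ≤ (ηup * ‖w‖ ^ 2) * (ηup * ‖z‖ ^ 2) :=
        mul_le_mul (hB.bound_up b hb w) (hB.bound_up b hb z) (hpos z) (by positivity)
    _ = _ := by ring

/-- The Hessian of the entropy symmetrizes the Jacobian of the flux. -/
theorem hessian_fderiv_symm (hb : b ∈ C) (w z : StateVec m) :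
    fderiv ℝ (fderiv ℝ η) b (fderiv ℝ F b w) z = fderiv ℝ (fderiv ℝ η) b w (fderiv ℝ F b z) := by
  have hbU := hB.subset hb
  have key : ∀ w z, fderiv ℝ (fderiv ℝ q) b w z
      = fderiv ℝ (fderiv ℝ η) b w (fderiv ℝ F b z)
        + fderiv ℝ η b (fderiv ℝ (fderiv ℝ F) b w z) := by
    intro w z
    have h1 := (hB.pair.contDiffOn_entropy.hasFDerivAt_fderiv_fderiv hB.isOpen hbU).clm_comp
      (hB.flux.hasFDerivAt_fderiv_fderiv hB.isOpen hbU)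
    have h2 : (fun v => (fderiv ℝ η v).comp (fderiv ℝ F v)) =ᶠ[nhds b] fderiv ℝ q := by
      filter_upwards [hB.isOpen.mem_nhds hbU] with v hv using hB.pair.compat v hv
    rw [(h1.congr_of_eventuallyEq h2.symm).fderiv]
    simp [add_comm]
  have h3 := key w z
  have h4 := key z w
  rw [hB.pair.contDiffOn_flux.fderiv_fderiv_symm hB.isOpen hbU w z, h4,
    hB.flux.fderiv_fderiv_symm hB.isOpen hbU w z] at h3
  rw [hB.pair.contDiffOn_entropy.fderiv_fderiv_symm hB.isOpen hbU]
  linarith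

end EntropyBounds

end Relative

/-! ### Lipschitz functions with compact support on space-time -/

section Lipschitz

variable {V : Type*} [NormedAddCommGroup V] [NormedSpace ℝ V]

theorem measurableSet_strip (T : ℝ) : MeasurableSet (strip T) :=
  measurableSet_Ioo.prod MeasurableSet.univ

theorem volume_restrict_strip (T : ℝ) :
    (volume : Measure (ℝ × ℝ)).restrict (strip T) = (volume.restrict (Ioo 0 T)).prod volume := by
  rw [strip, Measure.volume_eq_prod, ← Measure.prod_restrict, Measure.restrict_univ]

omit [NormedSpace ℝ V] in
theorem integrable_of_bounded_of_eq_zero {α : Type*} [TopologicalSpace α] [MeasurableSpace α]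
    [T2Space α] [OpensMeasurableSpace α] {μ : Measure α} [IsFiniteMeasureOnCompacts μ] {f : α → V}
    (hf : AEStronglyMeasurable f μ) {k : Set α} (hk : IsCompact k)
    (hz : ∀ᵐ p ∂μ, p ∉ k → f p = 0) {c : ℝ} (hc : ∀ᵐ p ∂μ, ‖f p‖ ≤ c) : Integrable f μ := by
  have h1 : k.indicator f =ᵐ[μ] f := by
    filter_upwards [hz] with p hp
    by_cases h : p ∈ k
    · simp [h]
    · simp [h, hp h]
  refine Integrable.congr ?_ h1
  rw [integrable_indicator_iff hk.measurableSet]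
  exact Measure.integrableOn_of_bounded hk.measure_lt_top.ne hf (ae_restrict_of_ae hc)

theorem LipschitzWith.smul_of_bounded {α : Type*} [PseudoMetricSpace α] {a : α → ℝ} {b : α → V}
    {Ka Kb : NNReal} (ha : LipschitzWith Ka a) (hb : LipschitzWith Kb b) {A B : NNReal}
    (hA : ∀ p, ‖a p‖ ≤ A) (hB : ∀ p, ‖b p‖ ≤ B) :
    LipschitzWith (A * Kb + Ka * B) (fun p => a p • b p) := by
  refine LipschitzWith.of_dist_le_mul fun p r => ?_
  have h1 : a p • b p - a r • b r = a p • (b p - b r) + (a p - a r) • b r := by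
    rw [smul_sub, sub_smul]; abel
  have h2 := ha.dist_le_mul p r
  have h3 := hb.dist_le_mul p r
  rw [dist_eq_norm] at h2 h3 ⊢
  rw [h1]
  refine (norm_add_le _ _).trans ?_
  rw [norm_smul, norm_smul]
  push_cast
  calc ‖a p‖ * ‖b p - b r‖ + ‖a p - a r‖ * ‖b r‖
      ≤ A * (Kb * dist p r) + (Ka * dist p r) * B := by
        gcongr
        · exact hA p
        · exact hB r
    _ = _ := by ring

theorem lipschitzWith_prodMk_left (x : ℝ) : LipschitzWith 1 (fun s : ℝ => (s, x)) :=
  LipschitzWith.of_dist_le_mul fun s r => by simp [Prod.dist_eq]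

theorem lipschitzWith_prodMk_right (t : ℝ) : LipschitzWith 1 (fun z : ℝ => (t, z)) :=
  LipschitzWith.of_dist_le_mul fun s r => by simp [Prod.dist_eq]

variable {v : ℝ → ℝ → V} {K : NNReal}

omit [NormedSpace ℝ V] in
theorem LipschitzWith.slice_time (hv : LipschitzWith K (fun p : ℝ × ℝ => v p.1 p.2)) (x : ℝ) :
    LipschitzWith K (fun s => v s x) := by
  simpa [Function.comp_def] using hv.comp (lipschitzWith_prodMk_left x)

omit [NormedSpace ℝ V] in
theorem LipschitzWith.slice_space (hv : LipschitzWith K (fun p : ℝ × ℝ => v p.1 p.2)) (t : ℝ) :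
    LipschitzWith K (fun z => v t z) := by
  simpa [Function.comp_def] using hv.comp (lipschitzWith_prodMk_right t)

theorem LipschitzWith.norm_dt_le (hv : LipschitzWith K (fun p : ℝ × ℝ => v p.1 p.2)) (t x : ℝ) :
    ‖dt v t x‖ ≤ K :=
  norm_deriv_le_of_lipschitz (hv.slice_time x)

theorem LipschitzWith.norm_dx_le (hv : LipschitzWith K (fun p : ℝ × ℝ => v p.1 p.2)) (t x : ℝ) :
    ‖dx v t x‖ ≤ K :=
  norm_deriv_le_of_lipschitz (hv.slice_space t)

theorem DifferentiableAt.hasDerivAt_dt {p : ℝ × ℝ}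
    (hv : DifferentiableAt ℝ (fun p : ℝ × ℝ => v p.1 p.2) p) :
    HasDerivAt (fun s => v s p.2) (dt v p.1 p.2) p.1 := by
  have h1 : DifferentiableAt ℝ (fun s : ℝ => (s, p.2)) p.1 := by fun_prop
  have h2 : DifferentiableAt ℝ ((fun p : ℝ × ℝ => v p.1 p.2) ∘ fun s : ℝ => (s, p.2)) p.1 :=
    DifferentiableAt.comp p.1 hv h1
  exact h2.hasDerivAt

theorem DifferentiableAt.hasDerivAt_dx {p : ℝ × ℝ}
    (hv : DifferentiableAt ℝ (fun p : ℝ × ℝ => v p.1 p.2) p) :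
    HasDerivAt (fun z => v p.1 z) (dx v p.1 p.2) p.2 := by
  have h1 : DifferentiableAt ℝ (fun z : ℝ => (p.1, z)) p.2 := by fun_prop
  have h2 : DifferentiableAt ℝ ((fun p : ℝ × ℝ => v p.1 p.2) ∘ fun z : ℝ => (p.1, z)) p.2 :=
    DifferentiableAt.comp p.2 hv h1
  exact h2.hasDerivAt

theorem measurable_dx [MeasurableSpace V] [BorelSpace V] [CompleteSpace V]
    (hv : Continuous (fun p : ℝ × ℝ => v p.1 p.2)) :
    Measurable (fun p : ℝ × ℝ => dx v p.1 p.2) :=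
  measurable_deriv_with_param (f := v) hv

theorem measurable_dt [MeasurableSpace V] [BorelSpace V] [CompleteSpace V]
    (hv : Continuous (fun p : ℝ × ℝ => v p.1 p.2)) :
    Measurable (fun p : ℝ × ℝ => dt v p.1 p.2) :=
  (measurable_deriv_with_param (f := fun x t => v t x) (hv.comp continuous_swap)).comp
    measurable_swap

theorem dt_eq_zero_of_notMem_tsupport {φ : ℝ × ℝ → V} {p : ℝ × ℝ} (hp : p ∉ tsupport φ) :
    dt (fun t x => φ (t, x)) p.1 p.2 = 0 := by
  have h1 : (fun s => φ (s, p.2)) =ᶠ[nhds p.1] fun _ => 0 := by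
    have h2 := notMem_tsupport_iff_eventuallyEq.1 hp
    exact (Continuous.tendsto (f := fun s : ℝ => (s, p.2)) (by fun_prop) p.1).eventually h2
  exact h1.deriv_eq.trans (deriv_const _ _)

theorem dx_eq_zero_of_notMem_tsupport {φ : ℝ × ℝ → V} {p : ℝ × ℝ} (hp : p ∉ tsupport φ) :
    dx (fun t x => φ (t, x)) p.1 p.2 = 0 := by
  have h1 : (fun z => φ (p.1, z)) =ᶠ[nhds p.2] fun _ => 0 := by
    have h2 := notMem_tsupport_iff_eventuallyEq.1 hp
    exact (Continuous.tendsto (f := fun z : ℝ => (p.1, z)) (by fun_prop) p.2).eventually h2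
  exact h1.deriv_eq.trans (deriv_const _ _)

theorem integral_dt_strip {T : ℝ} (hT : 0 < T) {G : ℝ × ℝ → ℝ} (hG : LipschitzWith K G)
    (hsupp : HasCompactSupport G) :
    IntegrableOn (fun p : ℝ × ℝ => dt (fun t x => G (t, x)) p.1 p.2) (strip T) ∧
    ∫ p in strip T, dt (fun t x => G (t, x)) p.1 p.2 = ∫ x, (G (T, x) - G (0, x)) := by
  have hint : Integrable (fun p : ℝ × ℝ => dt (fun t x => G (t, x)) p.1 p.2) :=
    integrable_of_bounded_of_eq_zero (measurable_dt (v := fun t x => G (t, x))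
      hG.continuous).aestronglyMeasurable hsupp
      (ae_of_all _ fun p hp => dt_eq_zero_of_notMem_tsupport hp)
      (ae_of_all _ fun p => LipschitzWith.norm_dt_le (v := fun t x => G (t, x)) hG p.1 p.2)
  refine ⟨hint.integrableOn, ?_⟩
  have hint' := hint.integrableOn (s := strip T)
  rw [IntegrableOn, volume_restrict_strip] at hint'
  rw [volume_restrict_strip, integral_prod_symm _ hint']
  congr 1
  ext x
  have h2 : LipschitzOnWith K (fun s => G (s, x)) (uIcc 0 T) :=
    (LipschitzWith.slice_time (v := fun t x => G (t, x)) hG x).lipschitzOnWith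
  have := h2.absolutelyContinuousOnInterval.integral_deriv_eq_sub
  rw [intervalIntegral.integral_of_le hT.le, integral_Ioc_eq_integral_Ioo] at this
  exact this

theorem integral_dx_strip {T : ℝ} {H : ℝ × ℝ → ℝ} (hH : LipschitzWith K H)
    (hsupp : HasCompactSupport H) :
    IntegrableOn (fun p : ℝ × ℝ => dx (fun t x => H (t, x)) p.1 p.2) (strip T) ∧
    ∫ p in strip T, dx (fun t x => H (t, x)) p.1 p.2 = 0 := by
  have hint : Integrable (fun p : ℝ × ℝ => dx (fun t x => H (t, x)) p.1 p.2) :=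
    integrable_of_bounded_of_eq_zero (measurable_dx (v := fun t x => H (t, x))
      hH.continuous).aestronglyMeasurable hsupp
      (ae_of_all _ fun p hp => dx_eq_zero_of_notMem_tsupport hp)
      (ae_of_all _ fun p => LipschitzWith.norm_dx_le (v := fun t x => H (t, x)) hH p.1 p.2)
  refine ⟨hint.integrableOn, ?_⟩
  have hint' := hint.integrableOn (s := strip T)
  rw [IntegrableOn, volume_restrict_strip] at hint'
  rw [volume_restrict_strip, integral_prod _ hint']
  have hzero : ∀ t, ∫ x, dx (fun t x => H (t, x)) t x = 0 := by
    intro t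
    obtain ⟨r, hr0, hr⟩ : ∃ r, 0 < r ∧ tsupport H ⊆ Metric.ball 0 r := by
      obtain ⟨r, hr⟩ := hsupp.isCompact.isBounded.subset_ball 0
      exact ⟨max r 1, by positivity, hr.trans (Metric.ball_subset_ball (le_max_left _ _))⟩
    have hout : ∀ x, r ≤ |x| → (t, x) ∉ tsupport H := by
      intro x hx hmem
      have := hr hmem
      rw [mem_ball_zero_iff, Prod.norm_def] at this
      exact absurd (lt_of_le_of_lt (le_max_right _ _) this) (not_lt.2 hx)
    have h2 : LipschitzOnWith K (fun z => H (t, z)) (uIcc (-r) r) :=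
      (LipschitzWith.slice_space (v := fun t x => H (t, x)) hH t).lipschitzOnWith
    have h3 := h2.absolutelyContinuousOnInterval.integral_deriv_eq_sub
    rw [image_eq_zero_of_notMem_tsupport (hout r (le_abs_self r)),
      image_eq_zero_of_notMem_tsupport (hout (-r) (by rw [abs_neg]; exact le_abs_self r)),
      intervalIntegral.integral_of_le (by linarith), sub_zero] at h3
    rw [← h3, setIntegral_eq_integral_of_forall_compl_eq_zero]
    · rfl
    · intro x hx
      have : r ≤ |x| := by
        rw [mem_Ioc, not_and_or, not_lt, not_le] at hx
        rcases hx with hx | hx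
        · rw [abs_of_nonpos (by linarith)]; linarith
        · exact hx.le.trans (le_abs_self x)
      exact dx_eq_zero_of_notMem_tsupport (φ := H) (p := (t, x)) (hout x this)
  simp [hzero]

/-- The divergence theorem on the strip, for Lipschitz functions with compact support which vanish
near the upper boundary. -/
theorem integral_divergence_strip {T : ℝ} (hT : 0 < T) {G H : ℝ × ℝ → ℝ} {KG KH : NNReal}
    (hG : LipschitzWith KG G) (hGs : HasCompactSupport G) (hGT : tsupport G ⊆ Iio T ×ˢ univ)
    (hH : LipschitzWith KH H) (hHs : HasCompactSupport H) :
    (∫ p in strip T, (dt (fun t x => G (t, x)) p.1 p.2 + dx (fun t x => H (t, x)) p.1 p.2))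
      + ∫ x, G (0, x) = 0 := by
  obtain ⟨h1, h2⟩ := integral_dt_strip hT hG hGs
  obtain ⟨h3, h4⟩ := integral_dx_strip (T := T) hH hHs
  have h5 : ∀ x, G (T, x) = 0 := fun x => image_eq_zero_of_notMem_tsupport fun hmem => by
    simpa using hGT hmem
  rw [integral_add h1 h3, h2, h4]
  simp [h5, integral_neg]

end Lipschitz

/-! ### The relative entropy inequality -/

section RelativeEntropyInequality

variable {m : ℕ} {V : Type*} [NormedAddCommGroup V]

theorem IsTestFunction.exists_norm_le {T : ℝ} {φ : ℝ × ℝ → V} (hφ : IsTestFunction T φ) :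
    ∃ A : NNReal, ∀ p, ‖φ p‖ ≤ A := by
  obtain ⟨⟨K, hK⟩, hs, -⟩ := hφ
  obtain ⟨A, hA⟩ := hs.exists_bound_of_continuous hK.continuous
  exact ⟨A.toNNReal, fun p => (hA p).trans (Real.le_coe_toNNReal _)⟩

theorem IsTestFunction.smul [NormedSpace ℝ V] {T : ℝ} {ψ : ℝ × ℝ → ℝ} (hψ : IsTestFunction T ψ)
    {b : ℝ × ℝ → V} {K : NNReal} (hb : LipschitzWith K b) {B : NNReal} (hB : ∀ p, ‖b p‖ ≤ B) :
    IsTestFunction T (fun p => ψ p • b p) := by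
  obtain ⟨A, hA⟩ := hψ.exists_norm_le
  obtain ⟨⟨K', hK'⟩, hs, hT⟩ := hψ
  refine ⟨⟨_, hK'.smul_of_bounded hb hA hB⟩, hs.smul_right (f' := b), ?_⟩
  exact (tsupport_smul_subset_left ψ b).trans hT

theorem measurable_indicator_of_continuousOn {α β : Type*} [TopologicalSpace α] [MeasurableSpace α]
    [OpensMeasurableSpace α] [TopologicalSpace β] [MeasurableSpace β] [BorelSpace β] [Zero β]
    {C : Set α} (hC : MeasurableSet C) {f : α → β} (hf : ContinuousOn f C) :
    Measurable (C.indicator f) := by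
  classical
  rw [← piecewise_eq_indicator]
  exact hf.measurable_piecewise continuousOn_const hC

theorem aestronglyMeasurable_comp_of_mem {α : Type*} [MeasurableSpace α] {μ : Measure α}
    [SecondCountableTopology V] {β : Type*} [TopologicalSpace β] [MeasurableSpace β]
    [OpensMeasurableSpace β] {C : Set β} (hC : MeasurableSet C) {f : β → V} (hf : ContinuousOn f C)
    {w : α → β} (hw : AEMeasurable w μ) (hwC : ∀ᵐ p ∂μ, w p ∈ C) :
    AEStronglyMeasurable (fun p => f (w p)) μ := by
  borelize V
  have h1 : AEMeasurable (fun p => C.indicator f (w p)) μ :=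
    (measurable_indicator_of_continuousOn hC hf).comp_aemeasurable hw
  refine h1.aestronglyMeasurable.congr ?_
  filter_upwards [hwC] with p hp
  simp [hp]

theorem inner_deriv_smul_gradient {η : StateVec m → ℝ} {U : Set (StateVec m)} (hU : IsOpen U)
    (hη : ContDiffOn ℝ 2 η U) {ψ : ℝ → ℝ} {φ w : ℝ → StateVec m} {ψ' s : ℝ} {φ' w' : StateVec m}
    (hψ : HasDerivAt ψ ψ' s) (hφ : HasDerivAt φ φ' s) (hw : HasDerivAt w w' s) (hws : w s ∈ U)
    {z : StateVec m} (h : ∀ r, inner ℝ (φ r) z = ψ r * fderiv ℝ η (w r) z) :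
    inner ℝ φ' z = ψ' * fderiv ℝ η (w s) z + ψ s * fderiv ℝ (fderiv ℝ η) (w s) w' z := by
  have a1 := hφ.inner ℝ (hasDerivAt_const s z)
  have a2 := hψ.mul (((hη.hasFDerivAt_fderiv_fderiv hU hws).comp_hasDerivAt s hw).clm_apply
    (hasDerivAt_const s z))
  have a3 : (fun r => inner ℝ (φ r) z) = fun r => ψ r * fderiv ℝ η (w r) z := funext h
  rw [a3] at a1
  simpa using a1.unique a2

theorem deriv_mul_sub_fderiv_apply {η f : StateVec m → ℝ} {Φ : StateVec m → StateVec m}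
    {U : Set (StateVec m)} (hU : IsOpen U) (hη : ContDiffOn ℝ 2 η U) {ψ : ℝ → ℝ}
    {w : ℝ → StateVec m} {ψ' s : ℝ} {w' : StateVec m} {Φ' : StateVec m →L[ℝ] StateVec m}
    (hψ : HasDerivAt ψ ψ' s) (hw : HasDerivAt w w' s) (hws : w s ∈ U)
    (hΦ : HasFDerivAt Φ Φ' (w s)) (hf : HasFDerivAt f ((fderiv ℝ η (w s)).comp Φ') (w s)) :
    deriv (fun r => ψ r • (f (w r) - fderiv ℝ η (w r) (Φ (w r)))) s
      = ψ' * (f (w s) - fderiv ℝ η (w s) (Φ (w s)))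
        - ψ s * fderiv ℝ (fderiv ℝ η) (w s) w' (Φ (w s)) := by
  have a2 := hψ.mul ((hf.comp_hasDerivAt s hw).sub
    (((hη.hasFDerivAt_fderiv_fderiv hU hws).comp_hasDerivAt s hw).clm_apply
      (hΦ.comp_hasDerivAt s hw)))
  refine Eq.trans (b := _) a2.deriv ?_
  simp
  ring

namespace EntropyBounds

variable {U C : Set (StateVec m)} {F : StateVec m → StateVec m} {η q : StateVec m → ℝ}
  {cF ηlow ηup : ℝ} (hB : EntropyBounds U C F η q cF ηlow ηup)
include hB

/-- The relative entropy inequality of Dafermos and DiPerna: a Lipschitz function `v` with values in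
`C` is compared with an entropy solution `u`. It is the entropy inequality of `u`, minus the weak
form of the equation of `u` tested with `ψ ∇η(v)`, minus the divergence theorem for the fields
`ψ (η(v) - Dη(v) v)` and `ψ (q(v) - Dη(v) F(v))`. -/
theorem relative_entropy_inequality {T : ℝ} (hT : 0 < T) {u0 : ℝ → StateVec m}
    {u v : ℝ → ℝ → StateVec m} (hu : IsEntropySolution U F η q T u0 u)
    (huC : ∀ᵐ p ∂(volume.restrict (strip T)), u p.1 p.2 ∈ C) (hu0C : ∀ᵐ x, u0 x ∈ C)
    {K : NNReal} (hv : LipschitzWith K (fun p : ℝ × ℝ => v p.1 p.2)) (hvC : ∀ t x, v t x ∈ C)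
    {ψ : ℝ × ℝ → ℝ} (hψ : IsTestFunction T ψ) (hψ0 : ∀ p, 0 ≤ ψ p) :
    Integrable (fun p : ℝ × ℝ =>
        dt (fun t x => ψ (t, x)) p.1 p.2 * relEntropy η (u p.1 p.2) (v p.1 p.2)
        + dx (fun t x => ψ (t, x)) p.1 p.2 * relEntropyFlux F η q (u p.1 p.2) (v p.1 p.2)
        - ψ p * (fderiv ℝ (fderiv ℝ η) (v p.1 p.2) (dt v p.1 p.2) (u p.1 p.2 - v p.1 p.2)
          + fderiv ℝ (fderiv ℝ η) (v p.1 p.2) (dx v p.1 p.2) (F (u p.1 p.2) - F (v p.1 p.2))))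
      (volume.restrict (strip T)) ∧
    0 ≤ (∫ p in strip T, (dt (fun t x => ψ (t, x)) p.1 p.2 * relEntropy η (u p.1 p.2) (v p.1 p.2)
        + dx (fun t x => ψ (t, x)) p.1 p.2 * relEntropyFlux F η q (u p.1 p.2) (v p.1 p.2)
        - ψ p * (fderiv ℝ (fderiv ℝ η) (v p.1 p.2) (dt v p.1 p.2) (u p.1 p.2 - v p.1 p.2)
          + fderiv ℝ (fderiv ℝ η) (v p.1 p.2) (dx v p.1 p.2) (F (u p.1 p.2) - F (v p.1 p.2)))))
      + ∫ x, ψ (0, x) * relEntropy η (u0 x) (v 0 x) := by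
  have hU := hB.isOpen
  have hηC := hB.pair.contDiffOn_entropy
  have hqC := hB.pair.contDiffOn_flux
  have hCm : MeasurableSet C := hB.compact.measurableSet
  set vv : ℝ × ℝ → StateVec m := fun p => v p.1 p.2 with hvv
  -- bounds and Lipschitz constants of functions of the state along `v`
  have comp_lip : ∀ {W : Type} [NormedAddCommGroup W] [NormedSpace ℝ W] (f : StateVec m → W),
      ContDiffOn ℝ 1 f U → (∃ L, LipschitzWith L (fun p => f (vv p))) ∧
        ∃ A : NNReal, ∀ a ∈ C, ‖f a‖ ≤ A := by
    intro W _ _ f hf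
    obtain ⟨L, hL⟩ := hf.lipschitzOnWith_of_compact_convex hU hB.compact hB.convex hB.subset
    obtain ⟨A, hA⟩ := hB.compact.exists_bound_of_continuousOn (hf.continuousOn.mono hB.subset)
    refine ⟨⟨L * K, ?_⟩, A.toNNReal, fun a ha => (hA a ha).trans (Real.le_coe_toNNReal _)⟩
    have := hL.comp (hv.lipschitzOnWith (s := univ)) (fun p _ => hvC p.1 p.2)
    exact lipschitzOnWith_univ.1 this
  have hη1 : ContDiffOn ℝ 1 η U := hηC.of_le (by norm_num)
  have hq1 : ContDiffOn ℝ 1 q U := hqC.of_le (by norm_num)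
  have hF1 : ContDiffOn ℝ 1 F U := hB.flux.of_le (by norm_num)
  have hDη1 : ContDiffOn ℝ 1 (fderiv ℝ η) U := hηC.fderiv_of_two hU
  have hP1 : ContDiffOn ℝ 1 (fun a => η a - fderiv ℝ η a a) U :=
    hη1.sub (hDη1.clm_apply contDiffOn_id)
  have hQ1 : ContDiffOn ℝ 1 (fun a => q a - fderiv ℝ η a (F a)) U := hq1.sub (hDη1.clm_apply hF1)
  obtain ⟨-, Aη, hAη⟩ := comp_lip η hη1
  obtain ⟨-, Aq, hAq⟩ := comp_lip q hq1
  obtain ⟨-, AF, hAF⟩ := comp_lip F hF1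
  obtain ⟨-, AI, hAI⟩ := comp_lip (fun a => a) contDiffOn_id
  obtain ⟨⟨LD, hLD⟩, AD, hAD⟩ := comp_lip (fderiv ℝ η) hDη1
  obtain ⟨⟨LP, hLP⟩, AP, hAP⟩ := comp_lip _ hP1
  obtain ⟨⟨LQ, hLQ⟩, AQ, hAQ⟩ := comp_lip _ hQ1
  -- the test function of the weak equation
  set g : ℝ × ℝ → StateVec m := fun p =>
    (InnerProductSpace.toDual ℝ (StateVec m)).symm (fderiv ℝ η (vv p)) with hg
  have hgin : ∀ p w, inner ℝ (g p) w = fderiv ℝ η (vv p) w := fun p w => by simp [hg]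
  have hgl : LipschitzWith LD g := by
    simpa [Function.comp_def] using
      ((InnerProductSpace.toDual ℝ (StateVec m)).symm.isometry.lipschitz).comp hLD
  have hgb : ∀ p, ‖g p‖ ≤ AD := fun p => by
    rw [hg]
    simpa using hAD _ (hvC p.1 p.2)
  set φ : ℝ × ℝ → StateVec m := fun p => ψ p • g p with hφdef
  have hφ : IsTestFunction T φ := hψ.smul hgl hgb
  set G : ℝ × ℝ → ℝ := fun p => ψ p • (η (vv p) - fderiv ℝ η (vv p) (vv p)) with hGdef
  set H : ℝ × ℝ → ℝ := fun p => ψ p • (q (vv p) - fderiv ℝ η (vv p) (F (vv p))) with hHdef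
  have hG : IsTestFunction T G := hψ.smul hLP fun p => hAP _ (hvC p.1 p.2)
  have hH : IsTestFunction T H := hψ.smul hLQ fun p => hAQ _ (hvC p.1 p.2)
  obtain ⟨⟨Kφ, hKφ⟩, hφs, -⟩ := id hφ
  obtain ⟨⟨KG, hKG⟩, hGs, hGT⟩ := id hG
  obtain ⟨⟨KH, hKH⟩, hHs, -⟩ := id hH
  obtain ⟨⟨Kψ, hKψ⟩, hψs, -⟩ := id hψ
  obtain ⟨Aψ, hAψ⟩ := hψ.exists_norm_le
  obtain ⟨Aφ, hAφ⟩ := hφ.exists_norm_le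
  obtain ⟨AG, hAG⟩ := hG.exists_norm_le
  have I1 := hu.weak_equation φ hφ
  have I2 := hu.entropy_inequality ψ hψ hψ0
  have I3 := integral_divergence_strip hT hKG hGs hGT hKH hHs
  -- measurability of functions of `u`
  have hum := hu.aestronglyMeasurable.aemeasurable
  have hu0m := hu.aestronglyMeasurable_initial.aemeasurable
  have mη := aestronglyMeasurable_comp_of_mem hCm (hη1.continuousOn.mono hB.subset) hum huC
  have mq := aestronglyMeasurable_comp_of_mem hCm (hq1.continuousOn.mono hB.subset) hum huC
  have mF := aestronglyMeasurable_comp_of_mem hCm (hF1.continuousOn.mono hB.subset) hum huC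
  have mη0 := aestronglyMeasurable_comp_of_mem hCm (hη1.continuousOn.mono hB.subset) hu0m hu0C
  have mdt : ∀ {W : Type} [NormedAddCommGroup W] [NormedSpace ℝ W] [CompleteSpace W]
      [SecondCountableTopology W] (f : ℝ × ℝ → W),
      Continuous f → AEStronglyMeasurable (fun p : ℝ × ℝ => dt (fun t x => f (t, x)) p.1 p.2)
        (volume.restrict (strip T)) := by
    intro W _ _ _ _ f hf
    borelize W
    exact (measurable_dt (v := fun t x => f (t, x)) hf).aestronglyMeasurable
  have mdx : ∀ {W : Type} [NormedAddCommGroup W] [NormedSpace ℝ W] [CompleteSpace W]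
      [SecondCountableTopology W] (f : ℝ × ℝ → W),
      Continuous f → AEStronglyMeasurable (fun p : ℝ × ℝ => dx (fun t x => f (t, x)) p.1 p.2)
        (volume.restrict (strip T)) := by
    intro W _ _ _ _ f hf
    borelize W
    exact (measurable_dx (v := fun t x => f (t, x)) hf).aestronglyMeasurable
  -- integrability
  have i1 : Integrable (fun p : ℝ × ℝ => inner ℝ (dt (fun t x => φ (t, x)) p.1 p.2) (u p.1 p.2)
      + inner ℝ (dx (fun t x => φ (t, x)) p.1 p.2) (F (u p.1 p.2)))
      (volume.restrict (strip T)) := by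
    refine Integrable.add ?_ ?_
    · refine integrable_of_bounded_of_eq_zero ((mdt φ hKφ.continuous).inner hu.aestronglyMeasurable)
        hφs (ae_of_all _ fun p hp => by rw [dt_eq_zero_of_notMem_tsupport hp, inner_zero_left])
        (c := Kφ * AI) ?_
      filter_upwards [huC] with p hp
      refine (norm_inner_le_norm _ _).trans ?_
      gcongr
      · exact LipschitzWith.norm_dt_le (v := fun t x => φ (t, x)) hKφ p.1 p.2
      · exact hAI _ hp
    · refine integrable_of_bounded_of_eq_zero ((mdx φ hKφ.continuous).inner mF)
        hφs (ae_of_all _ fun p hp => by rw [dx_eq_zero_of_notMem_tsupport hp, inner_zero_left])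
        (c := Kφ * AF) ?_
      filter_upwards [huC] with p hp
      refine (norm_inner_le_norm _ _).trans ?_
      gcongr
      · exact LipschitzWith.norm_dx_le (v := fun t x => φ (t, x)) hKφ p.1 p.2
      · exact hAF _ hp
  have i2 : Integrable (fun p : ℝ × ℝ => dt (fun t x => ψ (t, x)) p.1 p.2 * η (u p.1 p.2)
      + dx (fun t x => ψ (t, x)) p.1 p.2 * q (u p.1 p.2)) (volume.restrict (strip T)) := by
    refine Integrable.add ?_ ?_
    · refine integrable_of_bounded_of_eq_zero ((mdt ψ hKψ.continuous).mul mη)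
        hψs (ae_of_all _ fun p hp => by rw [dt_eq_zero_of_notMem_tsupport hp, zero_mul])
        (c := Kψ * Aη) ?_
      filter_upwards [huC] with p hp
      rw [norm_mul]
      gcongr
      · exact LipschitzWith.norm_dt_le (v := fun t x => ψ (t, x)) hKψ p.1 p.2
      · exact hAη _ hp
    · refine integrable_of_bounded_of_eq_zero ((mdx ψ hKψ.continuous).mul mq)
        hψs (ae_of_all _ fun p hp => by rw [dx_eq_zero_of_notMem_tsupport hp, zero_mul])
        (c := Kψ * Aq) ?_
      filter_upwards [huC] with p hp
      rw [norm_mul]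
      gcongr
      · exact LipschitzWith.norm_dx_le (v := fun t x => ψ (t, x)) hKψ p.1 p.2
      · exact hAq _ hp
  have i3 : Integrable (fun p : ℝ × ℝ => dt (fun t x => G (t, x)) p.1 p.2
      + dx (fun t x => H (t, x)) p.1 p.2) (volume.restrict (strip T)) :=
    (integral_dt_strip hT hKG hGs).1.add (integral_dx_strip (T := T) hKH hHs).1
  -- integrability on the initial line
  have slice0 : ∀ {W : Type} [NormedAddCommGroup W] (f : ℝ × ℝ → W), HasCompactSupport f →
      ∃ k : Set ℝ, IsCompact k ∧ ∀ x ∉ k, f (0, x) = 0 := by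
    intro W _ f hf
    refine ⟨Prod.snd '' tsupport f, hf.isCompact.image continuous_snd, fun x hx => ?_⟩
    exact image_eq_zero_of_notMem_tsupport fun h => hx ⟨_, h, rfl⟩
  obtain ⟨kφ, hkφ, hkφ0⟩ := slice0 φ hφs
  obtain ⟨kψ, hkψ, hkψ0⟩ := slice0 ψ hψs
  obtain ⟨kG, hkG, hkG0⟩ := slice0 G hGs
  have j1 : Integrable (fun x => inner ℝ (φ (0, x)) (u0 x)) := by
    refine integrable_of_bounded_of_eq_zero ((hKφ.continuous.comp
      (by fun_prop : Continuous fun x : ℝ => ((0 : ℝ), x))).aestronglyMeasurable.inner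
        hu.aestronglyMeasurable_initial) hkφ
      (ae_of_all _ fun x hx => by rw [hkφ0 x hx, inner_zero_left]) (c := Aφ * AI) ?_
    filter_upwards [hu0C] with x hx
    refine (norm_inner_le_norm _ _).trans ?_
    gcongr
    · exact hAφ _
    · exact hAI _ hx
  have j2 : Integrable (fun x => ψ (0, x) * η (u0 x)) := by
    refine integrable_of_bounded_of_eq_zero ((hKψ.continuous.comp
      (by fun_prop : Continuous fun x : ℝ => ((0 : ℝ), x))).aestronglyMeasurable.mul mη0) hkψ
      (ae_of_all _ fun x hx => by rw [hkψ0 x hx, zero_mul]) (c := Aψ * Aη) ?_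
    filter_upwards [hu0C] with x hx
    rw [norm_mul]
    gcongr
    · exact hAψ _
    · exact hAη _ hx
  have j3 : Integrable (fun x => G (0, x)) :=
    integrable_of_bounded_of_eq_zero (hKG.continuous.comp
      (by fun_prop : Continuous fun x : ℝ => ((0 : ℝ), x))).aestronglyMeasurable hkG
      (ae_of_all _ fun x hx => hkG0 x hx) (ae_of_all _ fun x => hAG _)
  have total : (∫ p in strip T, ((dt (fun t x => ψ (t, x)) p.1 p.2 * η (u p.1 p.2)
        + dx (fun t x => ψ (t, x)) p.1 p.2 * q (u p.1 p.2))
      - (inner ℝ (dt (fun t x => φ (t, x)) p.1 p.2) (u p.1 p.2)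
        + inner ℝ (dx (fun t x => φ (t, x)) p.1 p.2) (F (u p.1 p.2)))
      - (dt (fun t x => G (t, x)) p.1 p.2 + dx (fun t x => H (t, x)) p.1 p.2)))
      + ∫ x, (ψ (0, x) * η (u0 x) - inner ℝ (φ (0, x)) (u0 x) - G (0, x))
      = (∫ p in strip T, (dt (fun t x => ψ (t, x)) p.1 p.2 * η (u p.1 p.2)
        + dx (fun t x => ψ (t, x)) p.1 p.2 * q (u p.1 p.2))) + ∫ x, ψ (0, x) * η (u0 x) := by
    have e1 := integral_sub (i2.sub i1) i3
    have e2 := integral_sub i2 i1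
    have e3 := integral_sub (j2.sub j1) j3
    have e4 := integral_sub j2 j1
    simp only [Pi.sub_apply] at e1 e3
    rw [e1, e2, e3, e4]
    linarith
  rw [← total] at I2
  have hae : (fun p : ℝ × ℝ => (dt (fun t x => ψ (t, x)) p.1 p.2 * η (u p.1 p.2)
        + dx (fun t x => ψ (t, x)) p.1 p.2 * q (u p.1 p.2))
      - (inner ℝ (dt (fun t x => φ (t, x)) p.1 p.2) (u p.1 p.2)
        + inner ℝ (dx (fun t x => φ (t, x)) p.1 p.2) (F (u p.1 p.2)))
      - (dt (fun t x => G (t, x)) p.1 p.2 + dx (fun t x => H (t, x)) p.1 p.2))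
      =ᵐ[volume.restrict (strip T)] fun p =>
        dt (fun t x => ψ (t, x)) p.1 p.2 * relEntropy η (u p.1 p.2) (v p.1 p.2)
        + dx (fun t x => ψ (t, x)) p.1 p.2 * relEntropyFlux F η q (u p.1 p.2) (v p.1 p.2)
        - ψ p * (fderiv ℝ (fderiv ℝ η) (v p.1 p.2) (dt v p.1 p.2) (u p.1 p.2 - v p.1 p.2)
          + fderiv ℝ (fderiv ℝ η) (v p.1 p.2) (dx v p.1 p.2) (F (u p.1 p.2) - F (v p.1 p.2))) := by
    have dψ := hKψ.ae_differentiableAt (μ := volume)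
    have dφ := hKφ.ae_differentiableAt (μ := volume)
    have dv := hv.ae_differentiableAt (μ := volume)
    filter_upwards [ae_restrict_of_ae dψ, ae_restrict_of_ae dφ, ae_restrict_of_ae dv]
      with p hψp hφp hvp
    have hvU : v p.1 p.2 ∈ U := hB.subset (hvC _ _)
    have D1 := hηC.hasFDerivAt_fderiv_of_two hU hvU
    have Dq := hqC.hasFDerivAt_fderiv_of_two hU hvU
    have DF := hB.flux.hasFDerivAt_fderiv_of_two hU hvU
    have vt := DifferentiableAt.hasDerivAt_dt (v := v) hvp
    have vx := DifferentiableAt.hasDerivAt_dx (v := v) hvp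
    have ψt := DifferentiableAt.hasDerivAt_dt (v := fun t x => ψ (t, x)) hψp
    have ψx := DifferentiableAt.hasDerivAt_dx (v := fun t x => ψ (t, x)) hψp
    have φt := DifferentiableAt.hasDerivAt_dt (v := fun t x => φ (t, x)) hφp
    have φx := DifferentiableAt.hasDerivAt_dx (v := fun t x => φ (t, x)) hφp
    have e1 := inner_deriv_smul_gradient hU hηC ψt φt vt hvU (z := u p.1 p.2) fun r => by
      simp only [hφdef, real_inner_smul_left, hgin, hvv]
    have e2 := inner_deriv_smul_gradient hU hηC ψx φx vx hvU (z := F (u p.1 p.2)) fun r => by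
      simp only [hφdef, real_inner_smul_left, hgin, hvv]
    have e3 : dt (fun t x => G (t, x)) p.1 p.2 = _ :=
      deriv_mul_sub_fderiv_apply hU hηC ψt vt hvU (hasFDerivAt_id _) (by simpa using D1)
    have e4 : dx (fun t x => H (t, x)) p.1 p.2 = _ :=
      deriv_mul_sub_fderiv_apply hU hηC ψx vx hvU DF (by rw [hB.pair.compat _ hvU]; exact Dq)
    rw [e1, e2, e3, e4]
    simp only [relEntropy, relEntropyFlux, map_sub, id_eq]
    ring
  refine ⟨((i2.sub i1).sub i3).congr hae, I2.trans_eq ?_⟩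
  congr 1
  · exact integral_congr_ae hae
  · congr 1
    ext x
    simp only [hφdef, hGdef, hvv, real_inner_smul_left, relEntropy, map_sub, hgin, smul_eq_mul]
    ring

end EntropyBounds

end RelativeEntropyInequality

/-! ### Cut-off functions -/

section Cutoff

/-- A Lipschitz cut-off in time: equal to `1` on `[-1, a]`, affine on `[a, b]`, and zero after `b`
and before `-2`. -/
noncomputable def timeCutoff (a b t : ℝ) : ℝ := max 0 (min (min 1 (t + 2)) ((b - t) / (b - a)))

theorem timeCutoff_nonneg (a b t : ℝ) : 0 ≤ timeCutoff a b t := le_max_left _ _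

theorem timeCutoff_le_one (a b t : ℝ) : timeCutoff a b t ≤ 1 :=
  max_le zero_le_one ((min_le_left _ _).trans (min_le_left _ _))

theorem timeCutoff_eq_one {a b t : ℝ} (hab : a < b) (ht : -1 ≤ t) (hta : t ≤ a) :
    timeCutoff a b t = 1 := by
  have h1 : 1 ≤ (b - t) / (b - a) := by rw [one_le_div (by linarith)]; linarith
  rw [timeCutoff, min_eq_left (a := 1) (by linarith), min_eq_left h1]
  simp

theorem timeCutoff_eq_zero_of_le {a b t : ℝ} (hab : a < b) (ht : b ≤ t) : timeCutoff a b t = 0 :=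
  max_eq_left ((min_le_right _ _).trans (div_nonpos_of_nonpos_of_nonneg (by linarith)
    (by linarith)))

theorem timeCutoff_eq_zero_of_le_neg {a b t : ℝ} (ht : t ≤ -2) : timeCutoff a b t = 0 :=
  max_eq_left ((min_le_left _ _).trans ((min_le_right _ _).trans (by linarith)))

theorem exists_lipschitzWith_timeCutoff (a b : ℝ) : ∃ K, LipschitzWith K (timeCutoff a b) := by
  have h1 : LipschitzWith 1 (fun t : ℝ => t + 2) :=
    LipschitzWith.of_dist_le_mul fun s r => by simp
  have h2 : LipschitzWith ‖(b - a)⁻¹‖₊ (fun t : ℝ => (b - t) / (b - a)) :=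
    LipschitzWith.of_dist_le_mul fun s r => by
      rw [Real.dist_eq, Real.dist_eq, ← sub_div, div_eq_mul_inv, abs_mul, coe_nnnorm,
        Real.norm_eq_abs, mul_comm]
      apply le_of_eq
      congr 1
      rw [abs_sub_comm]
      congr 1
      ring
  exact ⟨_, ((h1.const_min 1).min h2).const_max 0⟩

theorem hasDerivAt_timeCutoff {a b t : ℝ} (hab : a < b) (ht : 0 < t) (hta : t ≠ a) (htb : t ≠ b) :
    HasDerivAt (timeCutoff a b) (if t ∈ Ioo a b then -(b - a)⁻¹ else 0) t := by
  rcases lt_or_gt_of_ne hta with h1 | h1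
  · rw [if_neg (fun h => absurd h.1 h1.le.not_gt)]
    refine (hasDerivAt_const t (1 : ℝ)).congr_of_eventuallyEq ?_
    filter_upwards [Ioo_mem_nhds ht h1] with s hs
    exact timeCutoff_eq_one hab (by linarith [hs.1]) hs.2.le
  rcases lt_or_gt_of_ne htb with h2 | h2
  · rw [if_pos ⟨h1, h2⟩]
    have h3 : HasDerivAt (fun s => (b - s) / (b - a)) (-(b - a)⁻¹) t := by
      have := ((hasDerivAt_id t).const_sub b).div_const (b - a)
      rwa [neg_div, one_div] at this
    refine h3.congr_of_eventuallyEq ?_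
    filter_upwards [Ioo_mem_nhds h1 h2, Ioi_mem_nhds ht] with s hs hs0
    rw [mem_Ioi] at hs0
    have h4 : (b - s) / (b - a) ≤ 1 := by
      rw [div_le_one (by linarith)]; linarith [hs.1]
    have h5 : 0 ≤ (b - s) / (b - a) := div_nonneg (by linarith [hs.2]) (by linarith)
    rw [timeCutoff, min_eq_left (a := 1) (by linarith), min_eq_right h4, max_eq_right h5]
  · rw [if_neg (fun h => absurd h.2 h2.le.not_gt)]
    refine (hasDerivAt_const t (0 : ℝ)).congr_of_eventuallyEq ?_
    filter_upwards [Ioi_mem_nhds h2] with s hs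
    exact timeCutoff_eq_zero_of_le hab (le_of_lt hs)

/-- Truncation of a real number to `[0, 1]`. -/
noncomputable def clampUnit (z : ℝ) : ℝ := max 0 (min 1 z)

theorem clampUnit_nonneg (z : ℝ) : 0 ≤ clampUnit z := le_max_left _ _

theorem clampUnit_le_one (z : ℝ) : clampUnit z ≤ 1 := max_le zero_le_one (min_le_left _ _)

theorem clampUnit_eq_one {z : ℝ} (hz : 1 ≤ z) : clampUnit z = 1 := by
  rw [clampUnit, min_eq_left hz]; simp

theorem clampUnit_eq_zero {z : ℝ} (hz : z ≤ 0) : clampUnit z = 0 :=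
  max_eq_left ((min_le_right _ _).trans hz)

theorem monotone_clampUnit : Monotone clampUnit := fun _ _ h =>
  max_le_max le_rfl (min_le_min le_rfl h)

theorem lipschitzWith_clampUnit : LipschitzWith 1 clampUnit :=
  (LipschitzWith.id.const_min 1).const_max 0

theorem isTestFunction_of_eq_zero {V : Type*} [NormedAddCommGroup V] {T b r : ℝ} (hb : b < T)
    {φ : ℝ × ℝ → V} {K : NNReal} (hφ : LipschitzWith K φ)
    (hz : ∀ p : ℝ × ℝ, p ∉ Icc (-2) b ×ˢ Icc (-r) r → φ p = 0) : IsTestFunction T φ := by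
  have hk : IsCompact (Icc (-2) b ×ˢ Icc (-r) r : Set (ℝ × ℝ)) := isCompact_Icc.prod isCompact_Icc
  have hsub : tsupport φ ⊆ Icc (-2) b ×ˢ Icc (-r) r :=
    closure_minimal (fun p hp => by_contra fun h => hp (hz p h)) hk.isClosed
  exact ⟨⟨K, hφ⟩, hk.of_isClosed_subset (isClosed_tsupport _) hsub,
    hsub.trans fun p hp => ⟨lt_of_le_of_lt hp.1.2 hb, mem_univ _⟩⟩

end Cutoff

/-! ### Traces in time of weakly continuous functions -/

section Trace

/-- A continuous function whose means over the intervals to the left of `τ` are at most `B` is at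
most `B` at `τ`. -/
theorem ContinuousOn.le_of_integral_le {f : ℝ → ℝ} {T τ B : ℝ} (hf : ContinuousOn f (Icc 0 T))
    (hτ0 : 0 < τ) (hτT : τ ≤ T)
    (h : ∀ a b, 0 < a → a < b → b < τ → ∫ t in Ioo a b, f t ≤ (b - a) * B) : f τ ≤ B := by
  by_contra! hlt
  obtain ⟨B', hB1, hB2⟩ := exists_between hlt
  have h1 : ∀ᶠ t in nhdsWithin τ (Icc 0 T), B' < f t :=
    (hf τ ⟨hτ0.le, hτT⟩).eventually (lt_mem_nhds hB2)
  obtain ⟨ε, hε, h2⟩ := Metric.mem_nhdsWithin_iff.1 h1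
  set a := max (τ / 2) (τ - ε / 2) with ha
  have ha0 : 0 < a := lt_of_lt_of_le (by linarith) (le_max_left _ _)
  have haτ : a < τ := max_lt (by linarith) (by linarith)
  set b := (a + τ) / 2 with hb
  have hab : a < b := by linarith
  have hbτ : b < τ := by linarith
  have h3 : ∀ t ∈ Icc a b, B' < f t := fun t ht => h2 ⟨by
    rw [Metric.mem_ball, Real.dist_eq, abs_sub_lt_iff]
    have : τ - ε / 2 ≤ a := le_max_right _ _
    constructor <;> linarith [ht.1, ht.2], by linarith [ht.1], by linarith [ht.2]⟩
  have hcont : ContinuousOn f (Icc a b) :=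
    hf.mono (Icc_subset_Icc ha0.le (by linarith))
  have hint : IntegrableOn f (Ioo a b) :=
    (hcont.integrableOn_Icc).mono_set Ioo_subset_Icc_self
  have h4 : (b - a) * B' ≤ ∫ t in Ioo a b, f t := by
    have : ∫ t in Ioo a b, B' = (b - a) * B' := by
      rw [setIntegral_const, smul_eq_mul, Real.volume_real_Ioo_of_le hab.le]
    rw [← this]
    refine setIntegral_mono_on (by simp) hint measurableSet_Ioo fun t ht => ?_
    exact (h3 t ⟨ht.1.le, ht.2.le⟩).le
  have := h a b ha0 hab hbτ
  nlinarith

variable {m : ℕ}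

theorem continuousOn_integral_inner {T : ℝ} {w : ℝ → ℝ → StateVec m}
    (hloc : ∀ t ∈ Icc 0 T, LocallyIntegrable (w t) volume)
    (hw : ∀ φ : ℝ → ℝ, Continuous φ → HasCompactSupport φ →
      ContinuousOn (fun t => ∫ x, φ x • w t x) (Icc 0 T))
    {β : ℝ → StateVec m} (hβ : Continuous β) (hβs : HasCompactSupport β) :
    ContinuousOn (fun t => ∫ x, inner ℝ (β x) (w t x)) (Icc 0 T) := by
  have hβi : ∀ i, Continuous (fun x => β x i) := fun i => by fun_prop
  have hβis : ∀ i, HasCompactSupport (fun x => β x i) := fun i =>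
    hβs.comp_left (g := fun z : StateVec m => z i) rfl
  have h1 : ContinuousOn (fun t => ∑ i, (∫ x, (β x i) • w t x) i) (Icc 0 T) := by
    refine continuousOn_finsetSum _ fun i _ => ?_
    have := hw _ (hβi i) (hβis i)
    exact (EuclideanSpace.proj (𝕜 := ℝ) i).continuous.comp_continuousOn this
  refine h1.congr fun t ht => ?_
  have hint : ∀ i, Integrable (fun x => (β x i) • w t x) := fun i =>
    (hloc t ht).integrable_smul_left_of_hasCompactSupport (hβi i) (hβis i)
  have h2 : ∀ i, (∫ x, (β x i) • w t x) i = ∫ x, β x i * w t x i := fun i => by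
    have := ContinuousLinearMap.integral_comp_comm (EuclideanSpace.proj (𝕜 := ℝ) i) (hint i)
    simpa using this.symm
  simp only [h2]
  rw [← integral_finsetSum]
  · congr 1
    ext x
    simp [PiLp.inner_apply, mul_comm]
  · intro i _
    have := (EuclideanSpace.proj (𝕜 := ℝ) i).integrable_comp (hint i)
    simpa using this

theorem continuousOn_integral_smul_of_lipschitz {T : ℝ} {K : NNReal} {v : ℝ → ℝ → StateVec m}
    (hv : LipschitzWith K (fun p : ℝ × ℝ => v p.1 p.2))
    {φ : ℝ → ℝ} (hφ : Continuous φ) (hφs : HasCompactSupport φ) :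
    ContinuousOn (fun t => ∫ x, φ x • v t x) (Icc 0 T) := by
  have hc : Continuous (Function.uncurry fun t x => φ x • v t x) :=
    (hφ.comp continuous_snd).smul hv.continuous
  have h1 := continuous_parametric_integral_of_continuous (μ := volume) hc hφs.isCompact
  refine h1.continuousOn.congr fun t _ => ?_
  change _ = ∫ y in tsupport φ, φ y • v t y
  symm
  rw [setIntegral_eq_integral_of_forall_compl_eq_zero]
  intro x hx
  rw [image_eq_zero_of_notMem_tsupport hx, zero_smul]

/-- Duality for the `L²` norm, through the pointwise inequality `|w|² ≥ 2 w · β - |β|²`. It makes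
the norm lower semicontinuous under weak convergence. -/
theorem lintegral_sq_le_of_forall_integral_le {w : ℝ → StateVec m}
    (hw : AEStronglyMeasurable w volume) {A : ℝ} (hA : ∀ᵐ x, ‖w x‖ ≤ A) {B : ℝ}
    (h : ∀ β : ℝ → StateVec m, Continuous β → HasCompactSupport β →
      2 * ∫ x, inner ℝ (β x) (w x) ≤ B + ∫ x, ‖β x‖ ^ 2) :
    ∫⁻ x, ‖w x‖ₑ ^ 2 ≤ ENNReal.ofReal B := by
  set κ : ℝ → ℝ → ℝ := fun n x => clampUnit (n - |x|) with hκ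
  have hκc : ∀ n, Continuous (κ n) := fun n =>
    lipschitzWith_clampUnit.continuous.comp (by fun_prop)
  have hκz : ∀ n x, x ∉ Icc (-n) n → κ n x = 0 := fun n x hx => clampUnit_eq_zero (by
    by_contra! hlt
    exact hx (abs_le.1 (by linarith)))
  -- the truncated norms are bounded
  have key : ∀ n : ℝ, ∫ x, κ n x * ‖w x‖ ^ 2 ≤ B := by
    intro n
    set W : ℝ → StateVec m := (Icc (-n) n).indicator w with hW
    have hWm : MemLp W 2 volume := by
      rw [hW, memLp_indicator_iff_restrict measurableSet_Icc]
      have : IsFiniteMeasure ((volume : Measure ℝ).restrict (Icc (-n) n)) :=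
        ⟨by rw [Measure.restrict_apply_univ]; exact measure_Icc_lt_top⟩
      exact MemLp.of_bound hw.restrict A (ae_restrict_of_ae hA)
    refine le_of_forall_pos_le_add fun ε hε => ?_
    obtain ⟨g, hgs, hgε, hgc, hgm⟩ := hWm.exists_hasCompactSupport_eLpNorm_sub_le (by norm_num)
      (ε := ENNReal.ofReal (Real.sqrt ε)) (by simpa using hε)
    have hdiff : MemLp (W - g) 2 volume := hWm.sub hgm
    have hi1 : Integrable (fun x => ‖W x - g x‖ ^ 2) := hdiff.integrable_norm_pow (by norm_num)
    have hle1 : ∫ x, ‖W x - g x‖ ^ 2 ≤ ε := by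
      have h1 := hdiff.eLpNorm_eq_integral_rpow_norm (by norm_num) (by norm_num)
      rw [h1] at hgε
      have h2 := (ENNReal.ofReal_le_ofReal_iff (Real.sqrt_nonneg _)).1 hgε
      simp only [ENNReal.toReal_ofNat, Real.rpow_ofNat, Pi.sub_apply] at h2
      rw [← one_div, ← Real.sqrt_eq_rpow] at h2
      exact (Real.sqrt_le_sqrt_iff hε.le).1 h2
    have h3 := h (fun x => κ n x • g x) ((hκc n).smul hgc) (hgs.smul_left (f := κ n))
    have hkw : Integrable (fun x => κ n x * ‖w x‖ ^ 2) := by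
      refine integrable_of_bounded_of_eq_zero (k := Icc (-n) n) (c := A ^ 2)
        ((hκc n).aestronglyMeasurable.mul (hw.norm.pow 2)) isCompact_Icc
        (ae_of_all _ fun x hx => by rw [hκz n x hx, zero_mul]) ?_
      filter_upwards [hA] with x hx
      rw [norm_mul, norm_pow, norm_norm, Real.norm_of_nonneg (clampUnit_nonneg _)]
      calc κ n x * ‖w x‖ ^ 2 ≤ 1 * A ^ 2 :=
            mul_le_mul (clampUnit_le_one _) (pow_le_pow_left₀ (norm_nonneg _) hx 2)
              (by positivity) zero_le_one
        _ = A ^ 2 := one_mul _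
    have hgw : Integrable (fun x => inner ℝ (κ n x • g x) (w x)) := by
      obtain ⟨Ag, hAg⟩ := hgs.exists_bound_of_continuous hgc
      refine integrable_of_bounded_of_eq_zero (k := Icc (-n) n) (c := 1 * Ag * A)
        (((hκc n).smul hgc).aestronglyMeasurable.inner hw) isCompact_Icc
        (ae_of_all _ fun x hx => by rw [hκz n x hx, zero_smul, inner_zero_left]) ?_
      filter_upwards [hA] with x hx
      refine (norm_inner_le_norm _ _).trans ?_
      rw [norm_smul, Real.norm_of_nonneg (clampUnit_nonneg _)]
      have := norm_nonneg (g x)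
      have := clampUnit_le_one (n - |x|)
      have hAg0 := (norm_nonneg _).trans (hAg x)
      gcongr
      exact hAg x
    have hgg : Integrable (fun x => ‖κ n x • g x‖ ^ 2) := by
      have : Continuous (fun x => ‖κ n x • g x‖ ^ 2) := (((hκc n).smul hgc).norm).pow 2
      refine this.integrable_of_hasCompactSupport ?_
      exact (hgs.smul_left (f := κ n)).comp_left (g := fun z => ‖z‖ ^ 2) (by simp)
    have h4 : ∫ x, κ n x * ‖w x‖ ^ 2 ≤ (2 * ∫ x, inner ℝ (κ n x • g x) (w x))
        - (∫ x, ‖κ n x • g x‖ ^ 2) + ∫ x, ‖W x - g x‖ ^ 2 := by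
      have hadd := integral_add ((hgw.const_mul 2).sub hgg) hi1
      simp only [Pi.sub_apply] at hadd
      rw [← integral_const_mul, ← integral_sub (hgw.const_mul 2) hgg, ← hadd]
      refine integral_mono hkw (((hgw.const_mul 2).sub hgg).add hi1) fun x => ?_
      beta_reduce
      have hk0 := clampUnit_nonneg (n - |x|)
      have hk1 := clampUnit_le_one (n - |x|)
      rw [real_inner_smul_left, norm_smul, mul_pow, Real.norm_of_nonneg hk0]
      by_cases hx : x ∈ Icc (-n) n
      · have hWx : W x = w x := by simp [hW, hx]
        rw [hWx]
        have e1 : ‖w x - g x‖ ^ 2 = ‖w x‖ ^ 2 - 2 * inner ℝ (g x) (w x) + ‖g x‖ ^ 2 := by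
          rw [norm_sub_sq_real, real_inner_comm]
        have e2 : κ n x * ‖w x - g x‖ ^ 2 ≤ ‖w x - g x‖ ^ 2 :=
          mul_le_of_le_one_left (by positivity) hk1
        have e3 : κ n x ^ 2 * ‖g x‖ ^ 2 ≤ κ n x * ‖g x‖ ^ 2 :=
          mul_le_mul_of_nonneg_right (by nlinarith) (by positivity)
        rw [e1] at e2 ⊢
        nlinarith
      · rw [hκz n x hx, show clampUnit (n - |x|) = 0 from hκz n x hx]
        simp
    linarith
  have key2 : ∀ n : ℕ, ∫⁻ x in Icc (-(n : ℝ)) n, ‖w x‖ₑ ^ 2 ≤ ENNReal.ofReal B := by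
    intro n
    have hkw : Integrable (fun x => κ (n + 1) x * ‖w x‖ ^ 2) := by
      refine integrable_of_bounded_of_eq_zero (k := Icc (-((n : ℝ) + 1)) (n + 1)) (c := A ^ 2)
        ((hκc _).aestronglyMeasurable.mul (hw.norm.pow 2)) isCompact_Icc
        (ae_of_all _ fun x hx => by rw [hκz _ x hx, zero_mul]) ?_
      filter_upwards [hA] with x hx
      rw [norm_mul, norm_pow, norm_norm, Real.norm_of_nonneg (clampUnit_nonneg _)]
      calc κ (n + 1) x * ‖w x‖ ^ 2 ≤ 1 * A ^ 2 :=
            mul_le_mul (clampUnit_le_one _) (pow_le_pow_left₀ (norm_nonneg _) hx 2)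
              (by positivity) zero_le_one
        _ = A ^ 2 := one_mul _
    refine le_trans ?_ (ENNReal.ofReal_le_ofReal (key (n + 1)))
    rw [ofReal_integral_eq_lintegral_ofReal hkw
      (ae_of_all _ fun x => mul_nonneg (clampUnit_nonneg _) (by positivity)),
      ← lintegral_indicator measurableSet_Icc]
    refine lintegral_mono fun x => ?_
    by_cases hx : x ∈ Icc (-(n : ℝ)) n
    · have h1 : κ (n + 1) x = 1 := clampUnit_eq_one (by have := abs_le.2 hx; linarith)
      simp [hx, h1]
    · simp [hx]
  have hcov : AECover volume Filter.atTop (fun n : ℕ => Icc (-(n : ℝ)) n) :=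
    aecover_Icc (Filter.tendsto_neg_atTop_atBot.comp tendsto_natCast_atTop_atTop)
      tendsto_natCast_atTop_atTop
  exact le_of_tendsto' (hcov.lintegral_tendsto_of_countably_generated
    (hw.enorm.pow_const 2)) key2

end Trace

section InitialTrace

variable {m : ℕ}

theorem ae_strip_of_forall_ae {T : ℝ} {u : ℝ → ℝ → StateVec m}
    (hum : Measurable (fun p : ℝ × ℝ => u p.1 p.2)) {C : Set (StateVec m)} (hC : MeasurableSet C)
    (huC : ∀ t ∈ Icc 0 T, ∀ᵐ x, u t x ∈ C) :
    ∀ᵐ p ∂((volume : Measure (ℝ × ℝ)).restrict (strip T)), u p.1 p.2 ∈ C := by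
  rw [volume_restrict_strip, Measure.ae_prod_iff_ae_ae (hum hC)]
  filter_upwards [ae_restrict_mem measurableSet_Ioo] with t ht
  exact huC t (Ioo_subset_Icc_self ht)

theorem ae_strip_time {T : ℝ} {P : ℝ → Prop} (h : ∀ᵐ t, P t) :
    ∀ᵐ p ∂((volume : Measure (ℝ × ℝ)).restrict (strip T)), P p.1 := by
  rw [volume_restrict_strip]
  exact Measure.quasiMeasurePreserving_fst.ae (ae_restrict_of_ae h)

theorem ae_strip_mem (T : ℝ) :
    ∀ᵐ p ∂((volume : Measure (ℝ × ℝ)).restrict (strip T)), p.1 ∈ Ioo 0 T := by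
  filter_upwards [ae_restrict_mem (measurableSet_strip T)] with p hp using hp.1

theorem IsEntropySolution.locallyIntegrable_initial {U : Set (StateVec m)}
    {F : StateVec m → StateVec m} {η q : StateVec m → ℝ} {T : ℝ} {u0 : ℝ → StateVec m}
    {u : ℝ → ℝ → StateVec m} (hu : IsEntropySolution U F η q T u0 u) :
    LocallyIntegrable u0 volume := by
  rw [locallyIntegrable_iff]
  intro k hk
  obtain ⟨B, hBc, -, hB⟩ := hu.locally_bounded_initial k hk
  obtain ⟨A, hA⟩ := hBc.isBounded.exists_norm_le
  exact Measure.integrableOn_of_bounded hk.measure_lt_top.ne hu.aestronglyMeasurable_initial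
    (hB.mono fun x hx => hA _ hx)

/-- Testing the equation with `ζ(t) χ(x) e`, where `ζ` is a cut-off in time, bounds the means over
short time intervals. -/
theorem IsEntropySolution.integral_inner_le {U : Set (StateVec m)}
    {F : StateVec m → StateVec m} {η q : StateVec m → ℝ} {T : ℝ} {u0 : ℝ → StateVec m}
    {u : ℝ → ℝ → StateVec m} (hu : IsEntropySolution U F η q T u0 u) {C : Set (StateVec m)}
    (hC : IsCompact C) (hF : ContinuousOn F C)
    (huC : ∀ᵐ p ∂((volume : Measure (ℝ × ℝ)).restrict (strip T)), u p.1 p.2 ∈ C)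
    {χ : ℝ → ℝ} (hχ : ContDiff ℝ 1 χ) (hχs : HasCompactSupport χ) (e : StateVec m) :
    ∃ c, 0 ≤ c ∧ ∀ a b, 0 < a → a < b → b < T →
      ∫ t in Ioo a b, ∫ x, inner ℝ (χ x • e) (u t x)
        ≤ (b - a) * ((∫ x, inner ℝ (χ x • e) (u0 x)) + c * b) := by
  obtain ⟨AF, hAF⟩ := hC.exists_bound_of_continuousOn hF
  obtain ⟨AI, hAI⟩ := hC.isBounded.exists_norm_le
  have hχ'c : Continuous (deriv χ) := hχ.continuous_deriv le_rfl
  have hχ's : HasCompactSupport (deriv χ) := hχs.deriv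
  obtain ⟨Kχ, hKχ⟩ := hχ.lipschitzWith_of_hasCompactSupport hχs (by norm_num)
  obtain ⟨Aχ, hAχ⟩ := hχs.exists_bound_of_continuous hχ.continuous
  obtain ⟨Aχ', hAχ'⟩ := hχ's.exists_bound_of_continuous hχ'c
  have hfin : IsFiniteMeasure ((volume : Measure ℝ).restrict (Ioo 0 T)) :=
    ⟨by rw [Measure.restrict_apply_univ]; exact measure_Ioo_lt_top⟩
  refine ⟨∫ x, ‖deriv χ x • e‖ * |AF|, integral_nonneg fun x => by positivity, ?_⟩
  set c := ∫ x, ‖deriv χ x • e‖ * |AF| with hc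
  intro a b ha hab hbT
  have hb : 0 < b := ha.trans hab
  obtain ⟨Kζ, hKζ⟩ := exists_lipschitzWith_timeCutoff a b
  set ζ := timeCutoff a b with hζ
  set ζ' : ℝ → ℝ := fun t => if t ∈ Ioo a b then -(b - a)⁻¹ else 0 with hζ'
  have hζb : ∀ p : ℝ × ℝ, ‖ζ p.1‖ ≤ (1 : NNReal) := fun p => by
    rw [Real.norm_of_nonneg (timeCutoff_nonneg _ _ _)]; exact timeCutoff_le_one _ _ _
  set φ : ℝ × ℝ → StateVec m := fun p => (ζ p.1 • χ p.2) • e with hφ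
  have hl1 : LipschitzWith _ (fun p : ℝ × ℝ => ζ p.1) := hKζ.comp LipschitzWith.prod_fst
  have hl2 : LipschitzWith _ (fun p : ℝ × ℝ => χ p.2) := hKχ.comp LipschitzWith.prod_snd
  have hl3 := hl1.smul_of_bounded hl2 hζb (B := Aχ.toNNReal)
    (fun p => (hAχ _).trans (Real.le_coe_toNNReal _))
  have hl4 : LipschitzWith _ φ := hl3.smul_of_bounded (LipschitzWith.const e)
    (A := Aχ.toNNReal) (B := ‖e‖₊) (fun p => by
      rw [norm_smul]
      calc ‖ζ p.1‖ * ‖χ p.2‖ ≤ 1 * ‖χ p.2‖ := by gcongr; exact hζb p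
        _ ≤ _ := by rw [one_mul]; exact (hAχ _).trans (Real.le_coe_toNNReal _)) (fun p => le_rfl)
  obtain ⟨r, hr⟩ := hχs.isCompact.isBounded.subset_closedBall 0
  have hχz : ∀ x, x ∉ Icc (-r) r → χ x = 0 := fun x hx =>
    image_eq_zero_of_notMem_tsupport fun h => hx (by
      have := hr h
      rwa [Real.closedBall_eq_Icc, zero_sub, zero_add] at this)
  have htest : IsTestFunction T φ := by
    refine isTestFunction_of_eq_zero (r := r) hbT hl4 fun p hp => ?_
    rw [mem_prod, not_and_or] at hp
    rcases hp with hp | hp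
    · have : ζ p.1 = 0 := by
        rw [mem_Icc, not_and_or, not_le, not_le] at hp
        rcases hp with hp | hp
        · exact timeCutoff_eq_zero_of_le_neg hp.le
        · exact timeCutoff_eq_zero_of_le hab hp.le
      simp [hφ, this]
    · simp [hφ, hχz _ hp]
  have hweak := hu.weak_equation φ htest
  have hζ0 : ζ 0 = 1 := timeCutoff_eq_one hab (by norm_num) ha.le
  have hinit : ∫ x, inner ℝ (φ (0, x)) (u0 x) = ∫ x, inner ℝ (χ x • e) (u0 x) := by
    simp [hφ, hζ0]
  have hae : (fun p : ℝ × ℝ => inner ℝ (dt (fun t x => φ (t, x)) p.1 p.2) (u p.1 p.2)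
      + inner ℝ (dx (fun t x => φ (t, x)) p.1 p.2) (F (u p.1 p.2)))
      =ᵐ[volume.restrict (strip T)] fun p => ζ' p.1 * inner ℝ (χ p.2 • e) (u p.1 p.2)
        + ζ p.1 * inner ℝ (deriv χ p.2 • e) (F (u p.1 p.2)) := by
    have hne : ∀ᵐ t : ℝ, t ≠ a ∧ t ≠ b := by
      have h1 : ∀ᵐ t : ℝ, t ≠ a := by simp [ae_iff]
      have h2 : ∀ᵐ t : ℝ, t ≠ b := by simp [ae_iff]
      exact h1.and h2
    filter_upwards [ae_strip_time hne, ae_strip_mem T] with p hp hpT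
    have h1 : dt (fun t x => φ (t, x)) p.1 p.2 = (ζ' p.1 • χ p.2) • e :=
      (((hasDerivAt_timeCutoff hab hpT.1 hp.1 hp.2).smul_const (χ p.2)).smul_const e).deriv
    have h2 : dx (fun t x => φ (t, x)) p.1 p.2 = (ζ p.1 • deriv χ p.2) • e :=
      ((((hχ.differentiable one_ne_zero) p.2).hasDerivAt.const_smul (ζ p.1)).smul_const e).deriv
    rw [h1, h2]
    simp only [real_inner_smul_left, smul_eq_mul]
    ring
  have hum := hu.aestronglyMeasurable
  have mF := aestronglyMeasurable_comp_of_mem hC.measurableSet hF hum.aemeasurable huC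
  have hζ'm : Measurable ζ' := Measurable.ite measurableSet_Ioo measurable_const measurable_const
  have hz2 : ∀ p : ℝ × ℝ, p ∉ Icc 0 T ×ˢ Icc (-r) r → p.1 ∈ Ioo 0 T → p.2 ∉ Icc (-r) r :=
    fun p hp hpT h => hp ⟨Ioo_subset_Icc_self hpT, h⟩
  have hk : IsCompact (Icc 0 T ×ˢ Icc (-r) r : Set (ℝ × ℝ)) := isCompact_Icc.prod isCompact_Icc
  have hχ'z : ∀ x, x ∉ tsupport χ → deriv χ x = 0 := fun x hx =>
    image_eq_zero_of_notMem_tsupport fun h => hx (tsupport_deriv_subset h)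
  have hχ'r : ∀ x, x ∉ Icc (-r) r → deriv χ x = 0 := fun x hx => hχ'z x fun h => hx (by
      have := hr h
      rwa [Real.closedBall_eq_Icc, zero_sub, zero_add] at this)
  have i0 : Integrable (fun p : ℝ × ℝ => inner ℝ (χ p.2 • e) (u p.1 p.2))
      (volume.restrict (strip T)) := by
    refine integrable_of_bounded_of_eq_zero (c := Aχ * ‖e‖ * AI)
      ((((hχ.continuous.comp continuous_snd).smul continuous_const).aestronglyMeasurable).inner hum)
      hk ?_ ?_
    · filter_upwards [ae_strip_mem T] with p hpT hp
      rw [hχz _ (hz2 p hp hpT), zero_smul, inner_zero_left]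
    · filter_upwards [huC] with p hp
      refine (norm_inner_le_norm _ _).trans ?_
      rw [norm_smul]
      have hAχ0 := (norm_nonneg _).trans (hAχ p.2)
      gcongr
      · exact hAχ _
      · exact hAI _ hp
  have i1 : Integrable (fun p : ℝ × ℝ => ζ' p.1 * inner ℝ (χ p.2 • e) (u p.1 p.2))
      (volume.restrict (strip T)) := by
    refine i0.bdd_mul (c := |(b - a)⁻¹|) (hζ'm.comp measurable_fst).aestronglyMeasurable
      (ae_of_all _ fun p => ?_)
    simp only [hζ']
    split_ifs
    · rw [norm_neg, Real.norm_eq_abs]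
    · simp
  have i2 : Integrable (fun p : ℝ × ℝ => ζ p.1 * inner ℝ (deriv χ p.2 • e) (F (u p.1 p.2)))
      (volume.restrict (strip T)) := by
    refine integrable_of_bounded_of_eq_zero (c := 1 * (Aχ' * ‖e‖ * AF))
      (hl1.continuous.aestronglyMeasurable.mul
        ((((hχ'c.comp continuous_snd).smul continuous_const).aestronglyMeasurable).inner mF))
      hk ?_ ?_
    · filter_upwards [ae_strip_mem T] with p hpT hp
      rw [hχ'r _ (hz2 p hp hpT), zero_smul, inner_zero_left, mul_zero]
    · filter_upwards [huC] with p hp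
      rw [norm_mul]
      have hn : ‖inner ℝ (deriv χ p.2 • e) (F (u p.1 p.2))‖ ≤ Aχ' * ‖e‖ * AF := by
        refine (norm_inner_le_norm _ _).trans ?_
        rw [norm_smul]
        have hAχ0 := (norm_nonneg _).trans (hAχ' p.2)
        gcongr
        · exact hAχ' _
        · exact hAF _ hp
      exact mul_le_mul (hζb p) hn (norm_nonneg _) zero_le_one
  rw [integral_congr_ae hae, integral_add i1 i2, hinit] at hweak
  have e1 : ∫ p in strip T, ζ' p.1 * inner ℝ (χ p.2 • e) (u p.1 p.2)
      = -(b - a)⁻¹ * ∫ t in Ioo a b, ∫ x, inner ℝ (χ x • e) (u t x) := by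
    rw [volume_restrict_strip] at i1 ⊢
    rw [integral_prod _ i1]
    simp only [integral_const_mul]
    have h1 : ∀ t, ζ' t * ∫ x, inner ℝ (χ x • e) (u t x)
        = (Ioo a b).indicator (fun t => -(b - a)⁻¹ * ∫ x, inner ℝ (χ x • e) (u t x)) t := by
      intro t
      simp only [hζ', indicator]
      split_ifs <;> simp
    simp only [h1]
    rw [integral_indicator measurableSet_Ioo, Measure.restrict_restrict measurableSet_Ioo,
      inter_eq_left.2 (Ioo_subset_Ioo ha.le hbT.le), integral_const_mul]
  have e2 : ∫ p in strip T, ζ p.1 * inner ℝ (deriv χ p.2 • e) (F (u p.1 p.2)) ≤ c * b := by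
    have hi3 : Integrable (fun x => ‖deriv χ x • e‖ * |AF|) := by
      refine Continuous.integrable_of_hasCompactSupport (by fun_prop) ?_
      exact (hχ's.comp_left (g := fun z : ℝ => ‖z • e‖ * |AF|) (by simp))
    have hi4 : Integrable ((Iio b).indicator (fun _ => (1 : ℝ))) (volume.restrict (Ioo 0 T)) :=
      (integrable_const _).indicator measurableSet_Iio
    have h1 : ∫ p in strip T, (Iio b).indicator (fun _ => (1 : ℝ)) p.1
        * (‖deriv χ p.2 • e‖ * |AF|) = c * b := by
      rw [volume_restrict_strip, integral_prod_mul ((Iio b).indicator fun _ => (1 : ℝ))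
          (fun x => ‖deriv χ x • e‖ * |AF|), mul_comm, ← hc,
        integral_indicator measurableSet_Iio, Measure.restrict_restrict measurableSet_Iio]
      have : Iio b ∩ Ioo 0 T = Ioo 0 b := by
        ext t
        simp only [mem_inter_iff, mem_Iio, mem_Ioo]
        constructor
        · rintro ⟨h1, h2, h3⟩; exact ⟨h2, h1⟩
        · rintro ⟨h1, h2⟩; exact ⟨h2, h1, h2.trans hbT⟩
      rw [this, setIntegral_const, Real.volume_real_Ioo_of_le hb.le]
      simp
    rw [← h1]
    refine integral_mono_ae i2 ?_ ?_
    · rw [volume_restrict_strip]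
      exact hi4.mul_prod hi3
    · filter_upwards [huC] with p hp
      have hn : inner ℝ (deriv χ p.2 • e) (F (u p.1 p.2)) ≤ ‖deriv χ p.2 • e‖ * |AF| :=
        (real_inner_le_norm _ _).trans (mul_le_mul_of_nonneg_left
          ((hAF _ hp).trans (le_abs_self _)) (norm_nonneg _))
      have hn0 : 0 ≤ ‖deriv χ p.2 • e‖ * |AF| := by positivity
      by_cases hpb : p.1 < b
      · rw [indicator_of_mem (by exact hpb), one_mul]
        calc ζ p.1 * inner ℝ (deriv χ p.2 • e) (F (u p.1 p.2))
            ≤ ζ p.1 * (‖deriv χ p.2 • e‖ * |AF|) :=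
              mul_le_mul_of_nonneg_left hn (timeCutoff_nonneg _ _ _)
          _ ≤ _ := mul_le_of_le_one_left hn0 (timeCutoff_le_one _ _ _)
      · rw [indicator_of_notMem (by exact hpb), zero_mul,
          show ζ p.1 = 0 from timeCutoff_eq_zero_of_le hab (not_lt.1 hpb), zero_mul]
  rw [e1] at hweak
  have hba : 0 < b - a := by linarith
  have h3 : (b - a)⁻¹ * ∫ t in Ioo a b, ∫ x, inner ℝ (χ x • e) (u t x)
      ≤ (∫ x, inner ℝ (χ x • e) (u0 x)) + c * b := by linarith
  rwa [inv_mul_le_iff₀ hba] at h3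

/-- The weak form of the equation makes the initial datum the trace of the weakly continuous
representative at time zero. -/
theorem IsEntropySolution.initial_eq {U : Set (StateVec m)}
    {F : StateVec m → StateVec m} {η q : StateVec m → ℝ} {T : ℝ} (hT : 0 < T)
    {u0 : ℝ → StateVec m}
    {u : ℝ → ℝ → StateVec m} (hu : IsEntropySolution U F η q T u0 u) {C : Set (StateVec m)}
    (hC : IsCompact C) (hF : ContinuousOn F C)
    (huC : ∀ᵐ p ∂((volume : Measure (ℝ × ℝ)).restrict (strip T)), u p.1 p.2 ∈ C) :
    ∀ᵐ x, u 0 x = u0 x := by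
  have h0 : (0 : ℝ) ∈ Icc 0 T := ⟨le_rfl, hT.le⟩
  have hloc := hu.locallyIntegrable_slice 0 h0
  have hloc0 := hu.locallyIntegrable_initial
  refine ae_eq_of_integral_contDiff_smul_eq hloc hloc0 fun χ hχ hχs => ?_
  have key : ∀ e : StateVec m, ∫ x, inner ℝ (χ x • e) (u 0 x) ≤ ∫ x, inner ℝ (χ x • e) (u0 x) := by
    intro e
    obtain ⟨c, hc0, hc⟩ := hu.integral_inner_le hC hF huC (hχ.of_le (by simp)) hχs e
    have hcont : ContinuousOn (fun t => ∫ x, inner ℝ (χ x • e) (u t x)) (Icc 0 T) :=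
      continuousOn_integral_inner hu.locallyIntegrable_slice hu.weakly_continuous
        (hχ.continuous.smul continuous_const) (hχs.smul_right (f' := fun _ => e))
    have hτ : ∀ τ ∈ Ioo 0 T, ∫ x, inner ℝ (χ x • e) (u τ x)
        ≤ (∫ x, inner ℝ (χ x • e) (u0 x)) + c * τ := by
      intro τ hτ
      refine hcont.le_of_integral_le hτ.1 hτ.2.le fun a b ha hab hb => ?_
      refine (hc a b ha hab (hb.trans hτ.2)).trans ?_
      have : c * b ≤ c * τ := mul_le_mul_of_nonneg_left hb.le hc0
      have hba : 0 ≤ b - a := by linarith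
      gcongr
    have hne : (nhdsWithin (0 : ℝ) (Ioo 0 T)).NeBot := left_nhdsWithin_Ioo_neBot hT
    have l1 : Filter.Tendsto (fun t => ∫ x, inner ℝ (χ x • e) (u t x)) (nhdsWithin 0 (Ioo 0 T))
        (nhds (∫ x, inner ℝ (χ x • e) (u 0 x))) := (hcont 0 h0).mono Ioo_subset_Icc_self
    have l2 : Filter.Tendsto (fun τ : ℝ => (∫ x, inner ℝ (χ x • e) (u0 x)) + c * τ)
        (nhdsWithin 0 (Ioo 0 T)) (nhds ((∫ x, inner ℝ (χ x • e) (u0 x)) + c * 0)) :=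
      (Continuous.tendsto (by fun_prop) 0).mono_left nhdsWithin_le_nhds
    rw [mul_zero, add_zero] at l2
    exact le_of_tendsto_of_tendsto l1 l2 (by
      filter_upwards [self_mem_nhdsWithin] with τ h using hτ τ h)
  have hi : ∀ w : ℝ → StateVec m, LocallyIntegrable w volume → Integrable (fun x => χ x • w x) :=
    fun w hw => hw.integrable_smul_left_of_hasCompactSupport hχ.continuous hχs
  have hswap : ∀ (w : ℝ → StateVec m) (_ : LocallyIntegrable w volume) (e : StateVec m),
      ∫ x, inner ℝ (χ x • e) (w x) = inner ℝ e (∫ x, χ x • w x) := by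
    intro w hw e
    rw [← integral_inner (hi w hw)]
    simp only [real_inner_smul_left, real_inner_smul_right]
  refine ext_inner_left ℝ fun e => ?_
  have k1 := key e
  have k2 := key (-e)
  rw [hswap _ hloc, hswap _ hloc0] at k1 k2
  rw [inner_neg_left, inner_neg_left] at k2
  linarith

end InitialTrace

/-! ### Weights in time and space -/

section Weights

/-- The Gronwall weight `exp (-∫₀ᵗ k)`, extended by `1` to negative times. -/
noncomputable def gronwallWeight (k : ℝ → ℝ) (t : ℝ) : ℝ :=
  Real.exp (-∫ s in (0 : ℝ)..t, (Ioi (0 : ℝ)).indicator k s)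

variable {k : ℝ → ℝ} (hk : Measurable k) (hk0 : ∀ t, 0 ≤ k t) {c : ℝ} (hc : ∀ t, k t ≤ c)
include hk hk0 hc

theorem locallyIntegrable_indicator_Ioi :
    LocallyIntegrable ((Ioi (0 : ℝ)).indicator k) volume := by
  rw [locallyIntegrable_iff]
  intro K hK
  refine Measure.integrableOn_of_bounded (M := c) hK.measure_lt_top.ne
    (hk.indicator measurableSet_Ioi).aestronglyMeasurable (ae_of_all _ fun t => ?_)
  have := hk0 t
  have := hc t
  by_cases ht : t ∈ Ioi (0 : ℝ)
  · simpa [ht, abs_of_nonneg (hk0 t)] using hc t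
  · simp only [ht, not_false_eq_true, indicator_of_notMem, norm_zero]
    linarith

theorem intervalIntegrable_indicator_Ioi (a b : ℝ) :
    IntervalIntegrable ((Ioi (0 : ℝ)).indicator k) volume a b :=
  intervalIntegrable_iff.2 (((locallyIntegrable_indicator_Ioi hk hk0 hc).integrableOn_isCompact
    isCompact_uIcc).mono_set uIoc_subset_uIcc)

omit hk hc in
theorem indicator_Ioi_nonneg (t : ℝ) : 0 ≤ (Ioi (0 : ℝ)).indicator k t :=
  indicator_nonneg (fun t _ => hk0 t) t

theorem monotone_primitive_indicator_Ioi :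
    Monotone fun t => ∫ s in (0 : ℝ)..t, (Ioi (0 : ℝ)).indicator k s := by
  intro a b hab
  have hi := intervalIntegrable_indicator_Ioi hk hk0 hc
  have h1 := intervalIntegral.integral_interval_sub_left (hi 0 b) (hi 0 a)
  have h2 : 0 ≤ ∫ s in a..b, (Ioi (0 : ℝ)).indicator k s :=
    intervalIntegral.integral_nonneg_of_forall hab (indicator_Ioi_nonneg hk0)
  beta_reduce
  linarith

omit hk hk0 hc in
theorem primitive_indicator_Ioi_of_nonpos {t : ℝ} (ht : t ≤ 0) :
    ∫ s in (0 : ℝ)..t, (Ioi (0 : ℝ)).indicator k s = 0 := by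
  rw [intervalIntegral.integral_of_ge ht, setIntegral_congr_fun (g := fun _ => 0) measurableSet_Ioc]
  · simp
  · intro s hs
    exact indicator_of_notMem (notMem_Ioi.2 hs.2) _

omit hk hc in
theorem primitive_indicator_Ioi_nonneg (t : ℝ) :
    0 ≤ ∫ s in (0 : ℝ)..t, (Ioi (0 : ℝ)).indicator k s := by
  rcases le_total t 0 with h | h
  · rw [primitive_indicator_Ioi_of_nonpos h]
  · exact intervalIntegral.integral_nonneg_of_forall h (indicator_Ioi_nonneg hk0)

omit hk hc in
theorem gronwallWeight_le_one (t : ℝ) : gronwallWeight k t ≤ 1 := by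
  rw [gronwallWeight, Real.exp_le_one_iff]
  linarith [primitive_indicator_Ioi_nonneg hk0 t]

theorem antitone_gronwallWeight : Antitone (gronwallWeight k) := fun _ _ hab =>
  Real.exp_le_exp.2 (neg_le_neg (monotone_primitive_indicator_Ioi hk hk0 hc hab))

theorem exists_lipschitzWith_gronwallWeight : ∃ K, LipschitzWith K (gronwallWeight k) := by
  have hc0 : 0 ≤ c := (hk0 0).trans (hc 0)
  have hi := intervalIntegrable_indicator_Ioi hk hk0 hc
  have h1 : LipschitzWith c.toNNReal (fun t => ∫ s in (0 : ℝ)..t, (Ioi (0 : ℝ)).indicator k s) := by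
    refine LipschitzWith.of_dist_le_mul fun a b => ?_
    rw [Real.coe_toNNReal _ hc0, dist_eq_norm,
      intervalIntegral.integral_interval_sub_left (hi 0 a) (hi 0 b), Real.dist_eq]
    refine intervalIntegral.norm_integral_le_of_norm_le_const fun t _ => ?_
    by_cases ht : t ∈ Ioi (0 : ℝ)
    · simpa [ht, abs_of_nonneg (hk0 t)] using hc t
    · simpa [ht] using hc0
  have h2 : LipschitzOnWith 1 (fun x : ℝ => Real.exp (-x)) (Ici 0) := by
    refine (convex_Ici 0).lipschitzOnWith_of_nnnorm_hasDerivWithin_le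
      (f' := fun x => -Real.exp (-x)) (fun x _ => ?_) fun x hx => ?_
    · have := ((hasDerivAt_id x).neg.exp).hasDerivWithinAt (s := Ici 0)
      simpa using this
    · rw [← NNReal.coe_le_coe, coe_nnnorm, norm_neg, Real.norm_of_nonneg (Real.exp_pos _).le,
        NNReal.coe_one, Real.exp_le_one_iff, Left.neg_nonpos_iff]
      exact hx
  have h3 := h2.comp (h1.lipschitzOnWith (s := univ))
    (fun t _ => primitive_indicator_Ioi_nonneg hk0 t)
  exact ⟨_, lipschitzOnWith_univ.1 h3⟩

theorem ae_hasDerivAt_gronwallWeight :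
    ∀ᵐ t, 0 < t → HasDerivAt (gronwallWeight k) (-(k t * gronwallWeight k t)) t := by
  filter_upwards [LocallyIntegrable.ae_hasDerivAt_integral
    (locallyIntegrable_indicator_Ioi hk hk0 hc)] with t ht ht0
  have := (ht 0).neg.exp
  rw [indicator_of_mem (by exact ht0)] at this
  convert! this using 1
  simp only [gronwallWeight, Pi.neg_apply]
  ring

omit hk hk0 hc

/-- A spatial cut-off whose support shrinks with speed `s`. -/
noncomputable def coneCutoff (s r T : ℝ) (p : ℝ × ℝ) : ℝ := clampUnit (r + s * (T - p.1) - |p.2|)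

theorem exists_lipschitzWith_coneCutoff (s r T : ℝ) : ∃ K, LipschitzWith K (coneCutoff s r T) := by
  have h1 : LipschitzWith (‖s‖₊ + 1) (fun p : ℝ × ℝ => r + s * (T - p.1) - |p.2|) := by
    refine LipschitzWith.of_dist_le_mul fun p w => ?_
    rw [Real.dist_eq]
    have h2 : |p.1 - w.1| ≤ dist p w := by
      rw [← Real.dist_eq, Prod.dist_eq]; exact le_max_left _ _
    have h3 : |p.2 - w.2| ≤ dist p w := by
      rw [← Real.dist_eq, Prod.dist_eq]; exact le_max_right _ _
    have h4 := abs_abs_sub_abs_le p.2 w.2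
    have h5 : r + s * (T - p.1) - |p.2| - (r + s * (T - w.1) - |w.2|)
        = -(s * (p.1 - w.1)) - (|p.2| - |w.2|) := by ring
    rw [h5]
    refine (abs_sub _ _).trans ?_
    rw [abs_neg, abs_mul]
    push_cast
    rw [Real.norm_eq_abs, add_mul, one_mul]
    have := abs_nonneg s
    gcongr
    exact h4.trans h3
  exact ⟨_, lipschitzWith_clampUnit.comp h1⟩

/-- Finite speed of propagation: the cut-off grows backwards in time along every line of speed at
most `s`. -/
theorem coneCutoff_deriv_le {s r T : ℝ} (hs : 0 ≤ s) {p : ℝ × ℝ}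
    (hp : DifferentiableAt ℝ (coneCutoff s r T) p) :
    s * |dx (fun t x => coneCutoff s r T (t, x)) p.1 p.2|
      ≤ -dt (fun t x => coneCutoff s r T (t, x)) p.1 p.2 := by
  set D := fderiv ℝ (coneCutoff s r T) p with hD
  have h1 : ∀ ε : ℝ, |ε| = 1 → 0 ≤ D (-1, ε * s) := by
    intro ε hε
    have hl : HasDerivAt (fun δ : ℝ => p + δ • ((-1 : ℝ), ε * s)) ((-1 : ℝ), ε * s) 0 := by
      simpa using ((hasDerivAt_id (0 : ℝ)).smul_const ((-1 : ℝ), ε * s)).const_add p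
    have hp' : HasFDerivAt (coneCutoff s r T) D (p + (0 : ℝ) • ((-1 : ℝ), ε * s)) := by
      simpa using hp.hasFDerivAt
    refine (hp'.comp_hasDerivAt 0 hl).nonneg_of_monotone fun δ δ' h => ?_
    simp only [Function.comp, coneCutoff]
    refine monotone_clampUnit ?_
    simp only [Prod.smul_mk, Prod.fst_add, Prod.snd_add, smul_eq_mul]
    have h2 : |p.2 + δ' * (ε * s)| ≤ |p.2 + δ * (ε * s)| + (δ' - δ) * s := by
      have h3 : p.2 + δ' * (ε * s) = (p.2 + δ * (ε * s)) + (δ' - δ) * (ε * s) := by ring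
      rw [h3]
      refine (abs_add_le _ _).trans ?_
      rw [abs_mul, abs_mul, hε, abs_of_nonneg hs, abs_of_nonneg (sub_nonneg.2 h), one_mul]
    nlinarith
  have e1 : dt (fun t x => coneCutoff s r T (t, x)) p.1 p.2 = D (1, 0) := by
    have hl : HasDerivAt (fun t : ℝ => (t, p.2)) ((1 : ℝ), (0 : ℝ)) p.1 :=
      (hasDerivAt_id p.1).prodMk (hasDerivAt_const p.1 p.2)
    exact (HasFDerivAt.comp_hasDerivAt p.1 (l := coneCutoff s r T) hp.hasFDerivAt hl).deriv
  have e2 : dx (fun t x => coneCutoff s r T (t, x)) p.1 p.2 = D (0, 1) := by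
    have hl : HasDerivAt (fun x : ℝ => (p.1, x)) ((0 : ℝ), (1 : ℝ)) p.2 :=
      (hasDerivAt_const p.2 p.1).prodMk (hasDerivAt_id p.2)
    exact (HasFDerivAt.comp_hasDerivAt p.2 (l := coneCutoff s r T) hp.hasFDerivAt hl).deriv
  have e3 : ∀ z : ℝ, D (-1, z) = -D (1, 0) + z * D (0, 1) := by
    intro z
    have : ((-1 : ℝ), z) = -((1 : ℝ), (0 : ℝ)) + z • ((0 : ℝ), (1 : ℝ)) := by simp
    rw [this, map_add, map_neg, map_smul, smul_eq_mul]
  have h2 := h1 1 (by simp)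
  have h3 := h1 (-1) (by simp)
  rw [e3] at h2 h3
  rw [e1, e2]
  rcases abs_cases (D (0, 1)) with ⟨h, -⟩ | ⟨h, -⟩ <;> rw [h] <;> linarith

end Weights

/-! ### The stability estimate along one path -/

section PathEstimate

variable {m : ℕ}

namespace EntropyBounds

variable {U C : Set (StateVec m)} {F : StateVec m → StateVec m} {η q : StateVec m → ℝ}
  {cF ηlow ηup : ℝ} (hB : EntropyBounds U C F η q cF ηlow ηup)
include hB

/-- The production term of the relative entropy is controlled by the residual `vt + DF(b) vx` and
by the relative entropy. -/
theorem neg_production_le {a b : StateVec m} (ha : a ∈ C) (hb : b ∈ C) (vt vx : StateVec m) :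
    -(fderiv ℝ (fderiv ℝ η) b vt (a - b) + fderiv ℝ (fderiv ℝ η) b vx (F a - F b))
      ≤ 1 / 2 * ‖vt + fderiv ℝ F b vx‖ ^ 2
        + ηlow⁻¹ * (ηup * cF * ‖vx‖ + ηup ^ 2) * relEntropy η a b := by
  set r := vt + fderiv ℝ F b vx with hr
  have hup := hB.up_pos
  have hlow := hB.low_pos
  have hcF := hB.cF_pos
  have e1 : fderiv ℝ (fderiv ℝ η) b vt (a - b) + fderiv ℝ (fderiv ℝ η) b vx (F a - F b)
      = fderiv ℝ (fderiv ℝ η) b r (a - b)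
        + fderiv ℝ (fderiv ℝ η) b vx (F a - F b - fderiv ℝ F b (a - b)) := by
    have : vt = r - fderiv ℝ F b vx := by rw [hr]; abel
    rw [this, map_sub (fderiv ℝ (fderiv ℝ η) b) r, sub_apply, hB.hessian_fderiv_symm hb,
      map_sub _ (F a - F b)]
    ring
  rw [e1]
  have h1 := (neg_le_abs _).trans (hB.abs_hessian_le hb r (a - b))
  have h2 := (neg_le_abs _).trans
    (hB.abs_hessian_le hb vx (F a - F b - fderiv ℝ F b (a - b)))
  have h3 : ηup * ‖vx‖ * ‖F a - F b - fderiv ℝ F b (a - b)‖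
      ≤ ηup * ‖vx‖ * (cF / 2 * ‖a - b‖ ^ 2) :=
    mul_le_mul_of_nonneg_left (hB.norm_flux_sub_le ha hb) (by positivity)
  have h4 : ηup * ‖r‖ * ‖a - b‖ ≤ 1 / 2 * ‖r‖ ^ 2 + 1 / 2 * ηup ^ 2 * ‖a - b‖ ^ 2 := by
    nlinarith [sq_nonneg (‖r‖ - ηup * ‖a - b‖)]
  have h5 : (ηup * cF * ‖vx‖ + ηup ^ 2) * (1 / 2 * ‖a - b‖ ^ 2)
      ≤ (ηup * cF * ‖vx‖ + ηup ^ 2) * (ηlow⁻¹ * relEntropy η a b) := by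
    refine mul_le_mul_of_nonneg_left ?_ (by positivity)
    rw [le_inv_mul_iff₀ hlow]
    linarith [hB.le_relEntropy ha hb]
  nlinarith

theorem stResidual_eq {v : ℝ → ℝ → StateVec m} {p : ℝ × ℝ}
    (hv : DifferentiableAt ℝ (fun p : ℝ × ℝ => v p.1 p.2) p) (hvU : v p.1 p.2 ∈ U) :
    stResidual F v p.1 p.2 = dt v p.1 p.2 + fderiv ℝ F (v p.1 p.2) (dx v p.1 p.2) := by
  rw [stResidual]
  congr 1
  exact ((hB.flux.hasFDerivAt_fderiv_of_two hB.isOpen hvU).comp_hasDerivAt p.2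
    (DifferentiableAt.hasDerivAt_dx hv)).deriv

end EntropyBounds

theorem integrable_norm_sq_of_lintegral {α : Type*} [MeasurableSpace α] {μ : Measure α}
    {V : Type*} [NormedAddCommGroup V] {f : α → V} (hf : AEStronglyMeasurable f μ)
    (h : ∫⁻ x, ‖f x‖ₑ ^ 2 ∂μ ≠ ∞) :
    Integrable (fun x => ‖f x‖ ^ 2) μ ∧
      ∫ x, ‖f x‖ ^ 2 ∂μ = (∫⁻ x, ‖f x‖ₑ ^ 2 ∂μ).toReal := by
  have h1 : ∀ x, ENNReal.ofReal (‖f x‖ ^ 2) = ‖f x‖ₑ ^ 2 := fun x => by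
    rw [ENNReal.ofReal_pow (norm_nonneg _), ofReal_norm]
  constructor
  · refine ⟨hf.norm.pow 2, ?_⟩
    rw [hasFiniteIntegral_iff_ofReal (ae_of_all _ fun x => by positivity)]
    simp only [h1]
    exact h.lt_top
  · rw [integral_eq_lintegral_of_nonneg_ae (f := fun x => ‖f x‖ ^ 2)
      (ae_of_all _ fun x => sq_nonneg _) (hf.norm.pow 2)]
    simp only [h1]

/-- The pointwise estimate behind the weighted relative entropy inequality: `E`, `Q`, `X` are the
relative entropy, its flux and its production, `θ`, `ζ`, `χ` the Gronwall weight and the cut-offs in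
time and space. -/
theorem weighted_integrand_le {θ ζ ζ' χ χt χx E Q X k r s : ℝ} (hθ0 : 0 ≤ θ) (hθ1 : θ ≤ 1)
    (hζ0 : 0 ≤ ζ) (hχ0 : 0 ≤ χ) (hχ1 : χ ≤ 1) (hχ : s * |χx| ≤ -χt) (hE : 0 ≤ E)
    (hQ : |Q| ≤ s * E) (hX : -X ≤ 1 / 2 * r + k * E) (hr : 0 ≤ r) :
    (-(k * θ) * (ζ * χ) + θ * (ζ' * χ + ζ * χt)) * E + θ * (ζ * χx) * Q - θ * (ζ * χ) * X
      ≤ ζ' * (θ * χ * E) + 1 / 2 * (ζ * r) := by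
  have h1 : χt * E + χx * Q ≤ 0 := by
    have h2 : χx * Q ≤ |χx| * (s * E) := by
      refine (le_abs_self _).trans ?_
      rw [abs_mul]
      exact mul_le_mul_of_nonneg_left hQ (abs_nonneg _)
    nlinarith
  have h3 : θ * ζ * (χt * E + χx * Q) ≤ 0 :=
    mul_nonpos_of_nonneg_of_nonpos (mul_nonneg hθ0 hζ0) h1
  have h4 : θ * ζ * χ * (-X - k * E) ≤ θ * ζ * χ * (1 / 2 * r) :=
    mul_le_mul_of_nonneg_left (by linarith) (by positivity)
  have h5 : θ * χ ≤ 1 := mul_le_one₀ hθ1 hχ0 hχ1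
  have h6 : θ * χ * (ζ * (1 / 2 * r)) ≤ ζ * (1 / 2 * r) :=
    mul_le_of_le_one_left (by positivity) h5
  nlinarith

end PathEstimate

section PathEstimate

variable {m : ℕ}

theorem MeasureTheory.LocallyIntegrable.integrable_inner_of_hasCompactSupport
    {w β : ℝ → StateVec m} (hw : LocallyIntegrable w volume) (hβ : Continuous β)
    (hβs : HasCompactSupport β) : Integrable (fun x => inner ℝ (β x) (w x)) := by
  obtain ⟨Aβ, hAβ⟩ := hβs.exists_bound_of_continuous hβ
  have h1 : IntegrableOn (fun x => inner ℝ (β x) (w x)) (tsupport β) := by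
    have h2 := hw.integrableOn_isCompact hβs.isCompact
    refine (h2.norm.const_mul Aβ).mono'
      (hβ.aestronglyMeasurable.restrict.inner h2.aestronglyMeasurable)
      (ae_of_all _ fun x => (norm_inner_le_norm _ _).trans ?_)
    exact mul_le_mul_of_nonneg_right (hAβ x) (norm_nonneg _)
  refine (integrableOn_iff_integrable_of_support_subset fun x hx => ?_).1 h1
  by_contra hnot
  exact hx (by simp [image_eq_zero_of_notMem_tsupport hnot])

theorem integral_inner_sub_sub_norm_sq {w w' β : ℝ → StateVec m} (hβ : Continuous β)
    (hβs : HasCompactSupport β) (hw : LocallyIntegrable w volume)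
    (hw' : LocallyIntegrable w' volume) :
    ∫ x, (2 * inner ℝ (β x) (w x - w' x) - ‖β x‖ ^ 2)
      = 2 * (∫ x, inner ℝ (β x) (w x)) - 2 * (∫ x, inner ℝ (β x) (w' x)) - ∫ x, ‖β x‖ ^ 2 := by
  have i1 := hw.integrable_inner_of_hasCompactSupport hβ hβs
  have i2 := hw'.integrable_inner_of_hasCompactSupport hβ hβs
  have hβ2 : Integrable (fun x => ‖β x‖ ^ 2) := by
    have hc : Continuous fun x => ‖β x‖ ^ 2 := hβ.norm.pow 2
    refine hc.integrable_of_hasCompactSupport ?_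
    exact hβs.comp_left (g := fun z : StateVec m => ‖z‖ ^ 2) (by simp)
  rw [← integral_const_mul, ← integral_const_mul,
    ← integral_sub (i1.const_mul 2) (i2.const_mul 2),
    ← integral_sub (f := fun x => 2 * inner ℝ (β x) (w x) - 2 * inner ℝ (β x) (w' x))
      ((i1.const_mul 2).sub (i2.const_mul 2)) hβ2]
  simp only [inner_sub_right, mul_sub]

namespace EntropyBounds

variable {U C : Set (StateVec m)} {F : StateVec m → StateVec m} {η q : StateVec m → ℝ}
  {cF ηlow ηup : ℝ} (hB : EntropyBounds U C F η q cF ηlow ηup)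
include hB

theorem continuous_flux_comp {X : Type*} [TopologicalSpace X] {w : X → StateVec m}
    (hw : Continuous w) (hwC : ∀ x, w x ∈ C) : Continuous fun x => F (w x) :=
  (hB.flux.continuousOn.mono hB.subset).comp_continuous hw hwC

theorem measurable_stResidual {v : ℝ → ℝ → StateVec m}
    (hv : Continuous (fun p : ℝ × ℝ => v p.1 p.2)) (hvC : ∀ t x, v t x ∈ C) :
    Measurable (fun p : ℝ × ℝ => stResidual F v p.1 p.2) :=
  (measurable_dt hv).add (measurable_dx (v := fun s z => F (v s z))
    (hB.continuous_flux_comp hv fun p => hvC p.1 p.2))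

/-- The relative entropy inequality with the weight `θ(t) ζ(t) χ(t, x)`: `θ` absorbs the growth of
the relative entropy, `ζ` localizes the left-hand side to the times in `(a, b)`, and `χ` cuts off in
space along a backward cone whose speed dominates the relative entropy flux. The norm of `u - v` is
replaced by its lower bound `2 β · (u - v) - |β|²`, which is affine in `u`. -/
theorem integral_duality_le {T : ℝ} (hT : 0 < T) {u0 : ℝ → StateVec m}
    {u v : ℝ → ℝ → StateVec m} (hu : IsEntropySolution U F η q T u0 u)
    (huC : ∀ᵐ p ∂((volume : Measure (ℝ × ℝ)).restrict (strip T)), u p.1 p.2 ∈ C)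
    (hu0C : ∀ᵐ x, u0 x ∈ C)
    {K : NNReal} (hv : LipschitzWith K (fun p : ℝ × ℝ => v p.1 p.2)) (hvC : ∀ t x, v t x ∈ C)
    {L : ℝ → ℝ} (hLm : Measurable L) (hL0 : ∀ t, 0 ≤ L t) {Λ : ℝ} (hLΛ : ∀ t, L t ≤ Λ)
    (hLv : ∀ᵐ p ∂((volume : Measure (ℝ × ℝ)).restrict (strip T)), ‖dx v p.1 p.2‖ ≤ L p.1)
    {τ : ℝ} (hτT : τ ≤ T) (hE0 : ∫⁻ x, ‖u0 x - v 0 x‖ₑ ^ 2 ≠ ∞)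
    (hR : ∫⁻ p in strip τ, ‖stResidual F v p.1 p.2‖ₑ ^ 2 ≠ ∞)
    {β : ℝ → StateVec m} (hβ : Continuous β) (hβs : HasCompactSupport β)
    {a b : ℝ} (ha : 0 < a) (hab : a < b) (hbτ : b < τ) :
    ∫ t in Ioo a b, ∫ x, (2 * inner ℝ (β x) (u t x - v t x) - ‖β x‖ ^ 2)
      ≤ (b - a) * (Real.exp (∫ t in (0 : ℝ)..τ, ηlow⁻¹ * (ηup * cF * L t + ηup ^ 2))
        * (ηlow⁻¹ * (ηup * (∫ x, ‖u0 x - v 0 x‖ ^ 2)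
          + ∫ p in strip τ, ‖stResidual F v p.1 p.2‖ ^ 2))) := by
  have hup := hB.up_pos
  have hlow := hB.low_pos
  have hcF := hB.cF_pos
  have hτ0 : 0 < τ := ha.trans (hab.trans hbτ)
  have hbT : b < T := hbτ.trans_le hτT
  set k : ℝ → ℝ := fun t => ηlow⁻¹ * (ηup * cF * L t + ηup ^ 2) with hk
  have hkm : Measurable k := ((hLm.const_mul _).add_const _).const_mul _
  have hk0 : ∀ t, 0 ≤ k t := fun t => by have := hL0 t; positivity
  have hkc : ∀ t, k t ≤ ηlow⁻¹ * (ηup * cF * Λ + ηup ^ 2) := fun t => by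
    have := hLΛ t
    simp only [hk]
    gcongr
  obtain ⟨c, hc0, hc⟩ := hB.exists_abs_relEntropyFlux_le
  -- a speed with `|q(a | b)| ≤ s η(a | b)` on `C`
  set s : ℝ := c * (2 * ηlow⁻¹) with hs
  have hs0 : 0 ≤ s := by positivity
  obtain ⟨r, hr⟩ := hβs.isCompact.isBounded.subset_closedBall 0
  have hβz : ∀ x, x ∉ Icc (-r) r → β x = 0 := fun x hx =>
    image_eq_zero_of_notMem_tsupport fun h => hx (by
      have := hr h
      rwa [Real.closedBall_eq_Icc, zero_sub, zero_add] at this)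
  set θ := gronwallWeight k with hθ
  set ζ := timeCutoff a b with hζ
  -- the cone has radius at least `r + 1`, so that `χ = 1` on the support of `β` at all times
  set χ := coneCutoff s (r + 1) T with hχ
  have hθ0 : ∀ t, 0 < θ t := fun t => Real.exp_pos _
  have hθ1 : ∀ t, θ t ≤ 1 := gronwallWeight_le_one hk0
  have hχ0 : ∀ p, 0 ≤ χ p := fun p => clampUnit_nonneg _
  have hχ1 : ∀ p, χ p ≤ 1 := fun p => clampUnit_le_one _
  obtain ⟨Kθ, hKθ⟩ := exists_lipschitzWith_gronwallWeight hkm hk0 hkc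
  obtain ⟨Kζ, hKζ⟩ := exists_lipschitzWith_timeCutoff a b
  obtain ⟨Kχ, hKχ⟩ := exists_lipschitzWith_coneCutoff s (r + 1) T
  set ψ : ℝ × ℝ → ℝ := fun p => θ p.1 • (ζ p.1 • χ p) with hψ
  have hζχ : ∀ p : ℝ × ℝ, ‖ζ p.1 • χ p‖ ≤ (1 : NNReal) := fun p => by
    rw [smul_eq_mul, Real.norm_of_nonneg (mul_nonneg (timeCutoff_nonneg _ _ _) (hχ0 p))]
    exact mul_le_one₀ (timeCutoff_le_one _ _ _) (hχ0 p) (hχ1 p)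
  have hψl : LipschitzWith _ ψ :=
    (hKθ.comp LipschitzWith.prod_fst).smul_of_bounded (A := 1) (B := 1)
      ((hKζ.comp LipschitzWith.prod_fst).smul_of_bounded hKχ (A := 1) (B := 1)
        (fun p => by
          rw [Real.norm_of_nonneg (timeCutoff_nonneg _ _ _)]
          exact timeCutoff_le_one _ _ _)
        (fun p => by rw [Real.norm_of_nonneg (hχ0 _)]; exact hχ1 _))
      (fun p => by rw [Real.norm_of_nonneg (hθ0 _).le]; exact hθ1 _) hζχ
  have htest : IsTestFunction T ψ := by
    refine isTestFunction_of_eq_zero (r := r + 1 + s * (T + 2)) hbT hψl fun p hp => ?_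
    by_cases hp1 : p.1 ∈ Icc (-2) b
    · have hp2 : p.2 ∉ Icc (-(r + 1 + s * (T + 2))) (r + 1 + s * (T + 2)) := fun h => hp ⟨hp1, h⟩
      have : χ p = 0 := clampUnit_eq_zero (by
        rw [mem_Icc, ← abs_le, not_le] at hp2
        nlinarith [hp1.1])
      simp [hψ, this]
    · have : ζ p.1 = 0 := by
        rw [mem_Icc, not_and_or, not_le, not_le] at hp1
        rcases hp1 with hp1 | hp1
        · exact timeCutoff_eq_zero_of_le_neg hp1.le
        · exact timeCutoff_eq_zero_of_le hab hp1.le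
      simp [hψ, this]
  have hψ0 : ∀ p, 0 ≤ ψ p := fun p =>
    mul_nonneg (hθ0 _).le (mul_nonneg (timeCutoff_nonneg _ _ _) (hχ0 p))
  have hψ1 : ∀ p, ψ p ≤ 1 := fun p =>
    mul_le_one₀ (hθ1 _) (mul_nonneg (timeCutoff_nonneg _ _ _) (hχ0 p))
      ((le_abs_self _).trans (hζχ p))
  obtain ⟨hI, hmain⟩ := hB.relative_entropy_inequality hT hu huC hu0C hv hvC htest hψ0
  -- the initial term
  have hinit : ∫ x, ψ (0, x) * relEntropy η (u0 x) (v 0 x)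
      ≤ ηup / 2 * ∫ x, ‖u0 x - v 0 x‖ ^ 2 := by
    have hm0 : AEStronglyMeasurable (fun x => u0 x - v 0 x) volume :=
      hu.aestronglyMeasurable_initial.sub (hv.slice_space 0).continuous.aestronglyMeasurable
    have hi0 := (integrable_norm_sq_of_lintegral hm0 hE0).1
    rw [← integral_const_mul]
    refine integral_mono_of_nonneg ?_ (hi0.const_mul _) ?_
    · filter_upwards [hu0C] with x hx
      exact mul_nonneg (hψ0 _) (hB.relEntropy_nonneg hx (hvC _ _))
    · filter_upwards [hu0C] with x hx
      exact (mul_le_of_le_one_left (hB.relEntropy_nonneg hx (hvC _ _)) (hψ1 _)).trans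
        (hB.relEntropy_le hx (hvC _ _))
  -- the terms of the majorant
  set g : ℝ × ℝ → ℝ := fun p => 2 * inner ℝ (β p.2) (u p.1 p.2 - v p.1 p.2) - ‖β p.2‖ ^ 2 with hg
  obtain ⟨AI, hAI⟩ := hB.compact.isBounded.exists_norm_le
  obtain ⟨Aβ, hAβ⟩ := hβs.exists_bound_of_continuous hβ
  have hgint : Integrable g (volume.restrict (strip T)) := by
    have hk' : IsCompact (Icc 0 T ×ˢ Icc (-r) r : Set (ℝ × ℝ)) := isCompact_Icc.prod isCompact_Icc
    refine integrable_of_bounded_of_eq_zero (c := 2 * (Aβ * (AI + AI)) + Aβ ^ 2) ?_ hk' ?_ ?_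
    · have hβm : AEStronglyMeasurable (fun p : ℝ × ℝ => β p.2) (volume.restrict (strip T)) :=
        (hβ.comp continuous_snd).aestronglyMeasurable
      exact ((hβm.inner (hu.aestronglyMeasurable.sub hv.continuous.aestronglyMeasurable)).const_mul
        2).sub (hβm.norm.pow 2)
    · filter_upwards [ae_strip_mem T] with p hpT hp
      have : β p.2 = 0 := hβz _ fun h => hp ⟨Ioo_subset_Icc_self hpT, h⟩
      simp [hg, this]
    · filter_upwards [huC] with p hp
      have h1 : ‖u p.1 p.2 - v p.1 p.2‖ ≤ AI + AI :=
        (norm_sub_le _ _).trans (add_le_add (hAI _ hp) (hAI _ (hvC _ _)))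
      have h2 : ‖inner ℝ (β p.2) (u p.1 p.2 - v p.1 p.2)‖ ≤ Aβ * (AI + AI) :=
        (norm_inner_le_norm _ _).trans
          (mul_le_mul (hAβ _) h1 (norm_nonneg _) ((norm_nonneg _).trans (hAβ p.2)))
      refine (norm_sub_le _ _).trans ?_
      rw [norm_mul, norm_pow, norm_norm, Real.norm_two]
      have := hAβ p.2
      gcongr
  set S : Set (ℝ × ℝ) := Ioo a b ×ˢ univ with hS
  have hSm : MeasurableSet S := measurableSet_Ioo.prod MeasurableSet.univ
  have hRm := hB.measurable_stResidual hv.continuous hvC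
  have hRint := integrable_norm_sq_of_lintegral (μ := volume.restrict (strip τ))
    hRm.aestronglyMeasurable hR
  have hsub : strip τ ⊆ strip T := prod_mono (Ioo_subset_Ioo le_rfl hτT) le_rfl
  have hSsub : S ⊆ strip T := prod_mono (Ioo_subset_Ioo ha.le hbT.le) le_rfl
  have j1 : Integrable (S.indicator g) (volume.restrict (strip T)) := hgint.indicator hSm
  have j2 : Integrable ((strip τ).indicator fun p : ℝ × ℝ => ‖stResidual F v p.1 p.2‖ ^ 2)
      (volume.restrict (strip T)) := by
    rw [integrable_indicator_iff (measurableSet_strip τ), IntegrableOn,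
      Measure.restrict_restrict (measurableSet_strip τ), inter_eq_left.2 hsub]
    exact hRint.1
  have e1 : ∫ p in strip T, S.indicator g p = ∫ t in Ioo a b, ∫ x, g (t, x) := by
    have hgS := hgint.mono_measure (Measure.restrict_mono hSsub le_rfl)
    rw [integral_indicator hSm, Measure.restrict_restrict hSm, inter_eq_left.2 hSsub]
    have : (volume : Measure (ℝ × ℝ)).restrict S = (volume.restrict (Ioo a b)).prod volume := by
      rw [hS, Measure.volume_eq_prod, ← Measure.prod_restrict, Measure.restrict_univ]
    rw [this] at hgS ⊢
    exact integral_prod _ hgS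
  have e2 : ∫ p in strip T, (strip τ).indicator (fun p : ℝ × ℝ => ‖stResidual F v p.1 p.2‖ ^ 2) p
      = ∫ p in strip τ, ‖stResidual F v p.1 p.2‖ ^ 2 := by
    rw [integral_indicator (measurableSet_strip τ),
      Measure.restrict_restrict (measurableSet_strip τ), inter_eq_left.2 hsub]
  set κ : ℝ := (b - a)⁻¹ * (θ τ * (ηlow / 2)) with hκ
  have hba : 0 < b - a := by linarith
  have hκ0 : 0 < κ := by have := hθ0 τ; positivity
  have hmono := integral_mono_ae hI ((j1.const_mul (-κ)).add (j2.const_mul (1 / 2))) ?_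
  · have hadd := integral_add (j1.const_mul (-κ)) (j2.const_mul (1 / 2))
    rw [integral_const_mul, integral_const_mul, e1, e2] at hadd
    have h1 : κ * ∫ t in Ioo a b, ∫ x, g (t, x)
        ≤ 1 / 2 * (∫ p in strip τ, ‖stResidual F v p.1 p.2‖ ^ 2)
          + ηup / 2 * ∫ x, ‖u0 x - v 0 x‖ ^ 2 := by
      simp only [Pi.add_apply] at hmono
      linarith
    have hθτ : Real.exp (∫ t in (0 : ℝ)..τ, k t) * θ τ = 1 := by
      have : ∫ t in (0 : ℝ)..τ, k t = ∫ t in (0 : ℝ)..τ, (Ioi (0 : ℝ)).indicator k t := by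
        refine intervalIntegral.integral_congr_ae (ae_of_all _ fun t ht => ?_)
        rw [uIoc_of_le hτ0.le] at ht
        rw [indicator_of_mem (by exact ht.1)]
      rw [this, hθ, gronwallWeight, ← Real.exp_add]
      simp
    set e := Real.exp (∫ t in (0 : ℝ)..τ, k t) with he
    have he0 : 0 < e := Real.exp_pos _
    have h2 : ∫ t in Ioo a b, ∫ x, g (t, x)
        = ((b - a) * e * (2 * ηlow⁻¹)) * (κ * ∫ t in Ioo a b, ∫ x, g (t, x)) := by
      have : (b - a) * e * (2 * ηlow⁻¹) * κ = 1 := by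
        rw [hκ]
        have : (b - a) * e * (2 * ηlow⁻¹) * ((b - a)⁻¹ * (θ τ * (ηlow / 2)))
            = ((b - a) * (b - a)⁻¹) * (ηlow⁻¹ * ηlow) * (e * θ τ) := by ring
        rw [this, mul_inv_cancel₀ hba.ne', inv_mul_cancel₀ hlow.ne', hθτ]
        ring
      rw [← mul_assoc, this, one_mul]
    have h3 := mul_le_mul_of_nonneg_left h1
      (show 0 ≤ (b - a) * e * (2 * ηlow⁻¹) by positivity)
    rw [← h2] at h3
    refine h3.trans_eq ?_
    ring
  · have hne : ∀ᵐ t : ℝ, t ≠ a ∧ t ≠ b := by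
      have h1 : ∀ᵐ t : ℝ, t ≠ a := by simp [ae_iff]
      have h2 : ∀ᵐ t : ℝ, t ≠ b := by simp [ae_iff]
      exact h1.and h2
    have dθ := ae_hasDerivAt_gronwallWeight hkm hk0 hkc
    have dχ := hKχ.ae_differentiableAt (μ := volume)
    have dv := hv.ae_differentiableAt (μ := volume)
    filter_upwards [ae_strip_time hne, ae_strip_mem T, ae_strip_time dθ, ae_restrict_of_ae dχ,
      ae_restrict_of_ae dv, huC, hLv] with p hp hpT hpθ hpχ hpv hpu hpL
    have hpv' := hvC p.1 p.2
    have hθp := hpθ hpT.1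
    have hζp := hasDerivAt_timeCutoff hab hpT.1 hp.1 hp.2
    have hχt := DifferentiableAt.hasDerivAt_dt (v := fun t x => χ (t, x)) hpχ
    have hχx := DifferentiableAt.hasDerivAt_dx (v := fun t x => χ (t, x)) hpχ
    have hψt : dt (fun t x => ψ (t, x)) p.1 p.2 = _ := (hθp.mul (hζp.mul hχt)).deriv
    have hψx : dx (fun t x => ψ (t, x)) p.1 p.2 = _ :=
      ((hχx.const_mul (ζ p.1)).const_mul (θ p.1)).deriv
    have hEq := hB.le_relEntropy hpu hpv'
    have hE := hB.relEntropy_nonneg hpu hpv'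
    have hQ : |relEntropyFlux F η q (u p.1 p.2) (v p.1 p.2)|
        ≤ s * relEntropy η (u p.1 p.2) (v p.1 p.2) := by
      refine (hc _ hpu _ hpv').trans ?_
      rw [hs, mul_assoc]
      refine mul_le_mul_of_nonneg_left ?_ hc0.le
      rw [mul_assoc, ← div_le_iff₀' two_pos, le_inv_mul_iff₀ hlow]
      linarith
    have hX := hB.neg_production_le hpu hpv' (dt v p.1 p.2) (dx v p.1 p.2)
    rw [← hB.stResidual_eq hpv (hB.subset hpv')] at hX
    have hX' : ηlow⁻¹ * (ηup * cF * ‖dx v p.1 p.2‖ + ηup ^ 2)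
        * relEntropy η (u p.1 p.2) (v p.1 p.2)
        ≤ k p.1 * relEntropy η (u p.1 p.2) (v p.1 p.2) := by
      simp only [hk]
      gcongr
    have hw := weighted_integrand_le (hθ0 p.1).le (hθ1 p.1) (timeCutoff_nonneg a b p.1)
      (ζ' := if p.1 ∈ Ioo a b then -(b - a)⁻¹ else 0) (hχ0 p) (hχ1 p)
      (coneCutoff_deriv_le hs0 hpχ) hE hQ (hX.trans (add_le_add le_rfl hX'))
      (sq_nonneg _)
    rw [hψt, hψx]
    refine le_trans (le_of_eq ?_) (hw.trans ?_)
    · simp only [hψ, hζ, smul_eq_mul, neg_mul]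
      rfl
    simp only [Pi.add_apply]
    refine add_le_add ?_ ?_
    · by_cases hpab : p.1 ∈ Ioo a b
      · rw [if_pos hpab, indicator_of_mem (show p ∈ S from ⟨hpab, mem_univ _⟩)]
        have h1 : θ τ * (ηlow / 2) * g p ≤ θ p.1 * χ p * relEntropy η (u p.1 p.2) (v p.1 p.2) := by
          by_cases hx : p.2 ∈ Icc (-r) r
          · have hχp : χ p = 1 := clampUnit_eq_one (by
              have := abs_le.2 hx
              have := mul_nonneg hs0 (sub_nonneg.2 hpT.2.le)
              linarith)
            have h2 : g p ≤ ‖u p.1 p.2 - v p.1 p.2‖ ^ 2 := by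
              have := norm_sub_sq_real (β p.2) (u p.1 p.2 - v p.1 p.2)
              have := sq_nonneg ‖β p.2 - (u p.1 p.2 - v p.1 p.2)‖
              simp only [hg]
              linarith
            have h3 : θ τ ≤ θ p.1 :=
              antitone_gronwallWeight hkm hk0 hkc (hpab.2.le.trans hbτ.le)
            rw [hχp, mul_one, mul_assoc]
            have := hθ0 τ
            calc θ τ * (ηlow / 2 * g p)
                ≤ θ τ * relEntropy η (u p.1 p.2) (v p.1 p.2) := by
                  refine mul_le_mul_of_nonneg_left ?_ this.le
                  exact (mul_le_mul_of_nonneg_left h2 (by positivity)).trans hEq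
              _ ≤ _ := mul_le_mul_of_nonneg_right h3 hE
          · have : g p = 0 := by simp [hg, hβz _ hx]
            rw [this, mul_zero]
            exact mul_nonneg (mul_nonneg (hθ0 _).le (hχ0 _)) hE
        have h4 := mul_le_mul_of_nonneg_left h1 (inv_nonneg.2 hba.le)
        rw [hκ]
        linarith
      · rw [if_neg hpab, indicator_of_notMem (fun h : p ∈ S => hpab h.1)]
        simp
    · by_cases hpτ : p.1 < τ
      · rw [indicator_of_mem (show p ∈ strip τ from ⟨⟨hpT.1, hpτ⟩, mem_univ _⟩)]
        refine mul_le_mul_of_nonneg_left ?_ (by norm_num)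
        exact mul_le_of_le_one_left (sq_nonneg _) (timeCutoff_le_one _ _ _)
      · rw [indicator_of_notMem (fun h : p ∈ strip τ => hpτ h.1.2),
          timeCutoff_eq_zero_of_le hab (hbτ.le.trans (not_lt.1 hpτ))]
        simp

/-- The stability estimate along one path: the distance of an entropy solution `u` to a Lipschitz
function `v` is controlled by the initial distance and by the residual of `v`. -/
theorem path_estimate {T : ℝ} (hT : 0 < T) {u0 : ℝ → StateVec m}
    {u v : ℝ → ℝ → StateVec m} (hu : IsEntropySolution U F η q T u0 u)
    (hum : Measurable (fun p : ℝ × ℝ => u p.1 p.2))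
    (huC : ∀ t ∈ Icc 0 T, ∀ᵐ x, u t x ∈ C)
    {K : NNReal} (hv : LipschitzWith K (fun p : ℝ × ℝ => v p.1 p.2)) (hvC : ∀ t x, v t x ∈ C)
    {L : ℝ → ℝ} (hLm : Measurable L) (hL0 : ∀ t, 0 ≤ L t) {Λ : ℝ} (hLΛ : ∀ t, L t ≤ Λ)
    (hLv : ∀ᵐ p ∂((volume : Measure (ℝ × ℝ)).restrict (strip T)), ‖dx v p.1 p.2‖ ≤ L p.1)
    {τ : ℝ} (hτ : τ ∈ Icc 0 T) :
    ∫⁻ x, ‖u τ x - v τ x‖ₑ ^ 2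
      ≤ ENNReal.ofReal ηlow⁻¹ * (ENNReal.ofReal ηup * (∫⁻ x, ‖u 0 x - v 0 x‖ₑ ^ 2)
          + ∫⁻ p in strip τ, ‖stResidual F v p.1 p.2‖ₑ ^ 2)
        * ENNReal.ofReal
          (Real.exp (∫ t in (0 : ℝ)..τ, ηlow⁻¹ * (ηup * cF * L t + ηup ^ 2))) := by
  have hup := hB.up_pos
  have hlow := hB.low_pos
  have hcF := hB.cF_pos
  have huC' := ae_strip_of_forall_ae hum hB.compact.measurableSet huC
  have h00 := hu.initial_eq hT hB.compact (hB.flux.continuousOn.mono hB.subset) huC'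
  have hu0C : ∀ᵐ x, u0 x ∈ C := by
    filter_upwards [h00, huC 0 ⟨le_rfl, hT.le⟩] with x h1 h2
    rwa [← h1]
  rcases hτ.1.eq_or_lt with rfl | hτ0
  · -- at the initial time only `ηlow ≤ ηup` is used
    rw [intervalIntegral.integral_same, Real.exp_zero, ENNReal.ofReal_one, mul_one, mul_add,
      ← mul_assoc, ← ENNReal.ofReal_mul (by positivity)]
    refine le_trans ?_ le_self_add
    have : 1 ≤ ηlow⁻¹ * ηup := by
      rw [le_inv_mul_iff₀ hlow, mul_one]; exact hB.low_lt_up.le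
    calc ∫⁻ x, ‖u 0 x - v 0 x‖ₑ ^ 2 = ENNReal.ofReal 1 * ∫⁻ x, ‖u 0 x - v 0 x‖ₑ ^ 2 := by simp
      _ ≤ _ := by gcongr
  set e := Real.exp (∫ t in (0 : ℝ)..τ, ηlow⁻¹ * (ηup * cF * L t + ηup ^ 2)) with he
  have he0 : 0 < e := Real.exp_pos _
  have hinit : ∫⁻ x, ‖u0 x - v 0 x‖ₑ ^ 2 = ∫⁻ x, ‖u 0 x - v 0 x‖ₑ ^ 2 := by
    refine lintegral_congr_ae ?_
    filter_upwards [h00] with x hx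
    rw [hx]
  by_cases hE0 : ∫⁻ x, ‖u0 x - v 0 x‖ₑ ^ 2 = ∞
  · rw [← hinit, hE0, ENNReal.mul_top (by simpa using hup), top_add,
      ENNReal.mul_top (by simpa using hlow), ENNReal.top_mul (by simpa using he0)]
    exact le_top
  by_cases hR : ∫⁻ p in strip τ, ‖stResidual F v p.1 p.2‖ₑ ^ 2 = ∞
  · rw [hR, add_top, ENNReal.mul_top (by simpa using hlow), ENNReal.top_mul (by simpa using he0)]
    exact le_top
  set B : ℝ := e * (ηlow⁻¹ * (ηup * (∫ x, ‖u0 x - v 0 x‖ ^ 2)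
    + ∫ p in strip τ, ‖stResidual F v p.1 p.2‖ ^ 2)) with hBdef
  obtain ⟨AI, hAI⟩ := hB.compact.isBounded.exists_norm_le
  have hmeas : ∀ t, Measurable (u t) := fun t => hum.comp measurable_prodMk_left
  have hvloc : ∀ t ∈ Icc 0 T, LocallyIntegrable (v t) volume := fun t _ =>
    (hv.slice_space t).continuous.locallyIntegrable
  have hle : ∫⁻ x, ‖u τ x - v τ x‖ₑ ^ 2 ≤ ENNReal.ofReal B := by
    refine lintegral_sq_le_of_forall_integral_le (w := fun x => u τ x - v τ x) (A := AI + AI)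
      ((hmeas τ).aestronglyMeasurable.sub (hv.slice_space τ).continuous.aestronglyMeasurable)
      ?_ fun β hβ hβs => ?_
    · filter_upwards [huC τ hτ] with x hx
      exact (norm_sub_le _ _).trans (add_le_add (hAI _ hx) (hAI _ (hvC _ _)))
    have hval : ∀ t ∈ Icc 0 T, ∫ x, (2 * inner ℝ (β x) (u t x - v t x) - ‖β x‖ ^ 2)
        = 2 * (∫ x, inner ℝ (β x) (u t x)) - 2 * (∫ x, inner ℝ (β x) (v t x))
          - ∫ x, ‖β x‖ ^ 2 := fun t ht =>
      integral_inner_sub_sub_norm_sq hβ hβs (hu.locallyIntegrable_slice t ht) (hvloc t ht)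
    have hcont : ContinuousOn
        (fun t => ∫ x, (2 * inner ℝ (β x) (u t x - v t x) - ‖β x‖ ^ 2)) (Icc 0 T) := by
      have c1 := continuousOn_integral_inner hu.locallyIntegrable_slice hu.weakly_continuous hβ hβs
      have c2 := continuousOn_integral_inner hvloc
        (fun φ hφ hφs => continuousOn_integral_smul_of_lipschitz (T := T) hv hφ hφs) hβ hβs
      exact (((continuousOn_const.mul c1).sub (continuousOn_const.mul c2)).sub
        continuousOn_const).congr hval
    have hfin := hcont.le_of_integral_le hτ0 hτ.2 fun a b ha hab hb =>
      hB.integral_duality_le hT hu huC' hu0C hv hvC hLm hL0 hLΛ hLv hτ.2 hE0 hR hβ hβs ha hab hb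
    rw [hval τ hτ] at hfin
    have i1 := (hu.locallyIntegrable_slice τ hτ).integrable_inner_of_hasCompactSupport hβ hβs
    have i2 := (hvloc τ hτ).integrable_inner_of_hasCompactSupport hβ hβs
    have hsplit : ∫ x, inner ℝ (β x) (u τ x - v τ x)
        = (∫ x, inner ℝ (β x) (u τ x)) - ∫ x, inner ℝ (β x) (v τ x) := by
      rw [← integral_sub i1 i2]
      simp only [inner_sub_right]
    rw [hsplit]
    linarith
  refine hle.trans (le_of_eq ?_)
  have hm0 : AEStronglyMeasurable (fun x => u0 x - v 0 x) volume :=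
    hu.aestronglyMeasurable_initial.sub (hv.slice_space 0).continuous.aestronglyMeasurable
  have hRm := hB.measurable_stResidual hv.continuous hvC
  rw [hBdef, (integrable_norm_sq_of_lintegral hm0 hE0).2,
    (integrable_norm_sq_of_lintegral (μ := volume.restrict (strip τ))
      hRm.aestronglyMeasurable hR).2, mul_comm e,
    ENNReal.ofReal_mul (by positivity), ENNReal.ofReal_mul (by positivity),
    ENNReal.ofReal_add (by positivity) (by positivity), ENNReal.ofReal_mul (by positivity),
    ENNReal.ofReal_toReal hE0, ENNReal.ofReal_toReal hR, hinit]

end EntropyBounds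

end PathEstimate

/-! ### Parseval's identity and parametric essential suprema -/

section Tools

theorem measurable_essSup_prod {α β : Type*} [MeasurableSpace α] [MeasurableSpace β]
    {ν : Measure β} [SFinite ν] {f : α × β → ℝ≥0∞} (hf : Measurable f) :
    Measurable fun a => essSup (fun b => f (a, b)) ν := by
  refine measurable_of_Iic fun c => ?_
  have h1 : (fun a => essSup (fun b => f (a, b)) ν) ⁻¹' Iic c
      = (fun a => ν (Prod.mk a ⁻¹' {p | c < f p})) ⁻¹' {0} := by
    ext a
    simp only [mem_preimage, mem_Iic, mem_singleton_iff]
    constructor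
    · intro h
      have h2 : ∀ᵐ b ∂ν, f (a, b) ≤ c :=
        (ENNReal.ae_le_essSup fun b => f (a, b)).mono fun b hb => hb.trans h
      rw [ae_iff] at h2
      simpa using h2
    · intro h
      refine essSup_le_of_ae_le c ?_
      change ∀ᵐ b ∂ν, f (a, b) ≤ c
      rw [ae_iff]
      simpa using h
  rw [h1]
  exact measurable_measure_prodMk_left (measurableSet_lt measurable_const hf)
    (measurableSet_singleton 0)

theorem eLpNorm_two_sq {α V : Type*} [MeasurableSpace α] [NormedAddCommGroup V] (ν : Measure α)
    (f : α → V) : eLpNorm f 2 ν ^ 2 = ∫⁻ x, ‖f x‖ₑ ^ 2 ∂ν := by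
  have := eLpNorm_nnreal_pow_eq_lintegral (f := f) (μ := ν) (p := 2) two_ne_zero
  simpa using this

theorem enorm_add_sq_le {V : Type*} [NormedAddCommGroup V] (a b : V) :
    ‖a + b‖ₑ ^ 2 ≤ 2 * ‖a‖ₑ ^ 2 + 2 * ‖b‖ₑ ^ 2 := by
  have h1 : ‖a + b‖₊ ^ 2 ≤ 2 * ‖a‖₊ ^ 2 + 2 * ‖b‖₊ ^ 2 :=
    (pow_le_pow_left' (nnnorm_add_le a b) 2).trans (add_sq_le.trans (mul_add _ _ _).le)
  simp only [enorm_eq_nnnorm]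
  exact_mod_cast h1

theorem ofReal_exp_le_EReal_exp {z : ℝ} {X : ℝ≥0∞} (h : ENNReal.ofReal z ≤ X) :
    ENNReal.ofReal (Real.exp z) ≤ EReal.exp (X : EReal) := by
  rw [← EReal.exp_coe]
  refine EReal.exp_monotone ?_
  calc (z : EReal) ≤ ((ENNReal.ofReal z : ℝ≥0∞) : EReal) := by
        rw [EReal.coe_ennreal_ofReal]; exact EReal.coe_le_coe_iff.2 (le_max_left _ _)
    _ ≤ X := EReal.coe_ennreal_le_coe_ennreal_iff.2 h

variable {Ξ : Type*} [MeasurableSpace Ξ] {μ : Measure Ξ} {m : ℕ}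

theorem lintegral_sq_eq_tsum_real (b : HilbertBasis ℕ ℝ (Lp ℝ 2 μ)) {f : Ξ → ℝ}
    (hf : MemLp f 2 μ) :
    ∫⁻ y, ‖f y‖ₑ ^ 2 ∂μ = ∑' j, ‖∫ y, b j y * f y ∂μ‖ₑ ^ 2 := by
  set g := hf.toLp f with hg
  have hinner : ∀ j, inner ℝ (b j) g = ∫ y, b j y * f y ∂μ := by
    intro j
    rw [L2.inner_def]
    refine integral_congr_ae ?_
    filter_upwards [hf.coeFn_toLp] with y hy
    rw [hg, hy]
    simp [mul_comm]
  have h1 := b.hasSum_inner_mul_inner g g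
  have h2 : ∀ j, inner ℝ g (b j) * inner ℝ (b j) g = ‖∫ y, b j y * f y ∂μ‖ ^ 2 := fun j => by
    rw [real_inner_comm, hinner, Real.norm_eq_abs, sq_abs, sq]
  simp only [h2, real_inner_self_eq_norm_sq] at h1
  have h3 : ∑' j, ‖∫ y, b j y * f y ∂μ‖ₑ ^ 2 = ENNReal.ofReal (‖g‖ ^ 2) := by
    rw [← h1.tsum_eq, ENNReal.ofReal_tsum_of_nonneg (fun j => by positivity) h1.summable]
    congr 1
    ext j
    rw [ENNReal.ofReal_pow (norm_nonneg _), ofReal_norm]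
  rw [h3, ENNReal.ofReal_pow (norm_nonneg _), ofReal_norm, hg, Lp.enorm_toLp, eLpNorm_two_sq]

theorem enorm_sq_eq_sum (z : StateVec m) : ‖z‖ₑ ^ 2 = ∑ i, ‖z i‖ₑ ^ 2 := by
  have h1 : ∀ r : ℝ, ‖r‖ₑ ^ 2 = ENNReal.ofReal (‖r‖ ^ 2) := fun r => by
    rw [ENNReal.ofReal_pow (norm_nonneg _), ofReal_norm]
  rw [← ofReal_norm, ← ENNReal.ofReal_pow (norm_nonneg _), EuclideanSpace.norm_sq_eq,
    ENNReal.ofReal_sum_of_nonneg fun i _ => by positivity]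
  simp only [h1]

theorem memLp_coord {f : Ξ → StateVec m} (hf : MemLp f 2 μ) (i : Fin m) :
    MemLp (fun y => f y i) 2 μ :=
  (EuclideanSpace.proj (𝕜 := ℝ) i).comp_memLp' hf

theorem integrable_smul_of_memLp {f : Ξ → StateVec m} {g : Ξ → ℝ} (hg : MemLp g 2 μ)
    (hf : MemLp f 2 μ) : Integrable (fun y => g y • f y) μ :=
  memLp_one_iff_integrable.1 (hf.smul hg)

/-- Parseval's identity for functions with values in `ℝᵐ`. -/
theorem lintegral_sq_eq_tsum (b : HilbertBasis ℕ ℝ (Lp ℝ 2 μ)) {f : Ξ → StateVec m}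
    (hf : MemLp f 2 μ) :
    ∫⁻ y, ‖f y‖ₑ ^ 2 ∂μ = ∑' j, ‖∫ y, b j y • f y ∂μ‖ₑ ^ 2 := by
  have h1 : ∀ j i, (∫ y, b j y • f y ∂μ) i = ∫ y, b j y * f y i ∂μ := fun j i => by
    have := ContinuousLinearMap.integral_comp_comm (EuclideanSpace.proj (𝕜 := ℝ) i)
      (integrable_smul_of_memLp (Lp.memLp (b j)) hf)
    simpa using this.symm
  simp only [enorm_sq_eq_sum, h1]
  rw [lintegral_finsetSum' _ fun i _ =>
    (memLp_coord hf i).aestronglyMeasurable.enorm.pow_const 2,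
    Summable.tsum_finsetSum fun _ _ => ENNReal.summable]
  exact Finset.sum_congr rfl fun i _ => lintegral_sq_eq_tsum_real b (memLp_coord hf i)

theorem integral_mul_hilbertBasis (b : HilbertBasis ℕ ℝ (Lp ℝ 2 μ)) (j i : ℕ) :
    ∫ y, b j y * b i y ∂μ = if j = i then 1 else 0 := by
  rw [← orthonormal_iff_ite.1 b.orthonormal j i, L2.inner_def]
  simp [mul_comm]

end Tools

/-! ### Finite modal expansions -/

section Modal

variable {m : ℕ} {Ξ : Type*}

/-- The modal expansion `∑ i ≤ M, f i y • c i t x` with coefficients `c i = c i (t, x)`. -/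
noncomputable def modalSum (M : ℕ) (c : ℕ → ℝ → ℝ → StateVec m) (f : ℕ → Ξ → ℝ)
    (t x : ℝ) (y : Ξ) : StateVec m :=
  ∑ i ∈ Finset.range (M + 1), f i y • c i t x

/-- The modes of the space-time-stochastic reconstruction. -/
noncomputable def reconstructionMode {R : ℕ} (Ψ : ℕ → Ξ → ℝ) (yq : Fin (R + 1) → Ξ)
    (wq : Fin (R + 1) → ℝ) (ust : Fin (R + 1) → ℝ → ℝ → StateVec m) (i : ℕ) (t x : ℝ) :
    StateVec m :=
  nispMode Ψ yq wq i fun l => ust l t x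

/-- A measurable representative of `∂ₓ F(v)`, `v` a modal expansion with values in `C`. The
derivative of the flux is cut off outside of `C`, where it need not be measurable. -/
noncomputable def modalFluxDeriv (C : Set (StateVec m)) (F : StateVec m → StateVec m) (M : ℕ)
    (c : ℕ → ℝ → ℝ → StateVec m) (f : ℕ → Ξ → ℝ) (t x : ℝ) (y : Ξ) : StateVec m :=
  C.indicator (fderiv ℝ F) (modalSum M c f t x y) (modalSum M (fun i => dx (c i)) f t x y)

variable {M : ℕ} {c : ℕ → ℝ → ℝ → StateVec m} {f : ℕ → Ξ → ℝ}

theorem exists_lipschitzWith_finsetSum_smul {α ι : Type*} [PseudoMetricSpace α] (s : Finset ι)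
    {g : ι → α → StateVec m} (a : ι → ℝ) (hg : ∀ i ∈ s, ∃ K, LipschitzWith K (g i)) :
    ∃ K, LipschitzWith K fun p => ∑ i ∈ s, a i • g i p := by
  classical
  induction s using Finset.induction_on with
  | empty => exact ⟨0, by simp⟩
  | insert i s hi ih =>
    obtain ⟨K1, h1⟩ := hg i (Finset.mem_insert_self _ _)
    obtain ⟨K2, h2⟩ := ih fun j hj => hg j (Finset.mem_insert_of_mem hj)
    refine ⟨‖a i‖₊ * K1 + K2, ?_⟩
    simp only [Finset.sum_insert hi]
    have h3 : LipschitzWith ‖a i‖₊ fun z : StateVec m => a i • z :=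
      LipschitzWith.of_dist_le_mul fun z w => by simp [dist_smul₀]
    exact (h3.comp h1).add h2

theorem exists_lipschitzWith_modalSum (hc : ∀ i, ∃ K, LipschitzWith K fun p : ℝ × ℝ => c i p.1 p.2)
    (y : Ξ) : ∃ K, LipschitzWith K fun p : ℝ × ℝ => modalSum M c f p.1 p.2 y :=
  exists_lipschitzWith_finsetSum_smul _ _ fun i _ => hc i

theorem exists_lipschitzWith_reconstructionMode {R : ℕ} {Ψ : ℕ → Ξ → ℝ} {yq : Fin (R + 1) → Ξ}
    {wq : Fin (R + 1) → ℝ} {ust : Fin (R + 1) → ℝ → ℝ → StateVec m}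
    (hl : ∀ l, ∃ K, LipschitzWith K fun p : ℝ × ℝ => ust l p.1 p.2) (i : ℕ) :
    ∃ K, LipschitzWith K fun p : ℝ × ℝ => reconstructionMode Ψ yq wq ust i p.1 p.2 :=
  exists_lipschitzWith_finsetSum_smul _ _ fun l _ => hl l

theorem nispMode_add {R : ℕ} (Ψ : ℕ → Ξ → ℝ) (yq : Fin (R + 1) → Ξ)
    (wq : Fin (R + 1) → ℝ) (i : ℕ) (v w : Fin (R + 1) → StateVec m) :
    nispMode Ψ yq wq i (fun l => v l + w l) = nispMode Ψ yq wq i v + nispMode Ψ yq wq i w := by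
  simp [nispMode, Finset.sum_add_distrib]

theorem dt_reconstructionMode {R : ℕ} {Ψ : ℕ → Ξ → ℝ} {yq : Fin (R + 1) → Ξ}
    {wq : Fin (R + 1) → ℝ} {ust : Fin (R + 1) → ℝ → ℝ → StateVec m} {p : ℝ × ℝ}
    (hp : ∀ l, DifferentiableAt ℝ (fun p : ℝ × ℝ => ust l p.1 p.2) p) (i : ℕ) :
    dt (reconstructionMode Ψ yq wq ust i) p.1 p.2
      = nispMode Ψ yq wq i fun l => dt (ust l) p.1 p.2 :=
  (HasDerivAt.fun_sum (u := Finset.univ) fun l _ =>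
    (DifferentiableAt.hasDerivAt_dt (hp l)).const_smul (Ψ i (yq l) * wq l)).deriv

theorem dt_modalSum {p : ℝ × ℝ}
    (hp : ∀ i, DifferentiableAt ℝ (fun p : ℝ × ℝ => c i p.1 p.2) p) (y : Ξ) :
    dt (fun t x => modalSum M c f t x y) p.1 p.2
      = modalSum M (fun i => dt (c i)) f p.1 p.2 y :=
  (HasDerivAt.fun_sum fun i _ => (DifferentiableAt.hasDerivAt_dt (hp i)).const_smul (f i y)).deriv

theorem dx_modalSum {p : ℝ × ℝ}
    (hp : ∀ i, DifferentiableAt ℝ (fun p : ℝ × ℝ => c i p.1 p.2) p) (y : Ξ) :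
    dx (fun t x => modalSum M c f t x y) p.1 p.2
      = modalSum M (fun i => dx (c i)) f p.1 p.2 y :=
  (HasDerivAt.fun_sum fun i _ => (DifferentiableAt.hasDerivAt_dx (hp i)).const_smul (f i y)).deriv

theorem differentiableAt_modalSum {p : ℝ × ℝ}
    (hp : ∀ i, DifferentiableAt ℝ (fun p : ℝ × ℝ => c i p.1 p.2) p) (y : Ξ) :
    DifferentiableAt ℝ (fun p : ℝ × ℝ => modalSum M c f p.1 p.2 y) p :=
  DifferentiableAt.fun_sum fun i _ => (hp i).const_smul (f i y)

theorem dx_flux_modalSum {U C : Set (StateVec m)} {F : StateVec m → StateVec m}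
    {η q : StateVec m → ℝ} {cF ηlow ηup : ℝ} (hB : EntropyBounds U C F η q cF ηlow ηup)
    {p : ℝ × ℝ} (hp : ∀ i, DifferentiableAt ℝ (fun p : ℝ × ℝ => c i p.1 p.2) p) {y : Ξ}
    (hy : modalSum M c f p.1 p.2 y ∈ C) :
    dx (fun t x => F (modalSum M c f t x y)) p.1 p.2 = modalFluxDeriv C F M c f p.1 p.2 y := by
  have h1 := DifferentiableAt.hasDerivAt_dx (v := fun t x => modalSum M c f t x y)
    (differentiableAt_modalSum hp y)
  have h2 := ((hB.flux.hasFDerivAt_fderiv_of_two hB.isOpen (hB.subset hy)).comp_hasDerivAt p.2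
    h1).deriv
  rw [dx_modalSum hp] at h2
  rw [modalFluxDeriv, indicator_of_mem hy]
  exact h2

theorem stResidual_modalSum {U C : Set (StateVec m)} {F : StateVec m → StateVec m}
    {η q : StateVec m → ℝ} {cF ηlow ηup : ℝ} (hB : EntropyBounds U C F η q cF ηlow ηup)
    {p : ℝ × ℝ} (hp : ∀ i, DifferentiableAt ℝ (fun p : ℝ × ℝ => c i p.1 p.2) p) {y : Ξ}
    (hy : modalSum M c f p.1 p.2 y ∈ C) :
    stResidual F (fun t x => modalSum M c f t x y) p.1 p.2
      = modalSum M (fun i => dt (c i)) f p.1 p.2 y + modalFluxDeriv C F M c f p.1 p.2 y := by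
  rw [stResidual, dt_modalSum hp, dx_flux_modalSum hB hp hy]

variable [MeasurableSpace Ξ]

theorem measurable_modalSum (hc : ∀ i, Measurable fun p : ℝ × ℝ => c i p.1 p.2)
    (hf : ∀ i, Measurable (f i)) :
    Measurable fun z : (ℝ × ℝ) × Ξ => modalSum M c f z.1.1 z.1.2 z.2 :=
  Finset.measurable_sum _ fun i _ =>
    ((hf i).comp measurable_snd).smul ((hc i).comp measurable_fst)

theorem measurable_modalFluxDeriv {C : Set (StateVec m)} (hC : MeasurableSet C)
    {F : StateVec m → StateVec m} (hF : ContinuousOn (fderiv ℝ F) C)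
    (hc : ∀ i, ∃ K, LipschitzWith K fun p : ℝ × ℝ => c i p.1 p.2) (hf : ∀ i, Measurable (f i)) :
    Measurable fun z : (ℝ × ℝ) × Ξ => modalFluxDeriv C F M c f z.1.1 z.1.2 z.2 := by
  have hcc : ∀ i, Continuous fun p : ℝ × ℝ => c i p.1 p.2 := fun i => (hc i).choose_spec.continuous
  have h1 : Measurable fun z : (ℝ × ℝ) × Ξ =>
      C.indicator (fderiv ℝ F) (modalSum M c f z.1.1 z.1.2 z.2) :=
    (measurable_indicator_of_continuousOn hC hF).comp
      (measurable_modalSum (fun i => (hcc i).measurable) hf)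
  have h2 : Measurable fun z : (ℝ × ℝ) × Ξ =>
      modalSum M (fun i => dx (c i)) f z.1.1 z.1.2 z.2 :=
    measurable_modalSum (fun i => measurable_dx (hcc i)) hf
  have h3 : Continuous fun w : (StateVec m →L[ℝ] StateVec m) × StateVec m => w.1 w.2 :=
    isBoundedBilinearMap_apply.continuous
  exact h3.measurable.comp (h1.prodMk h2)

theorem memLp_modalSum {μ : Measure Ξ} (hf : ∀ i, MemLp (f i) 2 μ) (t x : ℝ) :
    MemLp (fun y => modalSum M c f t x y) 2 μ :=
  memLp_finsetSum _ fun i _ =>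
    (ContinuousLinearMap.toSpanSingleton ℝ (c i t x)).comp_memLp' (hf i)

theorem memLp_modalFluxDeriv {μ : Measure Ξ} {U C : Set (StateVec m)}
    {F : StateVec m → StateVec m}
    {η q : StateVec m → ℝ} {cF ηlow ηup : ℝ} (hB : EntropyBounds U C F η q cF ηlow ηup)
    (hc : ∀ i, ∃ K, LipschitzWith K fun p : ℝ × ℝ => c i p.1 p.2) (hfm : ∀ i, Measurable (f i))
    (hf : ∀ i, MemLp (f i) 2 μ) (t x : ℝ) :
    MemLp (fun y => modalFluxDeriv C F M c f t x y) 2 μ := by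
  have hDF : ContinuousOn (fderiv ℝ F) C :=
    ((hB.flux.fderiv_of_two hB.isOpen).continuousOn).mono hB.subset
  obtain ⟨A, hA⟩ := hB.compact.exists_bound_of_continuousOn hDF
  have hm := measurable_modalFluxDeriv (M := M) hB.compact.measurableSet hDF hc hfm
  refine (memLp_modalSum (M := M) (c := fun i => dx (c i)) hf t x).of_le_mul (c := |A|)
    (hm.comp (measurable_prodMk_left (x := (t, x)))).aestronglyMeasurable
    (ae_of_all _ fun y => ?_)
  refine (ContinuousLinearMap.le_opNorm _ _).trans
    (mul_le_mul_of_nonneg_right ?_ (norm_nonneg _))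
  by_cases hy : modalSum M c f t x y ∈ C
  · rw [indicator_of_mem hy]; exact (hA _ hy).trans (le_abs_self _)
  · rw [indicator_of_notMem hy, norm_zero]; exact abs_nonneg _

theorem integral_smul_modalSum {μ : Measure Ξ} (b : HilbertBasis ℕ ℝ (Lp ℝ 2 μ)) (j : ℕ)
    (t x : ℝ) :
    ∫ y, b j y • modalSum M c (fun i => b i) t x y ∂μ = if j ≤ M then c j t x else 0 := by
  have hint : ∀ i, Integrable (fun y => b j y * b i y) μ := fun i =>
    memLp_one_iff_integrable.1 ((Lp.memLp (b i)).mul (Lp.memLp (b j)))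
  have h1 : ∀ y, b j y • modalSum M c (fun i => b i) t x y
      = ∑ i ∈ Finset.range (M + 1), (b j y * b i y) • c i t x := fun y => by
    simp only [modalSum, Finset.smul_sum, mul_smul]
  simp only [h1]
  rw [integral_finsetSum _ fun i _ => (hint i).smul_const _]
  simp only [integral_smul_const, integral_mul_hilbertBasis, ite_smul, one_smul, zero_smul]
  rw [Finset.sum_ite_eq]
  simp

end Modal

/-! ### The residual and its modes -/

section Residual

variable {m M R : ℕ} {Ξ : Type*} [MeasurableSpace Ξ] {μ : Measure Ξ} {U C : Set (StateVec m)}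
  {F : StateVec m → StateVec m} {η q : StateVec m → ℝ} {cF ηlow ηup : ℝ}
  {Ψ : ℕ → Ξ → ℝ} {yq : Fin (R + 1) → Ξ} {wq : Fin (R + 1) → ℝ}
  {ust : Fin (R + 1) → ℝ → ℝ → StateVec m}

omit [MeasurableSpace Ξ] in
theorem stsReconstruction_eq_modalSum {b : ℕ → Ξ → ℝ} {y : Ξ} (hy : ∀ i, b i y = Ψ i y)
    (t x : ℝ) : stsReconstruction Ψ yq wq M ust t x y
      = modalSum M (reconstructionMode Ψ yq wq ust) b t x y := by
  simp only [stsReconstruction, nisp, modalSum, hy]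
  rfl

omit [MeasurableSpace Ξ] in
theorem ae_differentiableAt_modes (hl : ∀ l, ∃ K, LipschitzWith K fun p : ℝ × ℝ => ust l p.1 p.2) :
    ∀ᵐ p : ℝ × ℝ, (∀ l, DifferentiableAt ℝ (fun p : ℝ × ℝ => ust l p.1 p.2) p) ∧
      ∀ i, DifferentiableAt ℝ (fun p : ℝ × ℝ => reconstructionMode Ψ yq wq ust i p.1 p.2) p :=
  (ae_all_iff.2 fun l => (hl l).choose_spec.ae_differentiableAt).and
    (ae_all_iff.2 fun i =>
      (exists_lipschitzWith_reconstructionMode (Ψ := Ψ) (yq := yq) (wq := wq) hl i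
        ).choose_spec.ae_differentiableAt)

theorem ae_modalSum_mem {b : ℕ → Ξ → ℝ} (hb : ∀ i, b i =ᵐ[μ] Ψ i)
    (hC : ∀ᵐ y ∂μ, ∀ t x, stsReconstruction Ψ yq wq M ust t x y ∈ C) :
    ∀ᵐ y ∂μ, (∀ i, b i y = Ψ i y) ∧
      ∀ t x, modalSum M (reconstructionMode Ψ yq wq ust) b t x y ∈ C := by
  filter_upwards [ae_all_iff.2 hb, hC] with y hy hCy
  exact ⟨hy, fun t x => by rw [← stsReconstruction_eq_modalSum hy]; exact hCy t x⟩

/-- The modes of `∂ₓ F(ûˢᵗˢ)` computed from representatives `b i` of the basis functions and from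
the measurable representative of the integrand. -/
theorem integral_dx_flux_eq (hB : EntropyBounds U C F η q cF ηlow ηup) {b : ℕ → Ξ → ℝ}
    (hb : ∀ i, b i =ᵐ[μ] Ψ i)
    (hC : ∀ᵐ y ∂μ, ∀ t x, stsReconstruction Ψ yq wq M ust t x y ∈ C) {p : ℝ × ℝ}
    (hp : ∀ i, DifferentiableAt ℝ
      (fun p : ℝ × ℝ => reconstructionMode Ψ yq wq ust i p.1 p.2) p) (j : ℕ) :
    ∫ y, Ψ j y • dx (fun s z => F (stsReconstruction Ψ yq wq M ust s z y)) p.1 p.2 ∂μ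
      = ∫ y, b j y • modalFluxDeriv C F M (reconstructionMode Ψ yq wq ust) b p.1 p.2 y ∂μ := by
  refine integral_congr_ae ?_
  filter_upwards [ae_modalSum_mem (M := M) hb hC] with y ⟨hy, hCy⟩
  simp only [stsReconstruction_eq_modalSum hy, hy j]
  rw [dx_flux_modalSum hB hp (hCy _ _)]

omit [MeasurableSpace Ξ] in
theorem measurable_nispMode {α : Type*} [MeasurableSpace α] (i : ℕ)
    {v : Fin (R + 1) → α → StateVec m} (hv : ∀ l, Measurable (v l)) :
    Measurable fun a => nispMode Ψ yq wq i fun l => v l a :=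
  Finset.measurable_sum _ fun l _ => (hv l).const_smul (Ψ i (yq l) * wq l)

/-- At almost every `(t, x)`, Parseval's identity decomposes the residual in its modes: the modes up
to `M` are the sums of the deterministic and of the quadrature residual, the other modes are those
of the cut-off residual. -/
theorem lintegral_residual_sq_le (hB : EntropyBounds U C F η q cF ηlow ηup)
    (b : HilbertBasis ℕ ℝ (Lp ℝ 2 μ)) (hb : ∀ i, (b i : Ξ → ℝ) =ᵐ[μ] Ψ i)
    (hl : ∀ l, ∃ K, LipschitzWith K fun p : ℝ × ℝ => ust l p.1 p.2)
    (hC : ∀ᵐ y ∂μ, ∀ t x, stsReconstruction Ψ yq wq M ust t x y ∈ C) {p : ℝ × ℝ}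
    (hpu : ∀ l, DifferentiableAt ℝ (fun p : ℝ × ℝ => ust l p.1 p.2) p)
    (hp : ∀ i, DifferentiableAt ℝ
      (fun p : ℝ × ℝ => reconstructionMode Ψ yq wq ust i p.1 p.2) p) :
    ∫⁻ y, ‖modalSum M (fun i => dt (reconstructionMode Ψ yq wq ust i)) (fun i => b i) p.1 p.2 y
        + modalFluxDeriv C F M (reconstructionMode Ψ yq wq ust) (fun i => b i) p.1 p.2 y‖ₑ ^ 2 ∂μ
      ≤ (∑ j ∈ Finset.range (M + 1), (2 * ‖detMode F Ψ yq wq ust j p.1 p.2‖ₑ ^ 2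
          + 2 * ‖sqMode μ F Ψ yq wq M ust j p.1 p.2‖ₑ ^ 2))
        + ∑' k, ‖scMode μ F Ψ yq wq M ust (M + 1 + k) p.1 p.2‖ₑ ^ 2 := by
  have hLp : ∀ i, MemLp (b i : Ξ → ℝ) 2 μ := fun i => Lp.memLp (b i)
  have hbm : ∀ i, Measurable (b i : Ξ → ℝ) := fun i => (Lp.stronglyMeasurable (b i)).measurable
  have hcl := exists_lipschitzWith_reconstructionMode (Ψ := Ψ) (yq := yq) (wq := wq) hl
  have m1 := memLp_modalSum (M := M) (c := fun i => dt (reconstructionMode Ψ yq wq ust i))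
    hLp p.1 p.2
  have m2 := memLp_modalFluxDeriv (M := M) hB hcl hbm hLp p.1 p.2
  have hmode : ∀ j, ∫ y, b j y •
      (modalSum M (fun i => dt (reconstructionMode Ψ yq wq ust i)) (fun i => b i) p.1 p.2 y
        + modalFluxDeriv C F M (reconstructionMode Ψ yq wq ust) (fun i => b i) p.1 p.2 y) ∂μ
      = (if j ≤ M then dt (reconstructionMode Ψ yq wq ust j) p.1 p.2 else 0)
        + scMode μ F Ψ yq wq M ust j p.1 p.2 := by
    intro j
    have e := integral_smul_modalSum (M := M)
      (c := fun i => dt (reconstructionMode Ψ yq wq ust i)) b j p.1 p.2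
    rw [scMode, integral_dx_flux_eq hB hb hC hp, ← e,
      ← integral_add (integrable_smul_of_memLp (hLp j) m1) (integrable_smul_of_memLp (hLp j) m2)]
    simp only [smul_add]
  rw [lintegral_sq_eq_tsum b (f := fun y => _ + _) (m1.add m2)]
  simp only [hmode]
  rw [← Summable.sum_add_tsum_nat_add' (k := M + 1) ENNReal.summable]
  refine add_le_add (Finset.sum_le_sum fun j hj => ?_) (le_of_eq (tsum_congr fun k => ?_))
  · rw [Finset.mem_range, Nat.lt_succ_iff] at hj
    rw [if_pos hj, dt_reconstructionMode hpu]
    have : (nispMode Ψ yq wq j fun l => dt (ust l) p.1 p.2) + scMode μ F Ψ yq wq M ust j p.1 p.2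
        = detMode F Ψ yq wq ust j p.1 p.2 + sqMode μ F Ψ yq wq M ust j p.1 p.2 := by
      simp only [detMode, stResidual, sqMode, scMode]
      rw [nispMode_add]
      abel
    rw [this]
    exact enorm_add_sq_le _ _
  · rw [if_neg (by omega), zero_add, add_comm k]

/-- The space-time-stochastic residual is bounded by its deterministic, quadrature and cut-off
parts. -/
theorem lintegral_stResidual_le [IsFiniteMeasure μ] (hB : EntropyBounds U C F η q cF ηlow ηup)
    (b : HilbertBasis ℕ ℝ (Lp ℝ 2 μ)) (hb : ∀ i, (b i : Ξ → ℝ) =ᵐ[μ] Ψ i)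
    (hl : ∀ l, ∃ K, LipschitzWith K fun p : ℝ × ℝ => ust l p.1 p.2)
    (hustU : ∀ l t x, ust l t x ∈ U)
    (hC : ∀ᵐ y ∂μ, ∀ t x, stsReconstruction Ψ yq wq M ust t x y ∈ C) (τ : ℝ) :
    AEMeasurable (fun y => ∫⁻ p in strip τ,
        ‖stResidual F (fun t x => stsReconstruction Ψ yq wq M ust t x y) p.1 p.2‖ₑ ^ 2) μ ∧
    ∫⁻ y, (∫⁻ p in strip τ,
        ‖stResidual F (fun t x => stsReconstruction Ψ yq wq M ust t x y) p.1 p.2‖ₑ ^ 2) ∂μ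
      ≤ 2 * detResidual F Ψ yq wq M ust τ + 2 * sqResidual μ F Ψ yq wq M ust τ
        + scResidual μ F Ψ yq wq M ust τ := by
  have hbm : ∀ i, Measurable (b i : Ξ → ℝ) := fun i => (Lp.stronglyMeasurable (b i)).measurable
  have hcl := exists_lipschitzWith_reconstructionMode (Ψ := Ψ) (yq := yq) (wq := wq) hl
  have hDF : ContinuousOn (fderiv ℝ F) C :=
    ((hB.flux.fderiv_of_two hB.isOpen).continuousOn).mono hB.subset
  have hfluxm := measurable_modalFluxDeriv (M := M) hB.compact.measurableSet hDF hcl hbm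
  set r : (ℝ × ℝ) × Ξ → StateVec m := fun z =>
    modalSum M (fun i => dt (reconstructionMode Ψ yq wq ust i)) (fun i => b i) z.1.1 z.1.2 z.2
      + modalFluxDeriv C F M (reconstructionMode Ψ yq wq ust) (fun i => b i) z.1.1 z.1.2 z.2
    with hr
  have hrm : Measurable r :=
    (measurable_modalSum (fun i => measurable_dt (hcl i).choose_spec.continuous) hbm).add hfluxm
  have hdiff := ae_restrict_of_ae (s := strip τ)
    (ae_differentiableAt_modes (Ψ := Ψ) (yq := yq) (wq := wq) hl)
  have hpath : (fun y => ∫⁻ p in strip τ,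
      ‖stResidual F (fun t x => stsReconstruction Ψ yq wq M ust t x y) p.1 p.2‖ₑ ^ 2)
      =ᵐ[μ] fun y => ∫⁻ p in strip τ, ‖r (p, y)‖ₑ ^ 2 := by
    filter_upwards [ae_modalSum_mem (M := M) hb hC] with y ⟨hy, hCy⟩
    refine lintegral_congr_ae ?_
    filter_upwards [hdiff] with p hp
    simp only [stsReconstruction_eq_modalSum hy]
    rw [stResidual_modalSum hB hp.2 (hCy _ _)]
  refine ⟨((hrm.enorm.pow_const 2).lintegral_prod_left' (μ := volume.restrict (strip τ))
    ).aemeasurable.congr hpath.symm, ?_⟩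
  rw [lintegral_congr_ae hpath, lintegral_lintegral_swap
    ((hrm.comp measurable_swap).enorm.pow_const 2).aemeasurable]
  -- measurability of the modes
  have hustc : ∀ l, Continuous fun p : ℝ × ℝ => ust l p.1 p.2 := fun l =>
    (hl l).choose_spec.continuous
  have hFc : ∀ l, Continuous fun p : ℝ × ℝ => F (ust l p.1 p.2) := fun l =>
    hB.flux.continuousOn.comp_continuous (hustc l) fun p => hustU l p.1 p.2
  have hdetm : ∀ j, Measurable fun p : ℝ × ℝ => detMode F Ψ yq wq ust j p.1 p.2 := fun j =>
    measurable_nispMode j fun l => (measurable_dt (hustc l)).add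
      (measurable_dx (v := fun s z => F (ust l s z)) (hFc l))
  have hscm : ∀ j, AEMeasurable (fun p : ℝ × ℝ => scMode μ F Ψ yq wq M ust j p.1 p.2)
      (volume.restrict (strip τ)) := by
    intro j
    have h1 : Measurable fun z : (ℝ × ℝ) × Ξ => b j z.2 •
        modalFluxDeriv C F M (reconstructionMode Ψ yq wq ust) (fun i => b i) z.1.1 z.1.2 z.2 :=
      ((hbm j).comp measurable_snd).smul hfluxm
    refine (h1.stronglyMeasurable.integral_prod_right' (ν := μ)).measurable.aemeasurable.congr ?_
    filter_upwards [hdiff] with p hp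
    exact (integral_dx_flux_eq hB hb hC hp.2 j).symm
  have hsqm : ∀ j, AEMeasurable (fun p : ℝ × ℝ => sqMode μ F Ψ yq wq M ust j p.1 p.2)
      (volume.restrict (strip τ)) := fun j => (hscm j).sub
    (measurable_nispMode j fun l =>
      measurable_dx (v := fun s z => F (ust l s z)) (hFc l)).aemeasurable
  have hle := lintegral_mono_ae (μ := volume.restrict (strip τ)) (hdiff.mono fun p hp =>
    lintegral_residual_sq_le hB b hb hl hC hp.1 hp.2)
  refine hle.trans (le_of_eq ?_)
  have a1 : ∀ j, AEMeasurable (fun p : ℝ × ℝ => 2 * ‖detMode F Ψ yq wq ust j p.1 p.2‖ₑ ^ 2)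
      (volume.restrict (strip τ)) := fun j =>
    (((hdetm j).enorm.pow_const 2).const_mul 2).aemeasurable
  have a2 : ∀ j, AEMeasurable (fun p : ℝ × ℝ => 2 * ‖sqMode μ F Ψ yq wq M ust j p.1 p.2‖ₑ ^ 2)
      (volume.restrict (strip τ)) := fun j => ((hsqm j).enorm.pow_const 2).const_mul 2
  have a3 : ∀ j, AEMeasurable (fun p : ℝ × ℝ => 2 * ‖detMode F Ψ yq wq ust j p.1 p.2‖ₑ ^ 2
      + 2 * ‖sqMode μ F Ψ yq wq M ust j p.1 p.2‖ₑ ^ 2) (volume.restrict (strip τ)) :=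
    fun j => (a1 j).add (a2 j)
  rw [lintegral_add_left' (Finset.aemeasurable_fun_sum _ fun j _ => a3 j),
    lintegral_finsetSum' _ fun j _ => a3 j,
    lintegral_tsum fun k => (hscm _).enorm.pow_const 2]
  have e1 : ∀ j, ∫⁻ p in strip τ, (2 * ‖detMode F Ψ yq wq ust j p.1 p.2‖ₑ ^ 2
      + 2 * ‖sqMode μ F Ψ yq wq M ust j p.1 p.2‖ₑ ^ 2)
      = 2 * sqNormST τ (detMode F Ψ yq wq ust j) + 2 * sqNormST τ (sqMode μ F Ψ yq wq M ust j) := by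
    intro j
    rw [lintegral_add_left' (a1 j), lintegral_const_mul' _ _ ENNReal.ofNat_ne_top,
      lintegral_const_mul' _ _ ENNReal.ofNat_ne_top]
    simp only [sqNormST, eLpNorm_two_sq]
  simp only [e1, detResidual, sqResidual, scResidual, Finset.sum_add_distrib, Finset.mul_sum]
  congr 1
  simp only [sqNormST, eLpNorm_two_sq]

end Residual

/-! ### The error estimate for globally Lipschitz reconstructions -/

section Estimate

variable {m M R : ℕ} {Ξ : Type*} [MeasurableSpace Ξ] {μ : Measure Ξ} {U C : Set (StateVec m)}
  {F : StateVec m → StateVec m} {η q : StateVec m → ℝ} {cF ηlow ηup : ℝ}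
  {Ψ : ℕ → Ξ → ℝ} {yq : Fin (R + 1) → Ξ} {wq : Fin (R + 1) → ℝ}
  {ust : Fin (R + 1) → ℝ → ℝ → StateVec m}

/-- The essential supremum over two of three variables is measurable in the third one, and it bounds
almost every section. -/
theorem exists_measurable_essSup_essSup [SFinite μ] {g : (ℝ × ℝ) × Ξ → ℝ≥0∞} (hg : Measurable g) :
    ∃ S : ℝ → ℝ≥0∞, Measurable S ∧
      (∀ t, S t = essSup (fun y => essSup (fun x => g ((t, x), y)) volume) μ) ∧
      ∀ᵐ y ∂μ, ∀ᵐ p : ℝ × ℝ, g (p, y) ≤ S p.1 := by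
  have hg' : Measurable fun z : (ℝ × Ξ) × ℝ => g ((z.1.1, z.2), z.1.2) :=
    hg.comp (((measurable_fst.comp measurable_fst).prodMk measurable_snd).prodMk
      (measurable_snd.comp measurable_fst))
  obtain ⟨H, hHm, hH⟩ : ∃ H : ℝ × Ξ → ℝ≥0∞, Measurable H ∧
      ∀ a, H a = essSup (fun x => g ((a.1, x), a.2)) volume :=
    ⟨_, measurable_essSup_prod hg', fun _ => rfl⟩
  obtain ⟨S, hSm, hS⟩ : ∃ S : ℝ → ℝ≥0∞, Measurable S ∧
      ∀ t, S t = essSup (fun y => H (t, y)) μ := ⟨_, measurable_essSup_prod hHm, fun _ => rfl⟩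
  refine ⟨S, hSm, fun t => by simp only [hS, hH], ?_⟩
  have h1 : ∀ᵐ t : ℝ, ∀ᵐ y ∂μ, H (t, y) ≤ S t := ae_of_all _ fun t => by
    rw [hS]; exact ENNReal.ae_le_essSup fun y => H (t, y)
  rw [Measure.ae_ae_comm (p := fun t y => H (t, y) ≤ S t)
    (measurableSet_le hHm (hSm.comp measurable_fst))] at h1
  filter_upwards [h1] with y h1y
  have hm : MeasurableSet {p : ℝ × ℝ | g (p, y) ≤ S p.1} :=
    measurableSet_le (hg.comp (measurable_id.prodMk measurable_const)) (hSm.comp measurable_fst)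
  rw [Measure.volume_eq_prod, Measure.ae_prod_iff_ae_ae hm]
  filter_upwards [h1y] with t ht
  rw [hH] at ht
  exact (ENNReal.ae_le_essSup fun x => g ((t, x), y)).mono fun x hx => hx.trans ht

theorem lintegral_le_of_ae_le_affine {X A B : Ξ → ℝ≥0∞} {c d G : ℝ≥0∞} (hA : AEMeasurable A μ)
    (hB : AEMeasurable B μ) (h : ∀ᵐ y ∂μ, X y ≤ c * (d * A y + B y) * G) :
    ∫⁻ y, X y ∂μ ≤ c * (d * (∫⁻ y, A y ∂μ) + ∫⁻ y, B y ∂μ) * G := by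
  have h1 : AEMeasurable (fun y => d * A y + B y) μ := (hA.const_mul d).add hB
  refine (lintegral_mono_ae h).trans (le_of_eq ?_)
  rw [lintegral_mul_const'' _ (h1.const_mul c), lintegral_const_mul'' _ h1,
    lintegral_add_left' (hA.const_mul d), lintegral_const_mul'' _ hA]

/-- The essential supremum of `∂ₓ ûˢᵗˢ` over `(x, y)` has a measurable version in time, and this
version bounds almost every path. -/
theorem exists_measurable_supNorm_dx [SFinite μ] {b : ℕ → Ξ → ℝ} (hbm : ∀ i, Measurable (b i))
    (hb : ∀ i, b i =ᵐ[μ] Ψ i)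
    (hl : ∀ l, ∃ K, LipschitzWith K fun p : ℝ × ℝ => ust l p.1 p.2) :
    ∃ S : ℝ → ℝ≥0∞, Measurable S ∧
      (∀ᵐ t, S t = supNormXi μ fun x y =>
        dx (fun s z => stsReconstruction Ψ yq wq M ust s z y) t x) ∧
      ∀ᵐ y ∂μ, ∀ᵐ p : ℝ × ℝ,
        ‖dx (fun s z => stsReconstruction Ψ yq wq M ust s z y) p.1 p.2‖ₑ ≤ S p.1 := by
  have hcl := exists_lipschitzWith_reconstructionMode (Ψ := Ψ) (yq := yq) (wq := wq) hl
  have hdiff := ae_differentiableAt_modes (Ψ := Ψ) (yq := yq) (wq := wq) hl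
  have hdiff2 : ∀ᵐ t : ℝ, ∀ᵐ x : ℝ, ∀ i, DifferentiableAt ℝ
      (fun p : ℝ × ℝ => reconstructionMode Ψ yq wq ust i p.1 p.2) (t, x) := by
    rw [Measure.volume_eq_prod] at hdiff
    exact (Measure.ae_ae_of_ae_prod hdiff).mono fun t ht => ht.mono fun x hx => hx.2
  have hg0 : Measurable fun z : (ℝ × ℝ) × Ξ =>
      ‖modalSum M (fun i => dx (reconstructionMode Ψ yq wq ust i)) b z.1.1 z.1.2 z.2‖ₑ :=
    (measurable_modalSum (fun i => measurable_dx (hcl i).choose_spec.continuous) hbm).enorm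
  obtain ⟨S, hSm, hS, hSb⟩ := exists_measurable_essSup_essSup (μ := μ) hg0
  have hgood : ∀ᵐ y ∂μ, ∀ i, b i y = Ψ i y := ae_all_iff.2 hb
  refine ⟨S, hSm, ?_, ?_⟩
  · filter_upwards [hdiff2] with t ht
    rw [hS]
    refine essSup_congr_ae ?_
    filter_upwards [hgood] with y hy
    rw [eLpNorm_exponent_top]
    refine essSup_congr_ae ?_
    filter_upwards [ht] with x hx
    simp only [stsReconstruction_eq_modalSum hy]
    rw [dx_modalSum (p := (t, x)) hx]
  · filter_upwards [hSb, hgood] with y hSy hy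
    filter_upwards [hSy, hdiff] with p hp hpd
    simp only [stsReconstruction_eq_modalSum hy]
    rw [dx_modalSum hpd.2]
    exact hp

/-- The estimate along one path, with the constant of Gronwall's inequality expressed through an
upper bound of the spatial derivative which may be infinite at some times. -/
theorem EntropyBounds.path_estimate_lintegral (hB : EntropyBounds U C F η q cF ηlow ηup) {T : ℝ}
    (hT : 0 < T) {u0 : ℝ → StateVec m} {u v : ℝ → ℝ → StateVec m}
    (hu : IsEntropySolution U F η q T u0 u) (hum : Measurable fun p : ℝ × ℝ => u p.1 p.2)
    (huC : ∀ t ∈ Icc 0 T, ∀ᵐ x, u t x ∈ C)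
    (hv : ∃ K, LipschitzWith K fun p : ℝ × ℝ => v p.1 p.2) (hvC : ∀ t x, v t x ∈ C)
    {S : ℝ → ℝ≥0∞} (hS : Measurable S)
    (hSv : ∀ᵐ p : ℝ × ℝ, ‖dx v p.1 p.2‖ₑ ≤ S p.1) {τ : ℝ} (hτ : τ ∈ Icc 0 T) :
    ∫⁻ x, ‖u τ x - v τ x‖ₑ ^ 2
      ≤ ENNReal.ofReal ηlow⁻¹ * (ENNReal.ofReal ηup * (∫⁻ x, ‖u 0 x - v 0 x‖ₑ ^ 2)
          + ∫⁻ p in strip τ, ‖stResidual F v p.1 p.2‖ₑ ^ 2)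
        * EReal.exp ((ENNReal.ofReal ηlow⁻¹ * ∫⁻ t in Ioo 0 τ,
            (ENNReal.ofReal (ηup * cF) * S t + ENNReal.ofReal (ηup ^ 2)) : ℝ≥0∞) : EReal) := by
  obtain ⟨K, hK⟩ := hv
  have hup : 0 < ηup := hB.low_pos.trans hB.low_lt_up
  have hfin : ∀ t, min (S t) (K : ℝ≥0∞) ≠ ∞ := fun t =>
    ((min_le_right _ _).trans_lt ENNReal.coe_lt_top).ne
  -- the Lipschitz constant of the path makes the rate bounded where `S` is large or infinite
  set L : ℝ → ℝ := fun t => (min (S t) (K : ℝ≥0∞)).toReal with hL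
  have hLm : Measurable L := (hS.min measurable_const).ennreal_toReal
  have hL0 : ∀ t, 0 ≤ L t := fun t => ENNReal.toReal_nonneg
  have hLK : ∀ t, L t ≤ K := fun t => by
    have := ENNReal.toReal_mono ENNReal.coe_ne_top (min_le_right (S t) (K : ℝ≥0∞))
    simpa [hL] using this
  have hLS : ∀ t, ENNReal.ofReal (L t) ≤ S t := fun t => by
    rw [hL, ENNReal.ofReal_toReal (hfin t)]; exact min_le_left _ _
  have hLv : ∀ᵐ p ∂(volume : Measure (ℝ × ℝ)).restrict (strip T), ‖dx v p.1 p.2‖ ≤ L p.1 := by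
    filter_upwards [ae_restrict_of_ae hSv] with p hp
    have h1 : ‖dx v p.1 p.2‖ₑ ≤ K := by
      rw [enorm_eq_nnnorm]; exact_mod_cast hK.norm_dx_le p.1 p.2
    have h2 := ENNReal.toReal_mono (hfin p.1) (le_min hp h1)
    rwa [toReal_enorm] at h2
  refine (hB.path_estimate hT hu hum huC hK hvC hLm hL0 hLK hLv hτ).trans ?_
  refine mul_le_mul_right (ofReal_exp_le_EReal_exp ?_) _
  have hk0 : ∀ t, 0 ≤ ηlow⁻¹ * (ηup * cF * L t + ηup ^ 2) := fun t => by
    have := hL0 t; have := hB.low_pos; have := hB.cF_pos; positivity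
  have hint : IntegrableOn (fun t => ηlow⁻¹ * (ηup * cF * L t + ηup ^ 2)) (Ioo 0 τ) := by
    refine Measure.integrableOn_of_bounded (M := ηlow⁻¹ * (ηup * cF * K + ηup ^ 2)) (by simp)
      (((hLm.const_mul _).add_const _).const_mul _).aestronglyMeasurable (ae_of_all _ fun t => ?_)
    rw [Real.norm_of_nonneg (hk0 t)]
    have := hB.low_pos; have := hB.cF_pos; have := hLK t
    gcongr
  rw [intervalIntegral.integral_of_le hτ.1, integral_Ioc_eq_integral_Ioo,
    ofReal_integral_eq_lintegral_ofReal hint (ae_of_all _ hk0),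
    ← lintegral_const_mul' _ _ ENNReal.ofReal_ne_top]
  refine lintegral_mono fun t => ?_
  have hcu : 0 ≤ ηup * cF := mul_nonneg hup.le hB.cF_pos.le
  rw [ENNReal.ofReal_mul (inv_nonneg.2 hB.low_pos.le),
    ENNReal.ofReal_add (mul_nonneg hcu (hL0 t)) (sq_nonneg _), ENNReal.ofReal_mul hcu]
  gcongr
  exact hLS t

theorem aemeasurable_lintegral_sub_sts_sq [SFinite μ] {b : ℕ → Ξ → ℝ}
    (hbm : ∀ i, Measurable (b i)) (hb : ∀ i, b i =ᵐ[μ] Ψ i)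
    (hl : ∀ l, ∃ K, LipschitzWith K fun p : ℝ × ℝ => ust l p.1 p.2)
    {u : ℝ → ℝ → Ξ → StateVec m} (hum : Measurable fun p : ℝ × ℝ × Ξ => u p.1 p.2.1 p.2.2)
    (t : ℝ) :
    AEMeasurable (fun y => ∫⁻ x, ‖u t x y - stsReconstruction Ψ yq wq M ust t x y‖ₑ ^ 2) μ := by
  have hcl := exists_lipschitzWith_reconstructionMode (Ψ := Ψ) (yq := yq) (wq := wq) hl
  have h1 : Measurable fun z : ℝ × Ξ => u t z.1 z.2
      - modalSum M (reconstructionMode Ψ yq wq ust) b t z.1 z.2 :=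
    (hum.comp (measurable_const.prodMk measurable_id)).sub
      ((measurable_modalSum (fun i => (hcl i).choose_spec.continuous.measurable) hbm).comp
        ((measurable_const.prodMk measurable_fst).prodMk measurable_snd))
  refine ((h1.enorm.pow_const 2).lintegral_prod_left' (μ := volume)).aemeasurable.congr ?_
  filter_upwards [ae_all_iff.2 hb] with y hy
  simp only [stsReconstruction_eq_modalSum hy]

/-- The distance between the random entropy solution and a globally Lipschitz reconstruction. -/
theorem sqNormXi_sub_sts_le [IsFiniteMeasure μ] (hB : EntropyBounds U C F η q cF ηlow ηup)
    (hΨ : IsOrthonormalBasisL2 μ Ψ) {T : ℝ} (hT : 0 < T) {u0 : ℝ → Ξ → StateVec m}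
    {u : ℝ → ℝ → Ξ → StateVec m} (hu : IsRandomEntropySolution μ U F η q T u0 u)
    (huC : ∀ᵐ y ∂μ, ∀ t ∈ Icc 0 T, ∀ᵐ x, u t x y ∈ C)
    (hl : ∀ l, ∃ K, LipschitzWith K fun p : ℝ × ℝ => ust l p.1 p.2)
    (hustU : ∀ l t x, ust l t x ∈ U)
    (hC : ∀ᵐ y ∂μ, ∀ t x, stsReconstruction Ψ yq wq M ust t x y ∈ C) {τ : ℝ}
    (hτ : τ ∈ Icc 0 T) :
    AEMeasurable (fun y => ∫⁻ x, ‖u τ x y - stsReconstruction Ψ yq wq M ust τ x y‖ₑ ^ 2) μ ∧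
    sqNormXi μ (fun x y => u τ x y - stsReconstruction Ψ yq wq M ust τ x y)
      ≤ ENNReal.ofReal ηlow⁻¹
        * (2 * detResidual F Ψ yq wq M ust τ + 2 * sqResidual μ F Ψ yq wq M ust τ
            + scResidual μ F Ψ yq wq M ust τ
            + ENNReal.ofReal ηup
              * sqNormXi μ (fun x y => u0 x y - stsReconstruction Ψ yq wq M ust 0 x y))
        * EReal.exp ((ENNReal.ofReal ηlow⁻¹ * ∫⁻ t in Ioo 0 τ,
            (ENNReal.ofReal (ηup * cF)
                * supNormXi μ (fun x y =>
                    dx (fun s z => stsReconstruction Ψ yq wq M ust s z y) t x)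
              + ENNReal.ofReal (ηup ^ 2)) : ℝ≥0∞) : EReal) := by
  obtain ⟨b, hb⟩ := hΨ
  have hbm : ∀ i, Measurable (b i : Ξ → ℝ) := fun i => (Lp.stronglyMeasurable (b i)).measurable
  have hcl := exists_lipschitzWith_reconstructionMode (Ψ := Ψ) (yq := yq) (wq := wq) hl
  obtain ⟨S, hSm, hSeq, hSb⟩ := exists_measurable_supNorm_dx (M := M) (yq := yq) (wq := wq)
    hbm hb hl
  have hmeas := fun t => aemeasurable_lintegral_sub_sts_sq (M := M) (yq := yq) (wq := wq)
    hbm hb hl hu.measurable t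
  obtain ⟨hRm, hR⟩ := lintegral_stResidual_le (M := M) hB b hb hl hustU hC τ
  refine ⟨hmeas τ, ?_⟩
  have hS : ∫⁻ t in Ioo 0 τ, (ENNReal.ofReal (ηup * cF)
        * supNormXi μ (fun x y => dx (fun s z => stsReconstruction Ψ yq wq M ust s z y) t x)
      + ENNReal.ofReal (ηup ^ 2))
      = ∫⁻ t in Ioo 0 τ, (ENNReal.ofReal (ηup * cF) * S t + ENNReal.ofReal (ηup ^ 2)) := by
    refine lintegral_congr_ae ?_
    filter_upwards [ae_restrict_of_ae hSeq] with t ht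
    rw [ht]
  rw [hS]
  set G : ℝ≥0∞ := EReal.exp ((ENNReal.ofReal ηlow⁻¹ * ∫⁻ t in Ioo 0 τ,
    (ENNReal.ofReal (ηup * cF) * S t + ENNReal.ofReal (ηup ^ 2)) : ℝ≥0∞) : EReal) with hG
  have hpath : ∀ᵐ y ∂μ, ∫⁻ x, ‖u τ x y - stsReconstruction Ψ yq wq M ust τ x y‖ₑ ^ 2
      ≤ ENNReal.ofReal ηlow⁻¹ * (ENNReal.ofReal ηup
            * (∫⁻ x, ‖u 0 x y - stsReconstruction Ψ yq wq M ust 0 x y‖ₑ ^ 2)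
          + ∫⁻ p in strip τ,
            ‖stResidual F (fun t x => stsReconstruction Ψ yq wq M ust t x y) p.1 p.2‖ₑ ^ 2)
        * G := by
    filter_upwards [hu.path, huC, hC, hSb, ae_all_iff.2 hb] with y huy huCy hCy hSy hy
    have hlip : ∃ K, LipschitzWith K fun p : ℝ × ℝ =>
        stsReconstruction Ψ yq wq M ust p.1 p.2 y := by
      simp only [stsReconstruction_eq_modalSum hy]
      exact exists_lipschitzWith_modalSum hcl y
    have humy : Measurable fun p : ℝ × ℝ => u p.1 p.2 y :=
      hu.measurable.comp (measurable_fst.prodMk (measurable_snd.prodMk measurable_const))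
    exact hB.path_estimate_lintegral hT huy humy huCy
      (v := fun t x => stsReconstruction Ψ yq wq M ust t x y) hlip hCy hSm hSy hτ
  have hinit : ∫⁻ y, (∫⁻ x, ‖u 0 x y - stsReconstruction Ψ yq wq M ust 0 x y‖ₑ ^ 2) ∂μ
      = sqNormXi μ (fun x y => u0 x y - stsReconstruction Ψ yq wq M ust 0 x y) := by
    refine lintegral_congr_ae ?_
    filter_upwards [hu.path, huC] with y huy huCy
    have humy : Measurable fun p : ℝ × ℝ => u p.1 p.2 y :=
      hu.measurable.comp (measurable_fst.prodMk (measurable_snd.prodMk measurable_const))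
    have h0 := huy.initial_eq hT hB.compact (hB.flux.continuousOn.mono hB.subset)
      (ae_strip_of_forall_ae humy hB.compact.measurableSet huCy)
    rw [eLpNorm_two_sq]
    refine lintegral_congr_ae ?_
    filter_upwards [h0] with x hx
    rw [hx]
  have hstep := lintegral_le_of_ae_le_affine (hmeas 0) hRm hpath
  rw [hinit] at hstep
  have e : sqNormXi μ (fun x y => u τ x y - stsReconstruction Ψ yq wq M ust τ x y)
      = ∫⁻ y, (∫⁻ x, ‖u τ x y - stsReconstruction Ψ yq wq M ust τ x y‖ₑ ^ 2) ∂μ := by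
    simp only [sqNormXi, eLpNorm_two_sq]
  rw [e]
  refine hstep.trans ?_
  rw [add_comm (ENNReal.ofReal ηup * _)]
  gcongr

end Estimate

/-! ### Extension of the reconstructions in time -/

section TimeExtension

variable {m M R : ℕ} {T : ℝ}

/-- The extension of a function on `[0, T] × ℝ` to all times by its values at the end points. -/
noncomputable def timeExtension (T : ℝ) (v : ℝ → ℝ → StateVec m) (t x : ℝ) : StateVec m :=
  v (max 0 (min t T)) x

theorem timeExtension_of_mem {v : ℝ → ℝ → StateVec m} {t : ℝ} (ht : t ∈ Icc 0 T) (x : ℝ) :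
    timeExtension T v t x = v t x := by
  rw [timeExtension, min_eq_left ht.2, max_eq_right ht.1]

theorem clamp_mem_Icc (hT : 0 ≤ T) (t : ℝ) : max 0 (min t T) ∈ Icc 0 T :=
  ⟨le_max_left _ _, max_le hT (min_le_right _ _)⟩

theorem exists_lipschitzWith_timeExtension (hT : 0 ≤ T) {v : ℝ → ℝ → StateVec m}
    (hv : ∃ K, LipschitzOnWith K (fun z : ℝ × ℝ => v z.1 z.2) (Icc 0 T ×ˢ univ)) :
    ∃ K, LipschitzWith K fun p : ℝ × ℝ => timeExtension T v p.1 p.2 := by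
  obtain ⟨K, hK⟩ := hv
  have h1 : LipschitzWith (max 1 1) fun p : ℝ × ℝ => (max 0 (min p.1 T), p.2) :=
    ((LipschitzWith.prod_fst.min_const T).const_max 0).prodMk LipschitzWith.prod_snd
  have h2 : MapsTo (fun p : ℝ × ℝ => (max 0 (min p.1 T), p.2)) univ (Icc 0 T ×ˢ univ) :=
    fun p _ => ⟨clamp_mem_Icc hT p.1, mem_univ _⟩
  have h3 := hK.comp h1.lipschitzOnWith h2
  exact ⟨K * max 1 1, lipschitzOnWith_univ.1 h3⟩

theorem dt_timeExtension {v : ℝ → ℝ → StateVec m} {t : ℝ} (ht : t ∈ Ioo 0 T) (x : ℝ) :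
    dt (timeExtension T v) t x = dt v t x := by
  refine Filter.EventuallyEq.deriv_eq ?_
  filter_upwards [Ioo_mem_nhds ht.1 ht.2] with s hs
  exact timeExtension_of_mem (Ioo_subset_Icc_self hs) x

theorem sqNormST_congr {τ : ℝ} {v w : ℝ → ℝ → StateVec m}
    (h : ∀ t ∈ Ioo 0 τ, ∀ x, v t x = w t x) : sqNormST τ v = sqNormST τ w := by
  unfold sqNormST
  congr 1
  refine eLpNorm_congr_ae (ae_restrict_of_forall_mem (measurableSet_strip τ) fun p hp => ?_)
  exact h p.1 hp.1 p.2

variable {Ξ : Type*} {F : StateVec m → StateVec m} {Ψ : ℕ → Ξ → ℝ}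
  {yq : Fin (R + 1) → Ξ} {wq : Fin (R + 1) → ℝ} {ust : Fin (R + 1) → ℝ → ℝ → StateVec m}

theorem stsReconstruction_timeExtension (t x : ℝ) (y : Ξ) :
    stsReconstruction Ψ yq wq M (fun l => timeExtension T (ust l)) t x y
      = stsReconstruction Ψ yq wq M ust (max 0 (min t T)) x y :=
  rfl

theorem stsReconstruction_timeExtension_of_mem {t : ℝ} (ht : t ∈ Icc 0 T) (x : ℝ) (y : Ξ) :
    stsReconstruction Ψ yq wq M (fun l => timeExtension T (ust l)) t x y
      = stsReconstruction Ψ yq wq M ust t x y := by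
  rw [stsReconstruction_timeExtension, min_eq_left ht.2, max_eq_right ht.1]

theorem detMode_timeExtension {t : ℝ} (ht : t ∈ Ioo 0 T) (j : ℕ) (x : ℝ) :
    detMode F Ψ yq wq (fun l => timeExtension T (ust l)) j t x = detMode F Ψ yq wq ust j t x := by
  simp only [detMode, stResidual, dt_timeExtension ht, dx,
    timeExtension_of_mem (Ioo_subset_Icc_self ht)]

theorem detResidual_timeExtension {τ : ℝ} (hτ : τ ≤ T) :
    detResidual F Ψ yq wq M (fun l => timeExtension T (ust l)) τ
      = detResidual F Ψ yq wq M ust τ :=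
  Finset.sum_congr rfl fun j _ => sqNormST_congr fun _ ht x =>
    detMode_timeExtension (Ioo_subset_Ioo_right hτ ht) j x

variable [MeasurableSpace Ξ] {μ : Measure Ξ}

theorem scMode_timeExtension {t : ℝ} (ht : t ∈ Icc 0 T) (j : ℕ) (x : ℝ) :
    scMode μ F Ψ yq wq M (fun l => timeExtension T (ust l)) j t x
      = scMode μ F Ψ yq wq M ust j t x := by
  simp only [scMode, dx, stsReconstruction_timeExtension_of_mem ht]

theorem sqMode_timeExtension {t : ℝ} (ht : t ∈ Icc 0 T) (j : ℕ) (x : ℝ) :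
    sqMode μ F Ψ yq wq M (fun l => timeExtension T (ust l)) j t x
      = sqMode μ F Ψ yq wq M ust j t x := by
  simp only [sqMode, dx, stsReconstruction_timeExtension_of_mem ht, timeExtension_of_mem ht]

theorem sqResidual_timeExtension {τ : ℝ} (hτ : τ ≤ T) :
    sqResidual μ F Ψ yq wq M (fun l => timeExtension T (ust l)) τ
      = sqResidual μ F Ψ yq wq M ust τ :=
  Finset.sum_congr rfl fun j _ => sqNormST_congr fun _ ht x =>
    sqMode_timeExtension (Ioo_subset_Icc_self (Ioo_subset_Ioo_right hτ ht)) j x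

theorem scResidual_timeExtension {τ : ℝ} (hτ : τ ≤ T) :
    scResidual μ F Ψ yq wq M (fun l => timeExtension T (ust l)) τ
      = scResidual μ F Ψ yq wq M ust τ :=
  tsum_congr fun k => sqNormST_congr fun _ ht x =>
    scMode_timeExtension (Ioo_subset_Icc_self (Ioo_subset_Ioo_right hτ ht)) (M + 1 + k) x

variable {U C : Set (StateVec m)} {η q : StateVec m → ℝ} {cF ηlow ηup : ℝ}

/-- The distance between the random entropy solution and a reconstruction which is Lipschitz
continuous on `[0, T] × ℝ`. -/
theorem sqNormXi_sub_sts_le_of_lipschitzOnWith [IsFiniteMeasure μ]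
    (hB : EntropyBounds U C F η q cF ηlow ηup)
    (hΨ : IsOrthonormalBasisL2 μ Ψ) (hT : 0 < T) {u0 : ℝ → Ξ → StateVec m}
    {u : ℝ → ℝ → Ξ → StateVec m} (hu : IsRandomEntropySolution μ U F η q T u0 u)
    (huC : ∀ᵐ y ∂μ, ∀ t ∈ Icc 0 T, ∀ᵐ x, u t x y ∈ C)
    (hl : ∀ l, ∃ K, LipschitzOnWith K (fun z : ℝ × ℝ => ust l z.1 z.2) (Icc 0 T ×ˢ univ))
    (hustU : ∀ l, ∀ t ∈ Icc 0 T, ∀ x, ust l t x ∈ U)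
    (hC : ∀ᵐ y ∂μ, ∀ t ∈ Icc 0 T, ∀ x, stsReconstruction Ψ yq wq M ust t x y ∈ C) {τ : ℝ}
    (hτ : τ ∈ Icc 0 T) :
    AEMeasurable (fun y => ∫⁻ x, ‖u τ x y - stsReconstruction Ψ yq wq M ust τ x y‖ₑ ^ 2) μ ∧
    sqNormXi μ (fun x y => u τ x y - stsReconstruction Ψ yq wq M ust τ x y)
      ≤ ENNReal.ofReal ηlow⁻¹
        * (2 * detResidual F Ψ yq wq M ust τ + 2 * sqResidual μ F Ψ yq wq M ust τ
            + scResidual μ F Ψ yq wq M ust τ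
            + ENNReal.ofReal ηup
              * sqNormXi μ (fun x y => u0 x y - stsReconstruction Ψ yq wq M ust 0 x y))
        * EReal.exp ((ENNReal.ofReal ηlow⁻¹ * ∫⁻ t in Ioo 0 τ,
            (ENNReal.ofReal (ηup * cF)
                * supNormXi μ (fun x y =>
                    dx (fun s z => stsReconstruction Ψ yq wq M ust s z y) t x)
              + ENNReal.ofReal (ηup ^ 2)) : ℝ≥0∞) : EReal) := by
  have key := sqNormXi_sub_sts_le (M := M) (yq := yq) (wq := wq)
    (ust := fun l => timeExtension T (ust l)) hB hΨ hT hu huC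
    (fun l => exists_lipschitzWith_timeExtension hT.le (hl l))
    (fun l t x => hustU l _ (clamp_mem_Icc hT.le t) x)
    (hC.mono fun y hy t x => hy _ (clamp_mem_Icc hT.le t) x) hτ
  have hsup : ∫⁻ t in Ioo 0 τ, (ENNReal.ofReal (ηup * cF)
        * supNormXi μ (fun x y => dx (fun s z =>
            stsReconstruction Ψ yq wq M (fun l => timeExtension T (ust l)) s z y) t x)
      + ENNReal.ofReal (ηup ^ 2))
      = ∫⁻ t in Ioo 0 τ, (ENNReal.ofReal (ηup * cF)
        * supNormXi μ (fun x y => dx (fun s z => stsReconstruction Ψ yq wq M ust s z y) t x)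
      + ENNReal.ofReal (ηup ^ 2)) := by
    refine setLIntegral_congr_fun measurableSet_Ioo fun t ht => ?_
    have ht' : t ∈ Icc 0 T := ⟨ht.1.le, ht.2.le.trans hτ.2⟩
    simp only [dx, stsReconstruction_timeExtension_of_mem ht']
  rw [hsup, detResidual_timeExtension hτ.2, sqResidual_timeExtension hτ.2,
    scResidual_timeExtension hτ.2] at key
  simp only [stsReconstruction_timeExtension_of_mem hτ,
    stsReconstruction_timeExtension_of_mem (left_mem_Icc.2 hT.le)] at key
  exact key

end TimeExtension

/-! ### The a posteriori estimate -/

/-- The triangle inequality for the squared norms. No measurability of `w` is needed: the integral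
of a sum splits as soon as one summand is measurable. -/
theorem sqNormXi_sub_le {Ξ : Type*} [MeasurableSpace Ξ] {μ : Measure Ξ} {m : ℕ}
    {f g w : ℝ → Ξ → StateVec m} (hx : ∀ᵐ y ∂μ, Measurable fun x => f x y - g x y)
    (hy : AEMeasurable (fun y => ∫⁻ x, ‖f x y - g x y‖ₑ ^ 2) μ) :
    sqNormXi μ (fun x y => f x y - w x y)
      ≤ 2 * sqNormXi μ (fun x y => g x y - w x y) + 2 * sqNormXi μ (fun x y => f x y - g x y) := by
  simp only [sqNormXi, eLpNorm_two_sq]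
  rw [← lintegral_const_mul' _ _ ENNReal.ofNat_ne_top, ← lintegral_const_mul' _ _
    ENNReal.ofNat_ne_top, ← lintegral_add_right' _ (hy.const_mul 2)]
  refine lintegral_mono_ae ?_
  filter_upwards [hx] with y hxy
  rw [← lintegral_const_mul' _ _ ENNReal.ofNat_ne_top, ← lintegral_const_mul' _ _
    ENNReal.ofNat_ne_top, ← lintegral_add_right _ ((hxy.enorm.pow_const 2).const_mul 2)]
  refine lintegral_mono fun x => ?_
  have := enorm_add_sq_le (g x y - w x y) (f x y - g x y)
  rwa [sub_add_sub_comm, add_comm (g x y), sub_add_eq_sub_sub_swap, add_sub_cancel_right] at this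

theorem theorem2
    -- the random parameter `ξ` with values in `Ξ ⊆ ℝ`, its density `wξ` and its law `μ`
    {Ω : Type*} [MeasurableSpace Ω] (P : Measure Ω) [IsProbabilityMeasure P]
    (Ξ : Set ℝ) (hΞ : MeasurableSet Ξ) (ξ : Ω → Ξ) (hξ : Measurable ξ)
    (wξ : Ξ → ℝ) (hwξ : Measurable wξ) (hwξ_nonneg : ∀ y, 0 ≤ wξ y)
    (μ : Measure Ξ) (hμ : μ = P.map ξ)
    (hdens : μ = (Measure.comap Subtype.val volume).withDensity (fun y => ENNReal.ofReal (wξ y)))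
    -- the conservation law and its entropy pair
    {m : ℕ} (U : Set (StateVec m)) (hU : IsOpen U)
    (F : StateVec m → StateVec m) (hF : ContDiffOn ℝ 2 F U) (hyp : StrictlyHyperbolic U F)
    (η q : StateVec m → ℝ) (hη : IsEntropyPair U F η q)
    -- the compact convex set of states and the constants of the flux and the entropy on it
    (C : Set (StateVec m)) (hCU : C ⊆ U) (hCconv : Convex ℝ C) (hCcomp : IsCompact C)
    (cF ηlow ηup : ℝ) (hcF : 0 < cF) (hηlow : 0 < ηlow) (hηup : ηlow < ηup)
    (hFbound : ∀ a ∈ C, ∀ v, ‖fderiv ℝ (fderiv ℝ F) a v v‖ ≤ cF * ‖v‖ ^ 2)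
    (hηbound_low : ∀ a ∈ C, ∀ v, ηlow * ‖v‖ ^ 2 ≤ fderiv ℝ (fderiv ℝ η) a v v)
    (hηbound_up : ∀ a ∈ C, ∀ v, fderiv ℝ (fderiv ℝ η) a v v ≤ ηup * ‖v‖ ^ 2)
    -- the random entropy solution
    (T : ℝ) (hT : 0 < T)
    (u0 : ℝ → Ξ → StateVec m) (u : ℝ → ℝ → Ξ → StateVec m)
    (hu : IsRandomEntropySolution μ U F η q T u0 u)
    (huC : ∀ᵐ y ∂μ, ∀ t ∈ Icc 0 T, ∀ᵐ x, u t x y ∈ C)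
    -- the orthonormal basis, the truncation order, the quadrature rule
    (Ψ : ℕ → Ξ → ℝ) (hΨ : IsOrthonormalBasisL2 μ Ψ) (M R : ℕ)
    (yq : Fin (R + 1) → Ξ) (wq : Fin (R + 1) → ℝ)
    -- the time partition, the triangulation, the numerical solutions at the quadrature points
    (N : ℕ) (tp : Fin (N + 1) → ℝ) (htp : StrictMono tp)
    (htp_zero : tp 0 = 0) (htp_last : tp (Fin.last N) = T)
    (x₀ h : ℝ) (hh : 0 < h) (p : ℕ)
    (uh : Fin (N + 1) → Fin (R + 1) → ℝ → StateVec m)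
    (huh : ∀ n l, uh n l ∈ DGSpace m x₀ h p)
    -- the space-time reconstructions at the quadrature points
    (ust : Fin (R + 1) → ℝ → ℝ → StateVec m)
    (hust : ∀ l, IsReconstruction x₀ h p T (ust l))
    (hustU : ∀ l, ∀ t ∈ Icc 0 T, ∀ x, ust l t x ∈ U)
    (hustsC : ∀ᵐ y ∂μ, ∀ t ∈ Icc 0 T, ∀ x, stsReconstruction Ψ yq wq M ust t x y ∈ C)
    (n : Fin (N + 1)) :
    sqNormXi μ (fun x y => u (tp n) x y - nisp Ψ yq wq M (fun l => uh n l x) y)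
      ≤ 2 * sqNormXi μ (fun x y => stsReconstruction Ψ yq wq M ust (tp n) x y
            - nisp Ψ yq wq M (fun l => uh n l x) y)
        + ENNReal.ofReal (2 * ηlow⁻¹)
          * (2 * detResidual F Ψ yq wq M ust (tp n)
              + 2 * sqResidual μ F Ψ yq wq M ust (tp n)
              + scResidual μ F Ψ yq wq M ust (tp n)
              + ENNReal.ofReal ηup
                * sqNormXi μ (fun x y => u0 x y - stsReconstruction Ψ yq wq M ust 0 x y))
          * EReal.exp ((ENNReal.ofReal ηlow⁻¹ * ∫⁻ t in Ioo 0 (tp n),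
              (ENNReal.ofReal (ηup * cF)
                  * supNormXi μ (fun x y =>
                      dx (fun s z => stsReconstruction Ψ yq wq M ust s z y) t x)
                + ENNReal.ofReal (ηup ^ 2)) : ℝ≥0∞) : EReal) := by
  have : IsProbabilityMeasure μ := hμ ▸ Measure.isProbabilityMeasure_map hξ.aemeasurable
  have hB : EntropyBounds U C F η q cF ηlow ηup :=
    ⟨hU, hF, hη, hCU, hCconv, hCcomp, hcF, hηlow, hηup, hFbound, hηbound_low, hηbound_up⟩
  have hτ : tp n ∈ Icc 0 T :=
    ⟨htp_zero ▸ htp.monotone (Fin.zero_le n), htp_last ▸ htp.monotone (Fin.le_last n)⟩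
  obtain ⟨hm, hest⟩ := sqNormXi_sub_sts_le_of_lipschitzOnWith (M := M) (yq := yq) (wq := wq) hB hΨ
    hT hu huC (fun l => (hust l).lipschitz) hustU hustsC hτ
  have hx : ∀ᵐ y ∂μ, Measurable fun x =>
      u (tp n) x y - stsReconstruction Ψ yq wq M ust (tp n) x y := by
    refine ae_of_all _ fun y => ?_
    have h1 : Measurable fun x => u (tp n) x y :=
      hu.measurable.comp (measurable_const.prodMk (measurable_id.prodMk measurable_const))
    refine h1.sub ?_
    unfold stsReconstruction nisp
    refine Finset.measurable_fun_sum _ fun i _ => Measurable.const_smul ?_ (Ψ i y)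
    exact measurable_nispMode i fun l => ((hust l).continuous _ hτ).measurable
  refine (sqNormXi_sub_le hx hm).trans (add_le_add_right ?_ _)
  rw [ENNReal.ofReal_mul zero_le_two, ENNReal.ofReal_ofNat, mul_assoc 2, mul_assoc 2]
  exact mul_le_mul_right hest 2
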